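/- **Setting.** A Jacobi matrix is given by bounded real sequences $a,b$ on $\mathbb Z$ with $\inf_m a_m>0$; it acts on $\ell^2(\mathbb Z)$ by $(\mathscr J\phi)_m=a_{m-1}\phi_{m-1}+b_m\phi_m+a_m\phi_{m+1}$. Let $R>0$, and let $\mathcal J(R)$ be the set of Jacobi matrices with $1/R\le a_m\le R$ and $|b_m|\le R$ for all $m\in\mathbb Z$. A Jacobi matrix is $q$-periodic if $a_{m+q}=a_m$ and $b_{m+q}=b_m$ for all $m$. For a $q$-periodic $\mathscr J$ ($q\ge1$) and $\theta\in\mathbb R$ let $\mathscr J(\theta)$ be the Hermitian $q\times q$ Floquet matrix, with rows and columns indexed by $0,\dots,q-1$: diagonal entries $b_0,\dots,b_{q-1}$, off-diagonal entries $a_0,\dots,a_{q-2}$, lower left corner entry $a_{q-1}e^{2\pi i\theta}$ and upper right corner entry $a_{q-1}e^{-2\pi i\theta}$ (coinciding entries being added if $q\le2$). Let $\lambda_{q,0}(\theta)\le\dots\le\lambda_{q,q-1}(\theta)$ be its eigenvalues, with multiplicity, $P_k(\theta)$ the orthogonal projection of $\mathbb C^q$ onto $\ker(\mathscr J(\theta)-\lambda_{q,k}(\theta))$,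 and $$Q_q(\theta)=\frac{q}{2\pi}\sum_{k=0}^{q-1}\frac{d\lambda_{q,k}}{d\theta}(\theta)\,P_k(\theta),\qquad \theta\in[0,1)\setminus\{0,\tfrac12\}.$$ Let $\mathcal F_q:\ell^2(\mathbb Z)\to L^2([0,1);\mathbb C^q)$ be the unitary Floquet transform, $[\mathcal F_q\phi]_k(\theta)=\sum_{p\in\mathbb Z}\phi_{k+pq}e^{-2\pi ip\theta}$ for $0\le k\le q-1$, and let $Q_q=\mathcal F_q^{-1}\big(\int^{\oplus}_{[0,1)}Q_q(\theta)\,d\theta\big)\mathcal F_q$. Let $X$ be the position operator, $(X\phi)_m=m\phi_m$, with domain $\mathfrak D(X)=\{\phi\in\ell^2(\mathbb Z):(m\phi_m)_m\in\ell^2(\mathbb Z)\}$, and let $X_{\mathscr J}(t)=e^{it\mathscr J}Xe^{-it\mathscr J}$ be its Heisenberg evolution, with domain $\{\phi:e^{-it\mathscr J}\phi\in\mathfrak D(X)\}$. **Statement.** For every $R>0$ there is a constant $c_1>0$, depending only on $R$, with the property (L) $\ |\tfrac{d}{d\theta}\lambda_{q,k}(\theta)|\ge e^{-c_1q}|\sin2\pi\theta|$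 for all $q\ge1$, all $q$-periodic $\mathscr J\in\mathcal J(R)$, all $0\le k\le q-1$ and all $\theta\in\mathbb R\setminus\frac12\mathbb Z$. Moreover, for every $c_1>0$ with property (L) the following holds. Let $\eta>7c_1$ and $\mathscr J\in\mathcal J(R)$. Let $q_0,q_1,\dots$ be positive integers with $q_n\mid q_{n+1}$ and $q_n\ne q_{n+1}$ for all $n\ge 0$, and let $\mathscr J_{q_n}$ be $q_n$-periodic Jacobi matrices with $\mathscr J_{q_n}\in\mathcal J(R)$ for all large $n$ and $$\lim_{n\to\infty}q_{n+1}^3e^{\eta q_n}\|\mathscr J-\mathscr J_{q_n}\|=0.$$ Put $\gamma_n=e^{-\eta q_{n-1}}/q_n^3$ for $n\ge1$, and let $Q_{q_n}$ be the operator defined above for $\mathscr J_{q_n}$ and $q_n$. Then there is $N\ge1$ such that for every $n\ge N$ the family $\theta\mapsto Q_{q_n}(\theta)$ is measurable and essentially bounded (so that $Q_{q_n}$ is a well-defined bounded operator on $\ell^2(\mathbb Z)$), and for all $t>0$, all $\varepsilon>\gamma_n$ and all $\varphi\in\ell^1(\mathbb Z)\cap\mathfrak D(X)$ one has $\varphi\in\mathfrak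 D(X_{\mathscr J_{q_n}}(t))$ and $$\Big\|Q_{q_n}\varphi-\frac1tX_{\mathscr J_{q_n}}(t)\varphi\Big\|\le\frac1t\|X\varphi\|+\|\varphi\|_{\ell^1}\left(\frac{4R^2q_n^2}{t^2\varepsilon^2}+16R^2q_n\,e^{c_1q_{n-1}/2}\sqrt{\varepsilon}\right)^{1/2}.$$ -/

import Mathlib

open Real Set Filter Topology MeasureTheory
open scoped ENNReal

noncomputable section

namespace JacobiTransport

/-- The Hilbert space `ℓ²(ℤ)` of complex sequences. -/
abbrev L2Z : Type := lp (fun _ : ℤ => ℂ) 2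

/-! ### Jacobi matrices -/

lemma weightedShift_memlp (d : ℤ → ℝ) (k : ℤ) {C : ℝ} (hC : ∀ n, |d n| ≤ C) (φ : L2Z) :
    Memℓp (fun n : ℤ => (d n : ℂ) * φ (n + k)) 2 ∧
      ∑' n : ℤ, ‖(d n : ℂ) * φ (n + k)‖ ^ (2 : ℝ≥0∞).toReal ≤
        (C * ‖φ‖) ^ (2 : ℝ≥0∞).toReal := by
  have h2 : (0 : ℝ) < (2 : ℝ≥0∞).toReal := by simp
  have hC0 : 0 ≤ C := (abs_nonneg (d 0)).trans (hC 0)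
  have hs := lp.hasSum_norm h2 φ
  have hs' : HasSum (fun n : ℤ => C ^ (2 : ℝ≥0∞).toReal * ‖φ (n + k)‖ ^ (2 : ℝ≥0∞).toReal)
      ((C * ‖φ‖) ^ (2 : ℝ≥0∞).toReal) := by
    rw [Real.mul_rpow hC0 (norm_nonneg _)]
    exact ((Equiv.addRight k).hasSum_iff.mpr hs).mul_left _
  have hle : ∀ n : ℤ, ‖(d n : ℂ) * φ (n + k)‖ ^ (2 : ℝ≥0∞).toReal ≤
      C ^ (2 : ℝ≥0∞).toReal * ‖φ (n + k)‖ ^ (2 : ℝ≥0∞).toReal := by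
    intro n
    rw [← Real.mul_rpow hC0 (norm_nonneg _)]
    refine Real.rpow_le_rpow (norm_nonneg _) ?_ h2.le
    rw [norm_mul, Complex.norm_real, Real.norm_eq_abs]
    exact mul_le_mul_of_nonneg_right (hC n) (norm_nonneg _)
  have hsum : Summable fun n : ℤ => ‖(d n : ℂ) * φ (n + k)‖ ^ (2 : ℝ≥0∞).toReal :=
    Summable.of_nonneg_of_le (fun n => by positivity) hle hs'.summable
  exact ⟨memℓp_gen hsum, (hsum.tsum_le_tsum hle hs'.summable).trans hs'.tsum_eq.le⟩

/-- The bounded operator `(Tφ)_n = d_n φ_{n+k}` on `ℓ²(ℤ)`, for a bounded real sequence `d`. -/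
def weightedShift (d : ℤ → ℝ) (k : ℤ) (hd : ∃ C, ∀ n, |d n| ≤ C) : L2Z →L[ℂ] L2Z :=
  LinearMap.mkContinuousOfExistsBound
    { toFun := fun φ =>
        ⟨fun n => (d n : ℂ) * φ (n + k), (weightedShift_memlp d k hd.choose_spec φ).1⟩
      map_add' := fun φ ψ => by
        ext n
        exact mul_add (d n : ℂ) (φ (n + k)) (ψ (n + k))
      map_smul' := fun c φ => by
        ext n
        exact mul_left_comm (d n : ℂ) c (φ (n + k)) }
    ⟨hd.choose, fun φ => lp.norm_le_of_tsum_le (by simp)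
      (mul_nonneg ((abs_nonneg (d 0)).trans (hd.choose_spec 0)) (norm_nonneg φ))
      (weightedShift_memlp d k hd.choose_spec φ).2⟩

/-- The coefficients of a Jacobi matrix: bounded real sequences `a, b` on `ℤ` with
`inf a > 0`. -/
structure JacobiMatrix where
  a : ℤ → ℝ
  b : ℤ → ℝ
  bdd_a : ∃ C, ∀ n, |a n| ≤ C
  bdd_b : ∃ C, ∀ n, |b n| ≤ C
  a_pos : ∃ δ > 0, ∀ n, δ ≤ a n

namespace JacobiMatrix

/-- The bounded operator on `ℓ²(ℤ)` given by a Jacobi matrix,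
`(Jφ)_n = a_{n-1} φ_{n-1} + b_n φ_n + a_n φ_{n+1}`. -/
def op (J : JacobiMatrix) : L2Z →L[ℂ] L2Z :=
  weightedShift (fun n => J.a (n - 1)) (-1) (J.bdd_a.imp fun _ h n => h (n - 1)) +
    weightedShift J.b 0 J.bdd_b + weightedShift J.a 1 J.bdd_a

lemma op_apply (J : JacobiMatrix) (φ : L2Z) (n : ℤ) :
    J.op φ n = (J.a (n - 1) : ℂ) * φ (n - 1) + (J.b n : ℂ) * φ n + (J.a n : ℂ) * φ (n + 1) := by
  have h0 : ∀ m : ℤ, m + 0 = m := fun m => add_zero m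
  change (J.a (n - 1) : ℂ) * φ (n + -1) + (J.b n : ℂ) * φ (n + 0) + (J.a n : ℂ) * φ (n + 1) = _
  rw [h0, sub_eq_add_neg]

/-- The class `𝒥(R)`: `1/R ≤ a_n ≤ R` and `|b_n| ≤ R` for all `n`. -/
def IsRBounded (R : ℝ) (J : JacobiMatrix) : Prop :=
  ∀ n : ℤ, 1 / R ≤ J.a n ∧ J.a n ≤ R ∧ |J.b n| ≤ R

/-- `q`-periodicity of the coefficients. -/
def IsPeriodic (q : ℕ) (J : JacobiMatrix) : Prop :=
  ∀ n : ℤ, J.a (n + q) = J.a n ∧ J.b (n + q) = J.b n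

/-- The data of exponential-class limit-periodicity: `q₀ ∣ q₁ ∣ …` with `q_n ≠ q_{n+1}`,
`Jq n` is `q_n`-periodic and `q_{n+1}³ exp(η q_n) ‖J - Jq n‖ → 0` (operator norm). -/
structure IsExpApprox (η : ℝ) (J : JacobiMatrix) (q : ℕ → ℕ) (Jq : ℕ → JacobiMatrix) :
    Prop where
  dvd : ∀ n, q n ∣ q (n + 1)
  ne : ∀ n, q n ≠ q (n + 1)
  periodic : ∀ n, (Jq n).IsPeriodic (q n)
  tendsto : Tendsto (fun n => (q (n + 1) : ℝ) ^ 3 * Real.exp (η * q n) * ‖J.op - (Jq n).op‖)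
    atTop (𝓝 0)

/-- The Schrödinger propagator `e^{itJ}`. -/
def propagator (J : JacobiMatrix) (t : ℝ) : L2Z →L[ℂ] L2Z :=
  NormedSpace.exp ((Complex.I * (t : ℂ)) • J.op)

end JacobiMatrix

/-! ### The position operator and its Heisenberg evolution -/

/-- The position operator `(Xφ)_n = n φ_n` with its maximal domain
`D(X) = {φ ∈ ℓ²(ℤ) : (n φ_n) ∈ ℓ²(ℤ)}`. -/
def positionOp : L2Z →ₗ.[ℂ] L2Z where
  domain :=
    { carrier := {φ | Memℓp (fun n : ℤ => (n : ℂ) * φ n) 2}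
      add_mem' := fun {φ ψ} hφ hψ => by
        have h : (fun n : ℤ => (n : ℂ) * (φ + ψ : L2Z) n) =
            (fun n : ℤ => (n : ℂ) * φ n) + fun n : ℤ => (n : ℂ) * ψ n := by
          ext n
          simp [mul_add]
        change Memℓp _ 2
        rw [h]
        exact Memℓp.add hφ hψ
      zero_mem' := by
        have h : (fun n : ℤ => (n : ℂ) * (0 : L2Z) n) = 0 := by
          ext n
          simp
        change Memℓp _ 2
        rw [h]
        exact zero_memℓp
      smul_mem' := fun c φ hφ => by
        have h : (fun n : ℤ => (n : ℂ) * (c • φ : L2Z) n) =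
            c • fun n : ℤ => (n : ℂ) * φ n := by
          ext n
          simp [mul_left_comm]
        change Memℓp _ 2
        rw [h]
        exact Memℓp.const_smul hφ c }
  toFun :=
    { toFun := fun φ => ⟨fun n : ℤ => (n : ℂ) * (φ : L2Z) n, φ.2⟩
      map_add' := fun φ ψ => by
        ext n
        exact mul_add (n : ℂ) ((φ : L2Z) n) ((ψ : L2Z) n)
      map_smul' := fun c φ => by
        ext n
        exact mul_left_comm (n : ℂ) c ((φ : L2Z) n) }

/-- The Heisenberg evolution `X_J(t) = e^{itJ} X e^{-itJ}` of the position operator, with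
domain `{φ : e^{-itJ} φ ∈ D(X)}`. -/
def heisenbergX (J : JacobiMatrix) (t : ℝ) : L2Z →ₗ.[ℂ] L2Z where
  domain := positionOp.domain.comap (J.propagator (-t)).toLinearMap
  toFun := (J.propagator t).toLinearMap ∘ₗ positionOp.toFun ∘ₗ
    (J.propagator (-t)).toLinearMap.submoduleComap positionOp.domain

/-- The `ℓ¹` norm `∑ |φ_n|` (meaningful for `φ ∈ ℓ¹(ℤ)`). -/
def l1norm (φ : L2Z) : ℝ := ∑' n : ℤ, ‖φ n‖

/-! ### Floquet theory -/

/-- The fibre `ℂ^q` with its Euclidean inner product. -/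
abbrev Fibre (q : ℕ) : Type := EuclideanSpace ℂ (Fin q)

/-- Floquet space `L²(𝕋; ℂ^q)`, where `𝕋 = ℝ/ℤ` carries Lebesgue (= normalized Haar) measure. -/
abbrev FloquetSpace (q : ℕ) : Type :=
  Lp (Fibre q) 2 (AddCircle.haarAddCircle : Measure UnitAddCircle)

/-- For `n = k + p q` with `0 ≤ k < q`, the function `θ ↦ e^{-2πipθ} e_k` in Floquet space. -/
def floquetVec (q : ℕ) [NeZero q] (n : ℤ) : FloquetSpace q :=
  (ContinuousLinearMap.toSpanSingleton ℂ
      (EuclideanSpace.single (Int.divModEquiv q n).2 (1 : ℂ) : Fibre q)).compLp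
    (fourierLp 2 (-(Int.divModEquiv q n).1) : Lp ℂ 2 AddCircle.haarAddCircle)

lemma floquetVec_coe (q : ℕ) [NeZero q] (n : ℤ) :
    floquetVec q n =ᵐ[AddCircle.haarAddCircle] fun θ : UnitAddCircle =>
      fourier (-(Int.divModEquiv q n).1) θ •
        (EuclideanSpace.single (Int.divModEquiv q n).2 (1 : ℂ) : Fibre q) := by
  filter_upwards [ContinuousLinearMap.coeFn_compLp
    (ContinuousLinearMap.toSpanSingleton ℂ
      (EuclideanSpace.single (Int.divModEquiv q n).2 (1 : ℂ) : Fibre q))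
    (fourierLp 2 (-(Int.divModEquiv q n).1) : Lp ℂ 2 AddCircle.haarAddCircle),
    coeFn_fourierLp (T := 1) 2 (-(Int.divModEquiv q n).1)] with θ h1 h2
  rw [floquetVec, h1, h2]
  simp

lemma inner_floquetVec (q : ℕ) [NeZero q] (n : ℤ) (f : FloquetSpace q) :
    inner ℂ (floquetVec q n) f =
      inner ℂ (fourierLp 2 (-(Int.divModEquiv q n).1) : Lp ℂ 2 AddCircle.haarAddCircle)
        ((EuclideanSpace.proj (𝕜 := ℂ) (ι := Fin q)
          (Int.divModEquiv q n).2).compLp f) := by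
  rw [L2.inner_def, L2.inner_def]
  refine integral_congr_ae ?_
  filter_upwards [floquetVec_coe q n,
    coeFn_fourierLp (T := 1) 2 (-(Int.divModEquiv q n).1),
    ContinuousLinearMap.coeFn_compLp (EuclideanSpace.proj (𝕜 := ℂ) (ι := Fin q)
      (Int.divModEquiv q n).2) f] with θ h1 h2 h3
  rw [h1, h2, h3, inner_smul_left, EuclideanSpace.inner_single_left]
  simp [mul_comm]

lemma orthonormal_floquetVec (q : ℕ) [NeZero q] : Orthonormal ℂ (floquetVec q) := by
  have hF := orthonormal_iff_ite.mp (orthonormal_fourier (T := 1))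
  rw [orthonormal_iff_ite]
  intro m n
  rw [L2.inner_def]
  have key : ∫ θ, inner ℂ (floquetVec q m θ) (floquetVec q n θ) ∂AddCircle.haarAddCircle =
      inner ℂ (EuclideanSpace.single (Int.divModEquiv q m).2 (1 : ℂ) : Fibre q)
        (EuclideanSpace.single (Int.divModEquiv q n).2 (1 : ℂ)) *
      inner ℂ (fourierLp 2 (-(Int.divModEquiv q m).1) : Lp ℂ 2 AddCircle.haarAddCircle)
        (fourierLp (T := 1) 2 (-(Int.divModEquiv q n).1)) := by
    rw [L2.inner_def, ← integral_const_mul]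
    refine integral_congr_ae ?_
    filter_upwards [floquetVec_coe q m, floquetVec_coe q n,
      coeFn_fourierLp (T := 1) 2 (-(Int.divModEquiv q m).1),
      coeFn_fourierLp (T := 1) 2 (-(Int.divModEquiv q n).1)] with θ h1 h2 h3 h4
    rw [h1, h2, h3, h4, inner_smul_left, inner_smul_right]
    simp only [RCLike.inner_apply]
    ring
  rw [key, hF, EuclideanSpace.inner_single_left]
  by_cases h : m = n
  · subst h
    simp
  · have h' : Int.divModEquiv q m ≠ Int.divModEquiv q n :=
      fun e => h ((Int.divModEquiv q).injective e)
    rw [if_neg h]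
    by_cases h1 : (Int.divModEquiv q m).1 = (Int.divModEquiv q n).1
    · have h2 : (Int.divModEquiv q m).2 ≠ (Int.divModEquiv q n).2 :=
        fun e => h' (Prod.ext h1 e)
      simp [-Int.divModEquiv_apply, h2]
    · have h3 : -(Int.divModEquiv q m).1 ≠ -(Int.divModEquiv q n).1 :=
        fun e => h1 (neg_injective e)
      rw [if_neg h3, mul_zero]

lemma floquetVec_total (q : ℕ) [NeZero q] :
    (Submodule.span ℂ (Set.range (floquetVec q)))ᗮ = ⊥ := by
  rw [Submodule.eq_bot_iff]
  intro f hf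
  have h0 : ∀ n, inner ℂ (floquetVec q n) f = 0 := fun n =>
    (Submodule.mem_orthogonal _ f).mp hf _ (Submodule.subset_span ⟨n, rfl⟩)
  have hk : ∀ k : Fin q,
      (EuclideanSpace.proj (𝕜 := ℂ) (ι := Fin q) k).compLp f = 0 := by
    intro k
    apply (fourierBasis (T := 1)).repr.injective
    ext p
    rw [HilbertBasis.repr_apply_apply, coe_fourierBasis, map_zero]
    have h := h0 ((Int.divModEquiv q).symm (-p, k))
    rw [inner_floquetVec] at h
    simp only [Equiv.apply_symm_apply, neg_neg] at h
    exact h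
  rw [Lp.eq_zero_iff_ae_eq_zero]
  have hall : ∀ᵐ θ ∂(AddCircle.haarAddCircle : Measure UnitAddCircle), ∀ k : Fin q,
      f θ k = 0 := by
    rw [ae_all_iff]
    intro k
    filter_upwards [ContinuousLinearMap.coeFn_compLp
      (EuclideanSpace.proj (𝕜 := ℂ) (ι := Fin q) k) f,
      (Lp.eq_zero_iff_ae_eq_zero).mp (hk k)] with θ h1 h2
    rw [h2] at h1
    exact h1.symm
  filter_upwards [hall] with θ h
  ext k
  exact h k

/-- The `q`-periodic Floquet transform, the unitary map `𝓕 : ℓ²(ℤ) → L²(𝕋; ℂ^q)` with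
`[𝓕 φ]_k(θ) = ∑_p φ_{k+pq} e^{-2πipθ}` for `0 ≤ k < q`; that is, it sends `δ_{k+pq}` to
`e^{-2πipθ} e_k`. -/
def floquetTransform (q : ℕ) [NeZero q] : L2Z ≃ₗᵢ[ℂ] FloquetSpace q :=
  (HilbertBasis.mkOfOrthogonalEqBot (orthonormal_floquetVec q) (floquetVec_total q)).repr.symm

/-- The Floquet matrix `J_q(θ)`, with rows and columns indexed by `0, …, q-1`. It is the
tridiagonal block of `J` with the corner entries `a_{q-1} e^{2πiθ}` (last row, first column) and
`a_{q-1} e^{-2πiθ}` (first row, last column); for `q ≤ 2` coinciding entries are added. -/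
def floquetMatrix (q : ℕ) (J : JacobiMatrix) (θ : ℝ) : Matrix (Fin q) (Fin q) ℂ :=
  Matrix.of fun j k =>
    (if j = k then (J.b j : ℂ) else 0) +
    (if (j : ℕ) + 1 = k then (J.a j : ℂ) else 0) +
    (if (k : ℕ) + 1 = j then (J.a k : ℂ) else 0) +
    (if (j : ℕ) + 1 = q ∧ (k : ℕ) = 0 then
      (J.a j : ℂ) * Complex.exp (2 * π * θ * Complex.I) else 0) +
    (if (k : ℕ) + 1 = q ∧ (j : ℕ) = 0 then
      (J.a k : ℂ) * Complex.exp (-(2 * π * θ * Complex.I)) else 0)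

lemma floquetMatrix_isHermitian (q : ℕ) (J : JacobiMatrix) (θ : ℝ) :
    (floquetMatrix q J θ).IsHermitian := by
  ext j k
  have e1 : (starRingEnd ℂ) (Complex.exp (2 * π * θ * Complex.I)) =
      Complex.exp (-(2 * π * θ * Complex.I)) := by
    rw [← Complex.exp_conj]
    simp only [map_mul, Complex.conj_ofReal, Complex.conj_I, map_ofNat, mul_neg]
  have e2 : (starRingEnd ℂ) (Complex.exp (-(2 * π * θ * Complex.I))) =
      Complex.exp (2 * π * θ * Complex.I) := by
    rw [← e1, Complex.conj_conj]
  simp only [floquetMatrix, Matrix.conjTranspose_apply, Matrix.of_apply, RCLike.star_def,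
    map_add, apply_ite (starRingEnd ℂ), map_mul, map_zero, Complex.conj_ofReal, e1, e2]
  by_cases h : j = k
  · subst h
    simp only [if_true]
    ring
  · rw [if_neg h, if_neg (Ne.symm h)]
    ring

/-- The eigenvalues `λ_{q,0}(θ) ≤ … ≤ λ_{q,q-1}(θ)` of `J_q(θ)`, in increasing order and
repeated according to multiplicity. -/
def floquetEig (q : ℕ) (J : JacobiMatrix) (k : Fin q) (θ : ℝ) : ℝ :=
  (floquetMatrix_isHermitian q J θ).eigenvalues₀ (Fin.cast (Fintype.card_fin q).symm k.rev)

/-- The orthogonal projection `P_k(θ)` of `ℂ^q` onto `ker (J_q(θ) - λ_{q,k}(θ))`. -/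
def floquetProj (q : ℕ) (J : JacobiMatrix) (k : Fin q) (θ : ℝ) : Fibre q →L[ℂ] Fibre q :=
  (Module.End.eigenspace (Matrix.toEuclideanLin (floquetMatrix q J θ))
    (floquetEig q J k θ : ℂ)).starProjection

/-- The fibre operator `Q_q(θ) = (q / 2π) ∑_k λ'_{q,k}(θ) P_k(θ)`; here `λ'_{q,k}` is the
derivative in `θ ∈ [0,1)`, so that `λ'_{q,k} / 2π` is the derivative in the phase `2πθ`. -/
def fibreQ (q : ℕ) (J : JacobiMatrix) (θ : ℝ) : Fibre q →L[ℂ] Fibre q :=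
  ((q : ℂ) / (2 * π)) • ∑ k : Fin q, ((deriv (floquetEig q J k) θ : ℝ) : ℂ) • floquetProj q J k θ

/-- The fibre operators as a function on the circle `𝕋`, identified with `[0,1)`. -/
def circleQ (q : ℕ) (J : JacobiMatrix) (θ : UnitAddCircle) : Fibre q →L[ℂ] Fibre q :=
  fibreQ q J (AddCircle.equivIco 1 0 θ : ℝ)

/-- The decomposable operator `∫^⊕ M(θ) dθ` on Floquet space, `f ↦ (θ ↦ M(θ) f(θ))`, for a
measurable essentially bounded family `M` of operators on `ℂ^q` (and `0` for any other `M`). -/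
def directIntegral (q : ℕ) (M : UnitAddCircle → Fibre q →L[ℂ] Fibre q) :
    FloquetSpace q →L[ℂ] FloquetSpace q :=
  open Classical in
  if h : MemLp M ∞ (AddCircle.haarAddCircle : Measure UnitAddCircle) then
    (ContinuousLinearMap.id ℂ (Fibre q →L[ℂ] Fibre q)).holderL AddCircle.haarAddCircle ∞ 2 2
      (h.toLp M)
  else 0

/-- The operator `Q_q = 𝓕⁻¹ (∫^⊕ Q_q(θ) dθ) 𝓕` on `ℓ²(ℤ)` of a `q`-periodic Jacobi matrix. -/
def opQ (q : ℕ) [NeZero q] (J : JacobiMatrix) : L2Z →L[ℂ] L2Z :=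
  (floquetTransform q).symm.toContinuousLinearEquiv.toContinuousLinearMap ∘L
    directIntegral q (circleQ q J) ∘L
    (floquetTransform q).toContinuousLinearEquiv.toContinuousLinearMap

/-- `c` is a constant for Last's lower bound on the class `𝒥(R)`: for every `q ≥ 1`, every
`q`-periodic `J ∈ 𝒥(R)`, every `k` and every `θ`, `|λ'_{q,k}(θ)| ≥ e^{-cq} |sin 2πθ|`. -/
def IsLastConstant (R c : ℝ) : Prop :=
  ∀ (q : ℕ) (J : JacobiMatrix), 1 ≤ q → J.IsPeriodic q → J.IsRBounded R →
    ∀ (k : Fin q) (θ : ℝ),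
      Real.exp (-(c * q)) * |Real.sin (2 * π * θ)| ≤ |deriv (floquetEig q J k) θ|

/-- `γ_n = e^{-η q_{n-1}} / q_n³`, for `n ≥ 1`. -/
def gam (η : ℝ) (q : ℕ → ℕ) (n : ℕ) : ℝ :=
  Real.exp (-(η * q (n - 1))) / (q n : ℝ) ^ 3

end JacobiTransport

end

noncomputable section

namespace JacobiTransport

/-! ### The Floquet vectors in the fibre -/

/-! The Heisenberg evolution of `X` moves with velocity equal to the evolved current. The current
`i[J, X]` is bounded, so `X_J(t) = X + t A(t)` on `D(X)`, with `A(t)` the average over `[0, t]` of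
`e^{isJ} i[J, X] e^{-isJ}` (`exists_heisenbergX_eq`). The term `‖Xφ‖ / t` comes from `X`. By the
triangle inequality in `ℓ¹`, it remains to bound `(Q - A(t)) δ_n` uniformly in `n`.

For periodic `J` both `Q` and `A(t)` act fibrewise. In an eigenbasis of `J(θ)` the time average
keeps the diagonal of the current and multiplies each off-diagonal entry by at most `2 / (t · gap)`.
The diagonal part is `Q(θ)`: up to a commutator with `J(θ)`, the current is `q/2π` times the
`θ`-derivative of `J(θ)`, and Hellmann–Feynman applies (`inner_currentFibre_eigenvector`). Hence the
squared fibre error is at most `(2/(tε))² · q(2R)²` wherever all gaps are at least `ε`, and at most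
`16R²` elsewhere. The Floquet transform of `δ_n` has norm one in every fibre, so the total squared
error is the first bound plus `16R²` times the measure of the set of bad `θ`.

The gaps are controlled through the preceding approximant. Let `p = q_{n-1}` and `q = q_n = p r`.
Seen with period `q`, the `p`-periodic matrix has half-trace `f = T_r ∘ Δ_p`, and its eigenvalues at
`θ` solve `f = cos 2πθ`. Two of them enclose a critical point, where `|f| ≥ 1`. Where `|f| < 1` the
slope is at most `K = r² · 2π e^{c₁p}`: the factor `r²` comes from Chebyshev polynomials, and the
rest inverts property (L) through `λ' = -2π sin 2πθ / Δ'(λ)`. So the gap is at least `sin² 2πθ / K`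
(`sin_sq_le_mul_gap`). The two approximants differ by at most `ε / 3` in norm, so gaps of size `ε`
survive for the `q`-periodic matrix when `|sin 2πθ| ≥ q e^{c₁p/2} √ε` (`le_gap_of_close`). The
remaining `θ` have measure at most `q e^{c₁p/2} √ε`, which gives the second term under the root.

A constant with property (L) exists by the same formula for `λ'`, because `Δ_q'` grows at most
exponentially in `q` on the range of the eigenvalues. -/

/-- The value at `θ` of the Floquet vector of `δ_n`. -/
def fibreVec (q : ℕ) [NeZero q] (n : ℤ) (θ : UnitAddCircle) : Fibre q :=
  fourier (-(Int.divModEquiv q n).1) θ •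
    (EuclideanSpace.single (Int.divModEquiv q n).2 (1 : ℂ) : Fibre q)

section FibreVec

variable (q : ℕ) [NeZero q]

lemma divModEquiv_add_mul (k : Fin q) (p : ℤ) :
    Int.divModEquiv q ((k : ℤ) + p * q) = (p, k) := by
  rw [← Equiv.eq_symm_apply, Int.divModEquiv_symm_apply]
  ring

lemma eq_add_mul_of_divModEquiv (n : ℤ) :
    n = ((Int.divModEquiv q n).2 : ℤ) + (Int.divModEquiv q n).1 * q := by
  conv_lhs => rw [← (Int.divModEquiv q).symm_apply_apply n]
  rw [Int.divModEquiv_symm_apply]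
  ring

lemma fibreVec_add_mul' (k : Fin q) (p : ℤ) (θ : UnitAddCircle) :
    fibreVec q ((k : ℤ) + p * q) θ =
      fourier (-p) θ • (EuclideanSpace.single k (1 : ℂ) : Fibre q) := by
  rw [fibreVec, divModEquiv_add_mul]

lemma fibreVec_natCast (k : Fin q) (θ : UnitAddCircle) :
    fibreVec q (k : ℤ) θ = (EuclideanSpace.single k (1 : ℂ) : Fibre q) := by
  have := fibreVec_add_mul' q k 0 θ
  simpa using this

lemma fibreVec_add_mul (n p : ℤ) (θ : UnitAddCircle) :
    fibreVec q (n + p * q) θ = fourier (-p) θ • fibreVec q n θ := by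
  obtain ⟨l, k, rfl⟩ : ∃ (l : ℤ) (k : Fin q), n = (k : ℤ) + l * q :=
    ⟨_, _, eq_add_mul_of_divModEquiv q n⟩
  rw [show (k : ℤ) + l * q + p * q = k + (l + p) * q by ring, fibreVec_add_mul',
    fibreVec_add_mul', smul_smul, ← fourier_add, neg_add_rev]

lemma norm_fourier_apply (n : ℤ) (θ : UnitAddCircle) : ‖fourier n θ‖ = 1 := by
  rw [fourier_apply]
  exact Circle.norm_coe _

lemma norm_fibreVec (n : ℤ) (θ : UnitAddCircle) : ‖fibreVec q n θ‖ = 1 := by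
  rw [fibreVec, norm_smul, norm_fourier_apply, PiLp.norm_single]
  simp

/-- Any `q` consecutive sites have distinct residues mod `q`, so up to phases their Floquet vectors
are the standard basis. -/
lemma fibreVec_shift_orthonormal (s : ℤ) (θ : UnitAddCircle) :
    Orthonormal ℂ (fun k : Fin q => fibreVec q (k + s) θ) := by
  refine ⟨fun k => norm_fibreVec q _ θ, fun k l hkl => ?_⟩
  have hne : (Int.divModEquiv q (k + s)).2 ≠ (Int.divModEquiv q (l + s)).2 := by
    intro h
    have hk := eq_add_mul_of_divModEquiv q (k + s)
    have hl := eq_add_mul_of_divModEquiv q (l + s)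
    rw [h] at hk
    apply hkl
    have hd : ((q : ℤ)) ∣ (k : ℤ) - l := by
      refine ⟨(Int.divModEquiv q (k + s)).1 - (Int.divModEquiv q (l + s)).1, ?_⟩
      linear_combination hk - hl
    have h0 := Int.eq_zero_of_abs_lt_dvd hd (by
      rw [abs_lt]
      have := k.2
      have := l.2
      omega)
    ext
    omega
  change inner ℂ (fibreVec q (k + s) θ) (fibreVec q (l + s) θ) = 0
  rw [fibreVec, fibreVec, inner_smul_left, inner_smul_right, EuclideanSpace.inner_single_left]
  simp [-Int.divModEquiv_apply, hne]

lemma continuous_fibreVec (n : ℤ) : Continuous (fibreVec q n) := by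
  unfold fibreVec
  fun_prop

lemma fourier_coe_unit (n : ℤ) (x : ℝ) :
    fourier n (x : UnitAddCircle) = Complex.exp (2 * π * Complex.I * n * x) := by
  rw [fourier_coe_apply]
  simp

lemma hasDerivAt_fibreVec (n : ℤ) (x : ℝ) :
    HasDerivAt (fun y : ℝ => fibreVec q n (y : UnitAddCircle))
      ((-(2 * π * Complex.I * (Int.divModEquiv q n).1)) • fibreVec q n (x : UnitAddCircle)) x := by
  have h := (hasDerivAt_fourier (1 : ℝ) (-(Int.divModEquiv q n).1) x).smul_const
    (EuclideanSpace.single (Int.divModEquiv q n).2 (1 : ℂ) : Fibre q)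
  have e : (-(2 * π * Complex.I * (Int.divModEquiv q n).1)) • fibreVec q n (x : UnitAddCircle) =
      (2 * π * Complex.I * ((-(Int.divModEquiv q n).1 : ℤ) : ℂ) / (1 : ℝ) *
        fourier (-(Int.divModEquiv q n).1) (x : AddCircle (1 : ℝ))) •
      (EuclideanSpace.single (Int.divModEquiv q n).2 (1 : ℂ) : Fibre q) := by
    rw [fibreVec, smul_smul]
    congr 1
    push_cast
    ring
  rw [e]
  exact h

lemma continuousLinearMap_ext_fibreVec {F : Type*} [NormedAddCommGroup F] [NormedSpace ℂ F]
    {S T : Fibre q →L[ℂ] F} (θ : UnitAddCircle)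
    (h : ∀ n : ℤ, S (fibreVec q n θ) = T (fibreVec q n θ)) : S = T := by
  have hb : S.toLinearMap = T.toLinearMap := by
    refine (EuclideanSpace.basisFun (Fin q) ℂ).toBasis.ext fun k => ?_
    have := h k
    rw [fibreVec_natCast] at this
    simpa using this
  ext1 v
  exact congrArg (fun L : Fibre q →ₗ[ℂ] F => L v) hb

/-! ### Tridiagonal fibre operators -/

/-- The fibres of the operator `δ_n ↦ α_n δ_{n+1} + β_n δ_n + γ_n δ_{n-1}`. -/
def triFibre (α β γ : ℤ → ℂ) : C(UnitAddCircle, Fibre q →L[ℂ] Fibre q) where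
  toFun θ := ∑ k : Fin q, (innerSL ℂ (EuclideanSpace.single k (1 : ℂ) : Fibre q)).smulRight
    (α k • fibreVec q (k + 1) θ + β k • fibreVec q k θ + γ k • fibreVec q (k - 1) θ)
  continuous_toFun := by
    refine continuous_finsetSum _ fun k _ => ?_
    have h : Continuous fun v : Fibre q =>
        (innerSL ℂ (EuclideanSpace.single k (1 : ℂ) : Fibre q)).smulRight v :=
      ((ContinuousLinearMap.smulRightL ℂ (Fibre q) (Fibre q))
        (innerSL ℂ (EuclideanSpace.single k (1 : ℂ) : Fibre q))).continuous
    refine h.comp ?_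
    have := continuous_fibreVec q
    fun_prop

lemma triFibre_apply (α β γ : ℤ → ℂ) (θ : UnitAddCircle) (v : Fibre q) :
    triFibre q α β γ θ v = ∑ k : Fin q, v k •
      (α k • fibreVec q (k + 1) θ + β k • fibreVec q k θ + γ k • fibreVec q (k - 1) θ) := by
  simp [triFibre, EuclideanSpace.inner_single_left]

lemma triFibre_single (α β γ : ℤ → ℂ) (θ : UnitAddCircle) (k : Fin q) :
    triFibre q α β γ θ (EuclideanSpace.single k (1 : ℂ)) =
      α k • fibreVec q (k + 1) θ + β k • fibreVec q k θ + γ k • fibreVec q (k - 1) θ := by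
  rw [triFibre_apply, Finset.sum_eq_single k]
  · simp
  · intro b _ hb
    simp [hb]
  · simp

/-- The definition prescribes the action only on sites of the period cell. The phase in
`fibreVec_add_mul` and the periodicity of the coefficients carry it to every integer, which removes
all corner cases from later computations. -/
lemma triFibre_fibreVec {α β γ : ℤ → ℂ} (hα : ∀ n : ℤ, α (n + q) = α n)
    (hβ : ∀ n : ℤ, β (n + q) = β n) (hγ : ∀ n : ℤ, γ (n + q) = γ n) (θ : UnitAddCircle) (n : ℤ) :
    triFibre q α β γ θ (fibreVec q n θ) =
      α n • fibreVec q (n + 1) θ + β n • fibreVec q n θ + γ n • fibreVec q (n - 1) θ := by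
  have hper : ∀ {f : ℤ → ℂ}, (∀ n : ℤ, f (n + q) = f n) → ∀ k p : ℤ, f (k + p * q) = f k := by
    intro f hf k p
    have hp : Function.Periodic f (q : ℤ) := hf
    simpa using (hp.int_mul p) k
  obtain ⟨p, k, rfl⟩ : ∃ (p : ℤ) (k : Fin q), n = (k : ℤ) + p * q :=
    ⟨_, _, eq_add_mul_of_divModEquiv q n⟩
  rw [fibreVec_add_mul', map_smul, triFibre_single, hper hα, hper hβ, hper hγ,
    show (k : ℤ) + p * q + 1 = k + 1 + p * q by ring,
    show (k : ℤ) + p * q - 1 = k - 1 + p * q by ring, fibreVec_add_mul, fibreVec_add_mul,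
    ← fibreVec_natCast q k θ]
  simp only [smul_add, smul_smul]
  simp only [mul_comm]

lemma norm_sq_sum_smul_of_orthonormal {ι E : Type*} [Fintype ι] [NormedAddCommGroup E]
    [InnerProductSpace ℂ E] {v : ι → E} (hv : Orthonormal ℂ v) (c : ι → ℂ) :
    ‖∑ i, c i • v i‖ ^ 2 = ∑ i, ‖c i‖ ^ 2 := by
  have h := hv.inner_sum c c Finset.univ
  rw [inner_self_eq_norm_sq_to_K] at h
  simp_rw [RCLike.conj_mul] at h
  exact_mod_cast h

lemma norm_sum_shift_le {α : ℤ → ℂ} {C : ℝ} (hα : ∀ n, ‖α n‖ ≤ C) (s : ℤ) (θ : UnitAddCircle)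
    (v : Fibre q) : ‖∑ k : Fin q, v k • α k • fibreVec q (k + s) θ‖ ≤ C * ‖v‖ := by
  have hC : 0 ≤ C := (norm_nonneg _).trans (hα 0)
  refine le_of_sq_le_sq ?_ (by positivity)
  simp_rw [smul_smul]
  rw [norm_sq_sum_smul_of_orthonormal (fibreVec_shift_orthonormal q s θ), mul_pow,
    EuclideanSpace.norm_sq_eq,
    Finset.mul_sum]
  refine Finset.sum_le_sum fun k _ => ?_
  rw [norm_mul, mul_pow, mul_comm]
  gcongr
  exact hα k

/-- Each of the three diagonals maps the standard basis to multiples of an orthonormal family, so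
its norm is at most the supremum of its coefficients. -/
lemma norm_triFibre_le {α β γ : ℤ → ℂ} {A B C : ℝ} (hα : ∀ n, ‖α n‖ ≤ A)
    (hβ : ∀ n, ‖β n‖ ≤ B) (hγ : ∀ n, ‖γ n‖ ≤ C) (θ : UnitAddCircle) :
    ‖triFibre q α β γ θ‖ ≤ A + B + C := by
  have hA : 0 ≤ A := (norm_nonneg _).trans (hα 0)
  have hB : 0 ≤ B := (norm_nonneg _).trans (hβ 0)
  have hC : 0 ≤ C := (norm_nonneg _).trans (hγ 0)
  refine ContinuousLinearMap.opNorm_le_bound _ (by positivity) fun v => ?_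
  have h0 := norm_sum_shift_le q hβ 0 θ v
  have h1 := norm_sum_shift_le q hα 1 θ v
  have h2 := norm_sum_shift_le q hγ (-1) θ v
  simp only [add_zero, ← sub_eq_add_neg] at h0 h2
  rw [triFibre_apply]
  simp_rw [smul_add]
  rw [Finset.sum_add_distrib, Finset.sum_add_distrib, add_mul, add_mul]
  exact norm_add₃_le.trans (add_le_add (add_le_add h1 h0) h2)

end FibreVec

/-! ### The Floquet matrix as a tridiagonal fibre operator -/

section JacobiFibre

variable (q : ℕ) [NeZero q] (J : JacobiMatrix)

/-- The fibres of a periodic Jacobi matrix. -/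
def jacobiFibre : C(UnitAddCircle, Fibre q →L[ℂ] Fibre q) :=
  triFibre q (fun n => J.a n) (fun n => J.b n) (fun n => J.a (n - 1))

/-- The fibres of the current operator `i[J, X]`. -/
def currentFibre : C(UnitAddCircle, Fibre q →L[ℂ] Fibre q) :=
  triFibre q (fun n => -(Complex.I * J.a n)) (fun _ => 0) (fun n => Complex.I * J.a (n - 1))

/-- Multiplication by the index in the period cell. -/
def indexOp : Fibre q →L[ℂ] Fibre q :=
  ∑ k : Fin q, (innerSL ℂ (EuclideanSpace.single k (1 : ℂ) : Fibre q)).smulRight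
    ((k : ℂ) • (EuclideanSpace.single k (1 : ℂ) : Fibre q))

variable {J}

lemma JacobiMatrix.IsPeriodic.a_add_mul {q : ℕ} (hJ : J.IsPeriodic q) (n p : ℤ) :
    J.a (n + p * q) = J.a n := by
  have hp : Function.Periodic J.a (q : ℤ) := fun n => (hJ n).1
  simpa using (hp.int_mul p) n

lemma JacobiMatrix.IsPeriodic.b_add_mul {q : ℕ} (hJ : J.IsPeriodic q) (n p : ℤ) :
    J.b (n + p * q) = J.b n := by
  have hp : Function.Periodic J.b (q : ℤ) := fun n => (hJ n).2
  simpa using (hp.int_mul p) n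

lemma JacobiMatrix.IsPeriodic.a_add_sub {q : ℕ} (hJ : J.IsPeriodic q) (n : ℤ) :
    J.a (n + q - 1) = J.a (n - 1) := by
  rw [show n + q - 1 = n - 1 + q by ring, (hJ _).1]

lemma jacobiFibre_fibreVec (hJ : J.IsPeriodic q) (θ : UnitAddCircle) (n : ℤ) :
    jacobiFibre q J θ (fibreVec q n θ) = (J.a n : ℂ) • fibreVec q (n + 1) θ +
      (J.b n : ℂ) • fibreVec q n θ + (J.a (n - 1) : ℂ) • fibreVec q (n - 1) θ :=
  triFibre_fibreVec q (fun n => by rw [(hJ n).1]) (fun n => by rw [(hJ n).2])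
    (fun n => by rw [hJ.a_add_sub]) θ n

lemma currentFibre_fibreVec (hJ : J.IsPeriodic q) (θ : UnitAddCircle) (n : ℤ) :
    currentFibre q J θ (fibreVec q n θ) = (-(Complex.I * J.a n)) • fibreVec q (n + 1) θ +
      (Complex.I * J.a (n - 1)) • fibreVec q (n - 1) θ := by
  have := triFibre_fibreVec q (α := fun n => -(Complex.I * J.a n)) (β := fun _ => 0)
    (γ := fun n => Complex.I * J.a (n - 1)) (fun n => by rw [(hJ n).1]) (fun n => rfl)
    (fun n => by rw [hJ.a_add_sub]) θ n
  rw [currentFibre, this, zero_smul, add_zero]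

lemma fibreVec_natCast_add_one_apply (k j : Fin q) (x : ℝ) :
    fibreVec q (k + 1) (x : UnitAddCircle) j =
      (if (k : ℕ) + 1 = j then 1 else 0) + (if (k : ℕ) + 1 = q ∧ (j : ℕ) = 0 then
        Complex.exp (-(2 * π * x * Complex.I)) else 0) := by
  have hk := k.2
  have hj := j.2
  by_cases h : (k : ℕ) + 1 = q
  -- The right neighbour of the last site is site `0` of the next cell.
  · have e : (k : ℤ) + 1 = ((0 : Fin q) : ℤ) + 1 * q := by
      rw [Fin.val_zero]
      omega
    have hne : (k : ℕ) + 1 ≠ j := by omega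
    rw [e, fibreVec_add_mul', fourier_coe_unit, if_neg hne]
    by_cases hj0 : (j : ℕ) = 0
    · have : j = 0 := Fin.ext (by rw [Fin.val_zero]; exact hj0)
      subst this
      simp only [PiLp.smul_apply, PiLp.single_apply, if_true, h, Fin.val_zero, and_self, zero_add,
        smul_eq_mul, mul_one]
      congr 1
      push_cast
      ring
    · have : j ≠ 0 := fun hh => hj0 (by rw [hh, Fin.val_zero])
      simp [this, hj0]
  · have hlt : (k : ℕ) + 1 < q := by omega
    have e : (k : ℤ) + 1 = ((⟨k + 1, hlt⟩ : Fin q) : ℤ) := by simp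
    rw [e, fibreVec_natCast]
    simp only [PiLp.single_apply, Fin.ext_iff, h, false_and, if_false, add_zero, eq_comm]

lemma fibreVec_natCast_sub_one_apply (k j : Fin q) (x : ℝ) :
    fibreVec q (k - 1) (x : UnitAddCircle) j =
      (if (j : ℕ) + 1 = k then 1 else 0) + (if (j : ℕ) + 1 = q ∧ (k : ℕ) = 0 then
        Complex.exp (2 * π * x * Complex.I) else 0) := by
  have hk := k.2
  have hj := j.2
  by_cases h : (k : ℕ) = 0
  · have hl : q - 1 < q := by omega
    have e : (k : ℤ) - 1 = ((⟨q - 1, hl⟩ : Fin q) : ℤ) + (-1) * q := by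
      simp only
      omega
    have hne : (j : ℕ) + 1 ≠ k := by omega
    rw [e, fibreVec_add_mul', fourier_coe_unit, if_neg hne]
    by_cases hj0 : (j : ℕ) + 1 = q
    · have : j = ⟨q - 1, hl⟩ := Fin.ext (by simp only; omega)
      rw [if_pos ⟨hj0, h⟩, ← this]
      simp only [PiLp.smul_apply, PiLp.single_apply, if_true, zero_add, smul_eq_mul, mul_one]
      congr 1
      push_cast
      ring
    · have : j ≠ ⟨q - 1, hl⟩ := fun hh => hj0 (by rw [hh]; simp only; omega)
      simp [this, hj0]
  · have hlt : (k : ℕ) - 1 < q := by omega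
    have e : (k : ℤ) - 1 = ((⟨k - 1, hlt⟩ : Fin q) : ℤ) := by
      simp only
      omega
    rw [e, fibreVec_natCast]
    have e2 : (j : ℕ) = k - 1 ↔ (j : ℕ) + 1 = k := by omega
    simp only [PiLp.single_apply, Fin.ext_iff, h, and_false, if_false, add_zero, e2]

/-- The neighbours of the end sites fall outside the cell and are folded back with phases
`e^{∓2πix}`. These are the corner entries, and for `q ≤ 2` they add to the others automatically. -/
lemma toEuclideanLin_floquetMatrix (hJ : J.IsPeriodic q) (x : ℝ) :
    Matrix.toEuclideanLin (floquetMatrix q J x) =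
      (jacobiFibre q J (x : UnitAddCircle)).toLinearMap := by
  refine (EuclideanSpace.basisFun (Fin q) ℂ).toBasis.ext fun k => ?_
  ext j
  have hk := k.2
  have hj := j.2
  rw [OrthonormalBasis.coe_toBasis, EuclideanSpace.basisFun_apply,
    ContinuousLinearMap.coe_coe, ← fibreVec_natCast q k (x : UnitAddCircle),
    jacobiFibre_fibreVec q hJ, PiLp.add_apply, PiLp.add_apply, PiLp.smul_apply, PiLp.smul_apply,
    PiLp.smul_apply, fibreVec_natCast_add_one_apply, fibreVec_natCast_sub_one_apply,
    fibreVec_natCast]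
  have e : Matrix.toEuclideanLin (floquetMatrix q J x) (EuclideanSpace.single k (1 : ℂ)) j =
      floquetMatrix q J x j k := by
    simp [Matrix.toLpLin_apply]
  rw [e, floquetMatrix, Matrix.of_apply, PiLp.single_apply]
  simp only [smul_eq_mul, mul_add, mul_ite, mul_one, mul_zero]
  have h1 : (if j = k then (J.b j : ℂ) else 0) = if j = k then (J.b k : ℂ) else 0 := by
    split_ifs with h
    · rw [h]
    · rfl
  have h2 : (if (j : ℕ) + 1 = k then (J.a j : ℂ) else 0) =
      if (j : ℕ) + 1 = k then (J.a (k - 1) : ℂ) else 0 := by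
    split_ifs with h
    · rw [show ((k : ℕ) : ℤ) - 1 = j by omega]
    · rfl
  have h3 : (if (j : ℕ) + 1 = q ∧ (k : ℕ) = 0 then
      (J.a j : ℂ) * Complex.exp (2 * π * x * Complex.I) else 0) =
      if (j : ℕ) + 1 = q ∧ (k : ℕ) = 0 then
        (J.a (k - 1) : ℂ) * Complex.exp (2 * π * x * Complex.I) else 0 := by
    split_ifs with h
    · rw [show (j : ℤ) = k - 1 + q by omega, (hJ _).1]
    · rfl
  rw [h1, h2, h3]
  ring

lemma jacobiFibre_inner (hJ : J.IsPeriodic q) (x : ℝ) (v w : Fibre q) :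
    inner ℂ (jacobiFibre q J (x : UnitAddCircle) v) w =
      inner ℂ v (jacobiFibre q J (x : UnitAddCircle) w) := by
  have h := Matrix.isSymmetric_toEuclideanLin_iff.mpr (floquetMatrix_isHermitian q J x)
  rw [toEuclideanLin_floquetMatrix q hJ x] at h
  exact h v w

lemma floquetEig_monotone (q : ℕ) (J : JacobiMatrix) (x : ℝ) :
    Monotone fun k : Fin q => floquetEig q J k x := by
  intro k l hkl
  apply (floquetMatrix_isHermitian q J x).eigenvalues₀_antitone
  simpa using hkl

/-- An orthonormal basis of eigenvectors, ordered as the eigenvalues. -/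
lemma exists_eigenbasis (hJ : J.IsPeriodic q) (x : ℝ) :
    ∃ b : OrthonormalBasis (Fin q) ℂ (Fibre q), ∀ k,
      jacobiFibre q J (x : UnitAddCircle) (b k) = (floquetEig q J k x : ℂ) • b k := by
  set hH := floquetMatrix_isHermitian q J x with hHdef
  -- `eigenvalues₀` is decreasing whereas the band functions increase with `k`, so the index is
  -- reversed before being matched with that of `eigenvectorBasis`.
  let e : Fin q ≃ Fin q := (Fin.revPerm.trans (finCongr (Fintype.card_fin q).symm)).trans
    (Fintype.equivOfCardEq (Fintype.card_fin _))
  refine ⟨hH.eigenvectorBasis.reindex e.symm, fun k => ?_⟩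
  rw [OrthonormalBasis.reindex_apply, Equiv.symm_symm]
  have h := hH.mulVec_eigenvectorBasis (e k)
  have hk : hH.eigenvalues (e k) = floquetEig q J k x := by
    rw [Matrix.IsHermitian.eigenvalues, floquetEig]
    congr 1
    simp [e]
  rw [hk] at h
  have h2 : Matrix.toEuclideanLin (floquetMatrix q J x) (hH.eigenvectorBasis (e k)) =
      (floquetEig q J k x : ℂ) • hH.eigenvectorBasis (e k) := by
    ext j
    have := congrFun h j
    simpa [Matrix.toLpLin_apply] using this
  rw [toEuclideanLin_floquetMatrix q hJ x] at h2
  exact h2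

lemma indexOp_fibreVec (n : ℤ) (θ : UnitAddCircle) :
    indexOp q (fibreVec q n θ) = ((Int.divModEquiv q n).2 : ℂ) • fibreVec q n θ := by
  rw [fibreVec, map_smul, smul_comm]
  congr 1
  generalize (Int.divModEquiv q n).2 = k
  rw [indexOp, sum_apply, Finset.sum_eq_single k]
  · simp
  · intro b _ hb
    simp [EuclideanSpace.inner_single_left, hb]
  · simp

/-- The current is the derivative of the fibre in the quasimomentum, up to a commutator. -/
lemma exists_hasDerivAt_jacobiFibre (hJ : J.IsPeriodic q) (x : ℝ) :
    ∃ D : Fibre q →L[ℂ] Fibre q,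
      HasDerivAt (fun y : ℝ => jacobiFibre q J (y : UnitAddCircle)) D x ∧
      currentFibre q J (x : UnitAddCircle) = ((q : ℂ) / (2 * π)) • D +
        Complex.I • (jacobiFibre q J (x : UnitAddCircle) ∘L indexOp q -
          indexOp q ∘L jacobiFibre q J (x : UnitAddCircle)) := by
  have hd := hasDerivAt_fibreVec q
  have hex : ∃ D : Fibre q →L[ℂ] Fibre q,
      HasDerivAt (fun y : ℝ => jacobiFibre q J (y : UnitAddCircle)) D x := by
    suffices h : DifferentiableAt ℝ (fun y : ℝ => ∑ k : Fin q,
        (innerSL ℂ (EuclideanSpace.single k (1 : ℂ) : Fibre q)).smulRight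
        ((J.a k : ℂ) • fibreVec q (k + 1) (y : UnitAddCircle) +
          (J.b k : ℂ) • fibreVec q k (y : UnitAddCircle) +
          (J.a (k - 1) : ℂ) • fibreVec q (k - 1) (y : UnitAddCircle))) x from
      ⟨_, h.hasDerivAt⟩
    refine DifferentiableAt.fun_sum fun k _ => ?_
    have hdiff := (((hd (k + 1) x).const_smul (J.a k : ℂ)).add
      ((hd k x).const_smul (J.b k : ℂ))).add ((hd (k - 1) x).const_smul (J.a (k - 1) : ℂ))
    exact ((((ContinuousLinearMap.smulRightL ℂ (Fibre q) (Fibre q))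
      (innerSL ℂ (EuclideanSpace.single k (1 : ℂ) : Fibre q))).restrictScalars ℝ).hasFDerivAt
        |>.comp_hasDerivAt x hdiff).differentiableAt
  obtain ⟨D, hD⟩ := hex
  refine ⟨D, hD, continuousLinearMap_ext_fibreVec q x fun n => ?_⟩
  have hD' : HasDerivAt (fun y : ℝ => (jacobiFibre q J (y : UnitAddCircle)).restrictScalars ℝ)
      (D.restrictScalars ℝ) x :=
    (ContinuousLinearMap.restrictScalarsL ℂ (Fibre q) (Fibre q) ℝ ℝ).hasFDerivAt.comp_hasDerivAt
      x hD
  have h1 := hD'.clm_apply (hd n x)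
  have h2 := (((hd (n + 1) x).const_smul (J.a n : ℂ)).add ((hd n x).const_smul (J.b n : ℂ))).add
    ((hd (n - 1) x).const_smul (J.a (n - 1) : ℂ))
  -- The derivative of `A(y) e_n(y)`, computed once by the product rule and once through its
  -- expansion in `e_{n-1}, e_n, e_{n+1}`, determines `D e_n`.
  have h3 := h1.unique (h2.congr_of_eventuallyEq
    (Eventually.of_forall fun y => jacobiFibre_fibreVec q hJ y n))
  have hq : (q : ℂ) ≠ 0 := Nat.cast_ne_zero.mpr (NeZero.ne q)
  have hpi : (π : ℂ) ≠ 0 := Complex.ofReal_ne_zero.mpr Real.pi_ne_zero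
  -- With `m = k + pq` the cell number is `(m - k)/q`: position is `q` times the cell number, seen
  -- by `d/dθ`, plus the index in the cell, which yields the commutator.
  have hp : ∀ m : ℤ, ((Int.divModEquiv q m).1 : ℂ) = (m - (Int.divModEquiv q m).2) / q := by
    intro m
    rw [eq_div_iff hq]
    have := congrArg (Int.cast : ℤ → ℂ) (eq_add_mul_of_divModEquiv q m)
    push_cast at this
    linear_combination -this
  simp only [ContinuousLinearMap.coe_restrictScalars', map_smul, jacobiFibre_fibreVec q hJ, hp,
    smul_add, smul_smul] at h3
  have h4 := eq_sub_of_add_eq h3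
  simp only [add_apply, FunLike.coe_smul, Pi.smul_apply,
    FunLike.coe_sub, Pi.sub_apply, ContinuousLinearMap.comp_apply, h4, indexOp_fibreVec, map_smul,
    jacobiFibre_fibreVec q hJ, currentFibre_fibreVec q hJ, map_add]
  push_cast
  match_scalars <;> field_simp <;> ring

end JacobiFibre

/-! ### Transfer matrices and the discriminant -/

section Transfer

open scoped Matrix

variable (J : JacobiMatrix)

lemma JacobiMatrix.a_pos' (n : ℤ) : 0 < J.a n := by
  obtain ⟨δ, hδ, h⟩ := J.a_pos
  exact hδ.trans_le (h n)

/-- One step of the transfer matrix, acting on `(ψ_m, a_{m-1} ψ_{m-1})`. -/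
def transferStep (m : ℕ) : Matrix (Fin 2) (Fin 2) (Polynomial ℝ) :=
  !![Polynomial.C (1 / J.a m) * (Polynomial.X - Polynomial.C (J.b m)),
      -Polynomial.C (1 / J.a m); Polynomial.C (J.a m), 0]

/-- The transfer matrix from `0` to `m`, with polynomial entries in the energy. -/
def transferPoly : ℕ → Matrix (Fin 2) (Fin 2) (Polynomial ℝ)
  | 0 => 1
  | m + 1 => transferStep J m * transferPoly m

/-- Half the trace of the transfer matrix. -/
def discr (m : ℕ) : Polynomial ℝ := Polynomial.C (1 / 2) * (transferPoly J m).trace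

/-- The weight `a_{m-1}` in the second component of the state makes every single step unimodular. -/
lemma det_transferPoly (m : ℕ) : (transferPoly J m).det = 1 := by
  induction m with
  | zero => simp [transferPoly]
  | succ m ih =>
    rw [transferPoly, Matrix.det_mul, ih, mul_one, transferStep, Matrix.det_fin_two_of]
    have h : 1 / J.a m * J.a m = 1 := div_mul_cancel₀ _ (J.a_pos' m).ne'
    rw [mul_zero, zero_sub, neg_mul, neg_neg, ← Polynomial.C_mul, h, Polynomial.C_1]

lemma natDegree_transferPoly_le (m : ℕ) (i j : Fin 2) :
    (transferPoly J m i j).natDegree ≤ m := by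
  induction m generalizing i j with
  | zero =>
    rw [transferPoly, Matrix.one_apply]
    split_ifs <;> simp
  | succ m ih =>
    have hs : ∀ i k : Fin 2, (transferStep J m i k).natDegree ≤ 1 := by
      intro i k
      fin_cases i <;> fin_cases k
      · change (Polynomial.C (1 / J.a m) * (Polynomial.X - Polynomial.C (J.b m))).natDegree ≤ 1
        compute_degree
      · change (-Polynomial.C (1 / J.a m)).natDegree ≤ 1
        simp
      · change (Polynomial.C (J.a m)).natDegree ≤ 1
        simp
      · change (0 : Polynomial ℝ).natDegree ≤ 1
        simp
    rw [transferPoly, Matrix.mul_apply]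
    refine Polynomial.natDegree_sum_le_of_forall_le _ _ fun k _ => ?_
    refine Polynomial.natDegree_mul_le.trans ?_
    have := hs i k
    have := ih k j
    omega

lemma natDegree_discr_le (m : ℕ) : (discr J m).natDegree ≤ m := by
  rw [discr, Matrix.trace_fin_two]
  refine (Polynomial.natDegree_C_mul_le _ _).trans ?_
  exact (Polynomial.natDegree_add_le_of_degree_le (natDegree_transferPoly_le J m 0 0)
    (natDegree_transferPoly_le J m 1 1))

variable {J}

lemma transferPoly_add {p : ℕ} (hJ : J.IsPeriodic p) (m : ℕ) :
    transferPoly J (m + p) = transferPoly J m * transferPoly J p := by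
  induction m with
  | zero => simp [transferPoly]
  | succ m ih =>
    have hs : transferStep J (m + p) = transferStep J m := by
      simp only [transferStep, Nat.cast_add, (hJ _).1, (hJ _).2]
    rw [show m + 1 + p = (m + p) + 1 by ring, transferPoly, ih, hs, transferPoly, mul_assoc]

lemma transferPoly_mul {p : ℕ} (hJ : J.IsPeriodic p) (r : ℕ) :
    transferPoly J (p * r) = transferPoly J p ^ r := by
  induction r with
  | zero => simp [transferPoly]
  | succ r ih => rw [mul_add, mul_one, transferPoly_add hJ, ih, pow_succ]

/-- Cayley–Hamilton for a unimodular `N` reads `N² = (tr N) N - 1`, so the traces of powers satisfy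
the Chebyshev recursion. Here `h` plays the role of `1/2`. -/
lemma two_mul_T_eval_half_trace {A : Type*} [CommRing A] {h : A} (hh : 2 * h = 1)
    (N : Matrix (Fin 2) (Fin 2) A) (hN : N.det = 1) (r : ℕ) :
    (N ^ r).trace = 2 * (Polynomial.Chebyshev.T A r).eval (h * N.trace) := by
  have hch : N ^ 2 = N.trace • N - 1 := by
    ext i j
    have hd := hN
    rw [Matrix.det_fin_two] at hd
    fin_cases i <;> fin_cases j <;>
      simp [pow_two, Matrix.mul_apply, Fin.sum_univ_two, Matrix.trace_fin_two]
    · linear_combination -hd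
    · ring
    · ring
    · linear_combination -hd
  induction r using Nat.twoStepInduction with
  | zero => simp
  | one =>
    simp only [pow_one, Nat.cast_one, Polynomial.Chebyshev.T_one, Polynomial.eval_X]
    linear_combination (-N.trace) * hh
  | more r ih1 ih2 =>
    have e : N ^ (r + 2) = N.trace • N ^ (r + 1) - N ^ r := by
      rw [pow_add, hch, mul_sub, mul_one, Matrix.mul_smul, pow_succ]
    rw [e, Matrix.trace_sub, Matrix.trace_smul, ih1, ih2]
    have hT : Polynomial.Chebyshev.T A ((r + 2 : ℕ) : ℤ) =
        2 * Polynomial.X * Polynomial.Chebyshev.T A ((r + 1 : ℕ) : ℤ) -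
          Polynomial.Chebyshev.T A (r : ℤ) := by
      have := Polynomial.Chebyshev.T_add_two A (r : ℤ)
      push_cast
      exact this
    rw [hT]
    simp only [Polynomial.eval_sub, Polynomial.eval_mul, Polynomial.eval_X, Polynomial.eval_ofNat,
      smul_eq_mul]
    linear_combination (-2 * N.trace * (Polynomial.Chebyshev.T A ((r + 1 : ℕ) : ℤ)).eval
      (h * N.trace)) * hh

/-- The transfer matrix at a given energy. -/
def transferMat (J : JacobiMatrix) (μ : ℝ) (m : ℕ) : Matrix (Fin 2) (Fin 2) ℝ :=
  (Polynomial.evalRingHom μ).mapMatrix (transferPoly J m)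

lemma transferMat_succ (J : JacobiMatrix) (μ : ℝ) (m : ℕ) :
    transferMat J μ (m + 1) =
      !![1 / J.a m * (μ - J.b m), -(1 / J.a m); J.a m, 0] * transferMat J μ m := by
  rw [transferMat, transferPoly, map_mul, transferMat]
  congr 1
  ext i j
  fin_cases i <;> fin_cases j <;> simp [transferStep]

lemma det_transferMat (J : JacobiMatrix) (μ : ℝ) (m : ℕ) : (transferMat J μ m).det = 1 := by
  rw [transferMat, ← RingHom.map_det, det_transferPoly, map_one]

lemma discr_eval (J : JacobiMatrix) (μ : ℝ) (m : ℕ) :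
    (discr J m).eval μ = 1 / 2 * (transferMat J μ m).trace := by
  rw [discr, transferMat, Matrix.trace_fin_two, Matrix.trace_fin_two]
  simp

/-- Over `r` periods the transfer matrix is an `r`-th power. This is what relates consecutive
approximants, one period dividing the other. -/
lemma discr_mul_eval {p : ℕ} (hJ : J.IsPeriodic p) (μ : ℝ) (r : ℕ) :
    (discr J (p * r)).eval μ = (Polynomial.Chebyshev.T ℝ r).eval ((discr J p).eval μ) := by
  rw [discr_eval, discr_eval, transferMat, transferPoly_mul hJ, map_pow, ← transferMat]
  rw [two_mul_T_eval_half_trace (h := (1 / 2 : ℝ)) (by norm_num) _ (det_transferMat J μ p)]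
  rw [← mul_assoc]
  norm_num

/-- The state vector `(ψ_m, a_{m-1} ψ_{m-1})` of a solution. -/
def stateVec (J : JacobiMatrix) (ψ : ℤ → ℂ) (m : ℤ) : Fin 2 → ℂ :=
  ![ψ m, (J.a (m - 1) : ℂ) * ψ (m - 1)]

lemma stateVec_eq_mulVec {μ : ℝ} {ψ : ℤ → ℂ}
    (hψ : ∀ n : ℤ, (J.a n : ℂ) * ψ (n + 1) + J.b n * ψ n + J.a (n - 1) * ψ (n - 1) = μ * ψ n)
    (m : ℕ) : stateVec J ψ m =
      ((transferMat J μ m).map ((↑) : ℝ → ℂ)) *ᵥ stateVec J ψ 0 := by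
  induction m with
  | zero =>
    have : (transferMat J μ 0).map ((↑) : ℝ → ℂ) = 1 := by
      rw [transferMat, transferPoly, map_one]
      exact Matrix.map_one _ Complex.ofReal_zero Complex.ofReal_one
    rw [this, Matrix.one_mulVec, Nat.cast_zero]
  | succ m ih =>
    have hmap : ∀ S T : Matrix (Fin 2) (Fin 2) ℝ, (S * T).map ((↑) : ℝ → ℂ) =
        S.map ((↑) : ℝ → ℂ) * T.map ((↑) : ℝ → ℂ) := fun S T =>
          Matrix.map_mul (f := Complex.ofRealHom)
    rw [transferMat_succ, hmap, ← Matrix.mulVec_mulVec, ← ih]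
    have ha : (J.a m : ℂ) ≠ 0 := Complex.ofReal_ne_zero.mpr (J.a_pos' m).ne'
    have h := hψ m
    ext i
    fin_cases i
    · simp [stateVec, Matrix.mulVec, dotProduct, Fin.sum_univ_two]
      field_simp
      linear_combination h
    · simp [stateVec, Matrix.mulVec, dotProduct, Fin.sum_univ_two]

end Transfer

/-! ### Floquet solutions, the discriminant equation and simplicity of the eigenvalues. -/

section FloquetSolution

open scoped Matrix

variable (q : ℕ) [NeZero q] {J : JacobiMatrix}

/-- The Floquet solution on `ℤ` of a vector in the fibre. -/
def floquetSolution (x : ℝ) (v : Fibre q) (n : ℤ) : ℂ :=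
  inner ℂ (fibreVec q n (x : UnitAddCircle)) v

lemma floquetSolution_natCast (x : ℝ) (v : Fibre q) (k : Fin q) :
    floquetSolution q x v (k : ℤ) = v k := by
  rw [floquetSolution, fibreVec_natCast, EuclideanSpace.inner_single_left]
  simp

/-- The inner product is conjugate linear in `fibreVec`, so its phase `e^{-2πix}` per cell becomes
the multiplier `e^{2πix}`. -/
lemma floquetSolution_add (x : ℝ) (v : Fibre q) (n : ℤ) :
    floquetSolution q x v (n + q) =
      Complex.exp (2 * π * x * Complex.I) * floquetSolution q x v n := by
  have h := fibreVec_add_mul q n 1 (x : UnitAddCircle)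
  rw [one_mul] at h
  rw [floquetSolution, h, inner_smul_left, fourier_neg, Complex.conj_conj, fourier_coe_unit,
    floquetSolution]
  congr 2
  push_cast
  ring

lemma floquetSolution_eq (hJ : J.IsPeriodic q) {x μ : ℝ} {v : Fibre q}
    (hv : jacobiFibre q J (x : UnitAddCircle) v = (μ : ℂ) • v) (n : ℤ) :
    (J.a n : ℂ) * floquetSolution q x v (n + 1) + J.b n * floquetSolution q x v n +
      J.a (n - 1) * floquetSolution q x v (n - 1) = μ * floquetSolution q x v n := by
  have h := jacobiFibre_inner q hJ x (fibreVec q n (x : UnitAddCircle)) v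
  rw [hv, jacobiFibre_fibreVec q hJ, inner_smul_right] at h
  simpa [inner_add_left, inner_smul_left, floquetSolution] using h

/-- The recursion is of second order: the state at `0` determines the solution at all sites of the
cell. -/
lemma eq_zero_of_stateVec_eq_zero (hJ : J.IsPeriodic q) {x μ : ℝ} {v : Fibre q}
    (hv : jacobiFibre q J (x : UnitAddCircle) v = (μ : ℂ) • v)
    (h0 : stateVec J (floquetSolution q x v) 0 = 0) : v = 0 := by
  ext k
  have h := stateVec_eq_mulVec (floquetSolution_eq q hJ hv) k
  rw [h0, Matrix.mulVec_zero] at h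
  have := congrFun h 0
  simpa [stateVec, floquetSolution_natCast] using this

lemma transferMat_mulVec_stateVec (hJ : J.IsPeriodic q) {x μ : ℝ} {v : Fibre q}
    (hv : jacobiFibre q J (x : UnitAddCircle) v = (μ : ℂ) • v) :
    ((transferMat J μ q).map ((↑) : ℝ → ℂ)) *ᵥ stateVec J (floquetSolution q x v) 0 =
      Complex.exp (2 * π * x * Complex.I) • stateVec J (floquetSolution q x v) 0 := by
  rw [← stateVec_eq_mulVec (floquetSolution_eq q hJ hv) q]
  have h0 := floquetSolution_add q x v 0
  have h1 := floquetSolution_add q x v (-1)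
  have ha : J.a (q - 1) = J.a (-1) := by
    rw [show (q : ℤ) - 1 = -1 + q by ring, (hJ _).1]
  rw [zero_add] at h0
  rw [show (-1 : ℤ) + q = q - 1 by ring] at h1
  ext i
  fin_cases i
  · simp [stateVec, h0]
  · simp [stateVec, h1, ha]
    ring

lemma det_map_transferMat (J : JacobiMatrix) (μ : ℝ) (m : ℕ) :
    ((transferMat J μ m).map ((↑) : ℝ → ℂ)).det = 1 := by
  have := (Complex.ofRealHom.map_det (transferMat J μ m)).symm
  rw [det_transferMat, map_one] at this
  exact this

/-- Every eigenvalue of the fibre at `x` is a root of `discr = cos 2πx`. -/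
lemma discr_eval_of_eigenvector (hJ : J.IsPeriodic q) {x μ : ℝ} {v : Fibre q}
    (hv : jacobiFibre q J (x : UnitAddCircle) v = (μ : ℂ) • v) (hv0 : v ≠ 0) :
    (discr J q).eval μ = Real.cos (2 * π * x) := by
  set s := stateVec J (floquetSolution q x v) 0 with hs
  have hs0 : s ≠ 0 := fun h => hv0 (eq_zero_of_stateVec_eq_zero q hJ hv h)
  have hN := transferMat_mulVec_stateVec q hJ hv
  have hdetN := det_map_transferMat J μ q
  set z := Complex.exp (2 * π * x * Complex.I) with hz
  set N := (transferMat J μ q).map ((↑) : ℝ → ℂ) with hNdef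
  -- `z` is an eigenvalue of the unimodular `N`, hence `tr N = z + z⁻¹ = 2 cos 2πx`.
  have hdet : (N - z • (1 : Matrix (Fin 2) (Fin 2) ℂ)).det = 0 := by
    rw [← Matrix.exists_mulVec_eq_zero_iff]
    refine ⟨s, hs0, ?_⟩
    rw [Matrix.sub_mulVec, hN, Matrix.smul_mulVec, Matrix.one_mulVec, sub_self]
  have hz1 : z * Complex.exp (-(2 * π * x * Complex.I)) = 1 := by
    rw [hz, ← Complex.exp_add, add_neg_cancel, Complex.exp_zero]
  have htr : N.trace = ((transferMat J μ q).trace : ℂ) := by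
    rw [Matrix.trace_fin_two, Matrix.trace_fin_two]
    simp [hNdef]
  rw [Matrix.det_fin_two] at hdet hdetN
  simp at hdet
  have h2 : N.trace = z + Complex.exp (-(2 * π * x * Complex.I)) := by
    rw [Matrix.trace_fin_two]
    have hz0 : z ≠ 0 := Complex.exp_ne_zero _
    apply mul_left_cancel₀ hz0
    linear_combination hdetN - hdet - hz1
  have h3 : ((transferMat J μ q).trace : ℂ) = ((2 * Real.cos (2 * π * x) : ℝ) : ℂ) := by
    rw [← htr, h2, hz]
    push_cast
    rw [Complex.cos]
    ring_nf
  have h4 := Complex.ofReal_injective h3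
  rw [discr_eval, h4]
  ring

lemma stateVec_sub_smul (J : JacobiMatrix) (x : ℝ) (v w : Fibre q) (α β : ℂ) :
    stateVec J (floquetSolution q x (α • v - β • w)) 0 =
      α • stateVec J (floquetSolution q x v) 0 - β • stateVec J (floquetSolution q x w) 0 := by
  ext i
  fin_cases i
  · simp only [stateVec, floquetSolution, inner_sub_right, inner_smul_right]
    simp
  · simp only [stateVec, floquetSolution, inner_sub_right, inner_smul_right]
    simp
    ring

/-- Away from the band edges the eigenvalues of the fibre are simple. -/
lemma not_orthogonal_eigenvectors (hJ : J.IsPeriodic q) {x μ : ℝ} {v w : Fibre q}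
    (hx : Real.sin (2 * π * x) ≠ 0)
    (hv : jacobiFibre q J (x : UnitAddCircle) v = (μ : ℂ) • v)
    (hw : jacobiFibre q J (x : UnitAddCircle) w = (μ : ℂ) • w)
    (hv0 : v ≠ 0) (hw0 : w ≠ 0) : inner ℂ v w ≠ 0 := by
  intro hvw
  set s := stateVec J (floquetSolution q x v) 0 with hs
  set s' := stateVec J (floquetSolution q x w) 0 with hs'
  have hN := transferMat_mulVec_stateVec q hJ hv
  have hN' := transferMat_mulVec_stateVec q hJ hw
  have hdetN := det_map_transferMat J μ q
  set z := Complex.exp (2 * π * x * Complex.I) with hz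
  set N := (transferMat J μ q).map ((↑) : ℝ → ℂ) with hNdef
  -- The Wronskian of the two states is preserved by `N`, since `det N = 1`, and is also multiplied
  -- by `z²`. It therefore vanishes unless `z² = 1`, that is, unless `sin 2πx = 0`.
  have hW : (z ^ 2 - 1) * (s 0 * s' 1 - s 1 * s' 0) = 0 := by
    have e0 := congrFun hN 0
    have e1 := congrFun hN 1
    have f0 := congrFun hN' 0
    have f1 := congrFun hN' 1
    rw [Matrix.det_fin_two] at hdetN
    simp only [Matrix.mulVec, dotProduct, Fin.sum_univ_two, Pi.smul_apply, smul_eq_mul, ← hs,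
      ← hs'] at e0 e1 f0 f1
    have g : (z * s 0) * (z * s' 1) - (z * s 1) * (z * s' 0) = s 0 * s' 1 - s 1 * s' 0 := by
      rw [← e0, ← e1, ← f0, ← f1]
      linear_combination (s 0 * s' 1 - s 1 * s' 0) * hdetN
    linear_combination g
  have hz2 : z ^ 2 - 1 ≠ 0 := by
    intro h
    apply hx
    have hzz : z * Complex.exp (-(2 * π * x * Complex.I)) = 1 := by
      rw [hz, ← Complex.exp_add, add_neg_cancel, Complex.exp_zero]
    have h5 : z = Complex.exp (-(2 * π * x * Complex.I)) := by
      apply mul_left_cancel₀ (Complex.exp_ne_zero (2 * π * x * Complex.I))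
      rw [← hz]
      linear_combination h - hzz
    have h6 : ((Real.sin (2 * π * x) : ℝ) : ℂ) = 0 := by
      push_cast
      rw [Complex.sin, neg_mul, ← h5, hz, sub_self]
      simp
    exact_mod_cast h6
  have hW0 := (mul_eq_zero.mp hW).resolve_left hz2
  -- As the Wronskian vanishes, `s' i • v - s i • w` has zero initial state and is zero. Pairing it
  -- with `w ⟂ v` leaves `s i ‖w‖² = 0`.
  have key : ∀ i : Fin 2, s i = 0 := by
    intro i
    have hc : s' i • v - s i • w = 0 := by
      refine eq_zero_of_stateVec_eq_zero (x := x) (μ := μ) q hJ ?_ ?_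
      · rw [map_sub, map_smul, map_smul, hv, hw, smul_sub, smul_comm, smul_comm (s i)]
      · rw [stateVec_sub_smul, ← hs, ← hs']
        ext j
        fin_cases i <;> fin_cases j <;> simp
        · ring
        · linear_combination -hW0
        · linear_combination hW0
        · ring
    have h1 := congrArg (fun y => inner ℂ w y) hc
    simp only [inner_sub_right, inner_smul_right, inner_zero_right] at h1
    rw [inner_eq_zero_symm.mp hvw, mul_zero, zero_sub, neg_eq_zero, mul_eq_zero] at h1
    exact h1.resolve_right (inner_self_ne_zero.mpr hw0)
  apply hv0
  refine eq_zero_of_stateVec_eq_zero q hJ hv ?_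
  ext i
  exact key i

lemma floquetEig_strictMono (hJ : J.IsPeriodic q) {x : ℝ} (hx : Real.sin (2 * π * x) ≠ 0) :
    StrictMono fun k : Fin q => floquetEig q J k x := by
  refine (floquetEig_monotone q J x).strictMono_of_injective fun k l hkl => ?_
  obtain ⟨b, hb⟩ := exists_eigenbasis q hJ x
  by_contra hne
  have hl := hb l
  rw [← show floquetEig q J k x = floquetEig q J l x from hkl] at hl
  exact not_orthogonal_eigenvectors q hJ hx (hb k) hl (b.orthonormal.ne_zero k)
    (b.orthonormal.ne_zero l) (b.orthonormal.inner_eq_zero hne)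

lemma discr_eval_floquetEig (hJ : J.IsPeriodic q) (k : Fin q) (x : ℝ) :
    (discr J q).eval (floquetEig q J k x) = Real.cos (2 * π * x) := by
  obtain ⟨b, hb⟩ := exists_eigenbasis q hJ x
  exact discr_eval_of_eigenvector q hJ (hb k) (b.orthonormal.ne_zero k)

end FloquetSolution

/-! ### Differentiability of the band functions and Last's lower bound -/

section Bands

variable (q : ℕ) [NeZero q] {J : JacobiMatrix}

/-- The `q` distinct eigenvalues are roots of a polynomial of degree at most `q`, so they exhaust
its roots and all of them are simple. -/
lemma roots_discr_sub (hJ : J.IsPeriodic q) {x : ℝ} (hx : Real.sin (2 * π * x) ≠ 0) :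
    (discr J q - Polynomial.C (Real.cos (2 * π * x))).roots =
      (Finset.univ.image fun k : Fin q => floquetEig q J k x).val ∧
    discr J q - Polynomial.C (Real.cos (2 * π * x)) ≠ 0 := by
  set P := discr J q - Polynomial.C (Real.cos (2 * π * x)) with hP
  have hP0 : P ≠ 0 := by
    intro h
    have h' : discr J q = Polynomial.C (Real.cos (2 * π * x)) := sub_eq_zero.mp h
    -- The discriminant is not constant: it equals `1` at an eigenvalue for `θ = 0` and `-1` at one
    -- for `θ = 1/2`.
    have h0 := discr_eval_floquetEig q hJ 0 0
    have h1 := discr_eval_floquetEig q hJ 0 (1 / 2)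
    rw [h', Polynomial.eval_C] at h0 h1
    rw [h0, show 2 * π * (1 / 2) = π by ring, mul_zero, Real.cos_zero, Real.cos_pi] at h1
    norm_num at h1
  refine ⟨?_, hP0⟩
  symm
  apply Multiset.eq_of_le_of_card_le
  · rw [Multiset.le_iff_subset (Finset.nodup _)]
    intro μ hμ
    rw [Finset.mem_val, Finset.mem_image] at hμ
    obtain ⟨k, -, rfl⟩ := hμ
    rw [Polynomial.mem_roots hP0, Polynomial.IsRoot, hP, Polynomial.eval_sub, Polynomial.eval_C,
      discr_eval_floquetEig q hJ, sub_self]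
  · rw [Finset.card_val, Finset.card_image_of_injective _ (floquetEig_strictMono q hJ hx).injective,
      Finset.card_univ, Fintype.card_fin]
    refine (Polynomial.card_roots' P).trans ?_
    rw [hP, Polynomial.natDegree_sub_C]
    exact natDegree_discr_le J q

lemma exists_floquetEig_eq (hJ : J.IsPeriodic q) {x : ℝ} (hx : Real.sin (2 * π * x) ≠ 0) {μ : ℝ}
    (hμ : (discr J q).eval μ = Real.cos (2 * π * x)) : ∃ k : Fin q, floquetEig q J k x = μ := by
  obtain ⟨h, h0⟩ := roots_discr_sub q hJ hx
  have hmem : μ ∈ (discr J q - Polynomial.C (Real.cos (2 * π * x))).roots := by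
    rw [Polynomial.mem_roots h0, Polynomial.IsRoot, Polynomial.eval_sub, Polynomial.eval_C, hμ,
      sub_self]
  rw [h, Finset.mem_val, Finset.mem_image] at hmem
  obtain ⟨k, -, hk⟩ := hmem
  exact ⟨k, hk⟩

lemma derivative_discr_ne_zero (hJ : J.IsPeriodic q) {x : ℝ} (hx : Real.sin (2 * π * x) ≠ 0)
    (k : Fin q) : (Polynomial.derivative (discr J q)).eval (floquetEig q J k x) ≠ 0 := by
  obtain ⟨h, h0⟩ := roots_discr_sub q hJ hx
  intro hd
  have h1 : 1 < (discr J q - Polynomial.C (Real.cos (2 * π * x))).rootMultiplicity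
      (floquetEig q J k x) := by
    rw [Polynomial.one_lt_rootMultiplicity_iff_isRoot h0]
    refine ⟨?_, ?_⟩
    · rw [Polynomial.IsRoot, Polynomial.eval_sub, Polynomial.eval_C, discr_eval_floquetEig q hJ,
        sub_self]
    · rw [Polynomial.IsRoot, Polynomial.derivative_sub, Polynomial.derivative_C, sub_zero, hd]
  rw [← Polynomial.count_roots, h] at h1
  have h2 := Multiset.nodup_iff_count_le_one.mp
    (Finset.nodup (Finset.univ.image fun k : Fin q => floquetEig q J k x)) (floquetEig q J k x)
  omega

lemma StrictMono.eq_of_range_subset {n : ℕ} {f g : Fin n → ℝ} (hf : StrictMono f)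
    (hg : StrictMono g) (h : ∀ k, ∃ l, g l = f k) : f = g := by
  classical
  have hsub : Finset.univ.image f ⊆ Finset.univ.image g := by
    intro y hy
    rw [Finset.mem_image] at hy ⊢
    obtain ⟨k, -, rfl⟩ := hy
    obtain ⟨l, hl⟩ := h k
    exact ⟨l, Finset.mem_univ _, hl⟩
  have heq := Finset.eq_of_subset_of_card_le hsub (by
    rw [Finset.card_image_of_injective _ hf.injective,
      Finset.card_image_of_injective _ hg.injective])
  refine (StrictMono.range_inj hf hg).mp ?_
  have := congrArg (fun s : Finset ℝ => (s : Set ℝ)) heq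
  simpa using this

/-- Invert the discriminant locally at each simple root. Near `x` the branches `g k (cos 2πy)` are
`q` solutions that stay strictly ordered, so they must be the sorted eigenvalues, and the chain rule
gives the derivative. -/
lemma hasDerivAt_floquetEig (hJ : J.IsPeriodic q) {x : ℝ} (hx : Real.sin (2 * π * x) ≠ 0)
    (k : Fin q) : HasDerivAt (floquetEig q J k)
      (((Polynomial.derivative (discr J q)).eval (floquetEig q J k x))⁻¹ *
        (-(2 * π * Real.sin (2 * π * x)))) x := by
  have hu : ∀ k : Fin q, HasStrictDerivAt (fun μ => (discr J q).eval μ)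
      ((Polynomial.derivative (discr J q)).eval (floquetEig q J k x)) (floquetEig q J k x) :=
    fun k => (discr J q).hasStrictDerivAt _
  have hu0 := fun k => derivative_discr_ne_zero q hJ hx k
  have huv := fun k => discr_eval_floquetEig q hJ k x
  let g : Fin q → ℝ → ℝ := fun k => (hu k).localInverse _ _ _ (hu0 k)
  have hg : ∀ k, HasDerivAt (g k)
      ((Polynomial.derivative (discr J q)).eval (floquetEig q J k x))⁻¹
      (Real.cos (2 * π * x)) := by
    intro k
    have := ((hu k).to_localInverse (hu0 k)).hasDerivAt
    simp only [huv] at this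
    exact this
  have hcos : HasDerivAt (fun y : ℝ => Real.cos (2 * π * y)) (-(2 * π * Real.sin (2 * π * x)))
      x := by
    have h1 : HasDerivAt (fun y : ℝ => 2 * π * y) (2 * π) x := by
      simpa using (hasDerivAt_id x).const_mul (2 * π)
    convert! h1.cos using 1
    ring
  have hG : ∀ k, HasDerivAt (fun y => g k (Real.cos (2 * π * y)))
      (((Polynomial.derivative (discr J q)).eval (floquetEig q J k x))⁻¹ *
        (-(2 * π * Real.sin (2 * π * x)))) x := fun k => (hg k).comp x hcos
  have hGx : ∀ k, g k (Real.cos (2 * π * x)) = floquetEig q J k x := by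
    intro k
    have := ((hu k).hasStrictFDerivAt_equiv (hu0 k)).localInverse_apply_image
    simp only [huv] at this
    exact this
  have hev1 : ∀ᶠ y in 𝓝 x, ∀ k, (discr J q).eval (g k (Real.cos (2 * π * y))) =
      Real.cos (2 * π * y) := by
    rw [Filter.eventually_all]
    intro k
    have := (hu k).eventually_right_inverse (hu0 k)
    simp only [huv] at this
    exact hcos.continuousAt.eventually this
  have hev2 : ∀ᶠ y in 𝓝 x, StrictMono fun k => g k (Real.cos (2 * π * y)) := by
    have : ∀ᶠ y in 𝓝 x, ∀ k l : Fin q, k < l →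
        g k (Real.cos (2 * π * y)) < g l (Real.cos (2 * π * y)) := by
      rw [Filter.eventually_all]
      intro k
      rw [Filter.eventually_all]
      intro l
      rw [Filter.eventually_imp_distrib_left]
      intro hkl
      refine (hG k).continuousAt.eventually_lt (hG l).continuousAt ?_
      simp only [hGx]
      exact floquetEig_strictMono q hJ hx hkl
    filter_upwards [this] with y hy k l hkl
    exact hy k l hkl
  have hev3 : ∀ᶠ y in 𝓝 x, Real.sin (2 * π * y) ≠ 0 := by
    have hc : ContinuousAt (fun y : ℝ => Real.sin (2 * π * y)) x := by fun_prop
    exact hc.eventually_ne hx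
  refine (hG k).congr_of_eventuallyEq ?_
  filter_upwards [hev1, hev2, hev3] with y h1 h2 h3
  have := StrictMono.eq_of_range_subset h2 (floquetEig_strictMono q hJ h3)
    (fun k => exists_floquetEig_eq q hJ h3 (h1 k))
  exact (congrFun this k).symm

lemma abs_floquetEig_le {R : ℝ} (hJ : J.IsPeriodic q) (hR : J.IsRBounded R) (k : Fin q)
    (x : ℝ) : |floquetEig q J k x| ≤ 3 * R := by
  obtain ⟨b, hb⟩ := exists_eigenbasis q hJ x
  have ha : ∀ n, ‖(J.a n : ℂ)‖ ≤ R := fun n => by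
    rw [Complex.norm_real, Real.norm_eq_abs, abs_of_pos (J.a_pos' n)]
    exact (hR n).2.1
  have hbb : ∀ n, ‖(J.b n : ℂ)‖ ≤ R := fun n => by
    rw [Complex.norm_real, Real.norm_eq_abs]
    exact (hR n).2.2
  have h1 := norm_triFibre_le q ha hbb (fun n => ha (n - 1)) (x : UnitAddCircle)
  have h2 := (jacobiFibre q J (x : UnitAddCircle)).le_opNorm (b k)
  rw [hb, norm_smul, b.orthonormal.norm_eq_one, mul_one, mul_one, Complex.norm_real,
    Real.norm_eq_abs] at h2
  have h3 : ‖jacobiFibre q J (x : UnitAddCircle)‖ ≤ R + R + R := h1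
  linarith

/-- Since `1/a ≤ R` and `|μ - b| ≤ 4R`, the absolute row sums of one transfer step are at most `4R²
+ R` and `R`. The extra `1` in the base makes it at least `1`, and differentiating one of the `m`
steps costs the factor `m`. -/
lemma transferMat_bounds {R : ℝ} (hR0 : 0 < R) (hR : J.IsRBounded R) {μ : ℝ}
    (hμ : |μ| ≤ 3 * R) (m : ℕ) (i j : Fin 2) :
    |(transferPoly J m i j).eval μ| ≤ (4 * R ^ 2 + R + 1) ^ m ∧
      |(Polynomial.derivative (transferPoly J m i j)).eval μ| ≤ m * (4 * R ^ 2 + R + 1) ^ m := by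
  set κ := 4 * R ^ 2 + R + 1 with hκ
  have hκ1 : 1 ≤ κ := by nlinarith
  induction m generalizing i j with
  | zero =>
    rw [transferPoly, Matrix.one_apply]
    split_ifs <;> simp
  | succ m ih =>
    have ha := J.a_pos' m
    obtain ⟨h1, h2, h3⟩ := hR m
    have hinv : 1 / J.a m ≤ R := by
      rw [div_le_iff₀ ha]
      rw [div_le_iff₀ hR0] at h1
      linarith
    have hinv0 : 0 < 1 / J.a m := by positivity
    have hμb : |μ - J.b m| ≤ 4 * R := (abs_sub _ _).trans (by linarith)
    have hκm : 0 < κ ^ m := by positivity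
    fin_cases i
    · have e : transferPoly J (m + 1) 0 j = Polynomial.C (1 / J.a m) *
          (Polynomial.X - Polynomial.C (J.b m)) * transferPoly J m 0 j -
          Polynomial.C (1 / J.a m) * transferPoly J m 1 j := by
        rw [transferPoly, Matrix.mul_apply, Fin.sum_univ_two, transferStep]
        simp
        ring
      obtain ⟨A0, D0⟩ := ih 0 j
      obtain ⟨A1, D1⟩ := ih 1 j
      have hstep : ∀ {s t B : ℝ}, |s| ≤ B → |t| ≤ B → 0 ≤ B →
          |1 / J.a m * (μ - J.b m) * s - 1 / J.a m * t| ≤ (4 * R ^ 2 + R) * B := by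
        intro s t B hs ht hB
        calc |1 / J.a m * (μ - J.b m) * s - 1 / J.a m * t|
            ≤ |1 / J.a m * (μ - J.b m) * s| + |1 / J.a m * t| := abs_sub _ _
          _ = 1 / J.a m * |μ - J.b m| * |s| + 1 / J.a m * |t| := by
            rw [abs_mul, abs_mul, abs_mul, abs_of_pos hinv0]
          _ ≤ R * (4 * R) * B + R * B := by gcongr
          _ = (4 * R ^ 2 + R) * B := by ring
      change |(transferPoly J (m + 1) 0 j).eval μ| ≤ _ ∧
        |(Polynomial.derivative (transferPoly J (m + 1) 0 j)).eval μ| ≤ _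
      rw [e]
      constructor
      · simp only [Polynomial.eval_sub, Polynomial.eval_mul, Polynomial.eval_C, Polynomial.eval_X]
        refine (hstep A0 A1 hκm.le).trans ?_
        rw [pow_succ, mul_comm]
        exact mul_le_mul_of_nonneg_left (by linarith) hκm.le
      · simp only [Polynomial.derivative_sub, Polynomial.derivative_mul, Polynomial.derivative_C,
          Polynomial.derivative_X, zero_mul, zero_add, sub_zero, mul_one, Polynomial.eval_sub,
          Polynomial.eval_mul, Polynomial.eval_add, Polynomial.eval_C, Polynomial.eval_X]
        have h5 := hstep D0 D1 (by positivity)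
        have h6 : |1 / J.a m * (transferPoly J m 0 j).eval μ| ≤ R * κ ^ m := by
          rw [abs_mul, abs_of_pos hinv0]
          gcongr
        rw [add_sub_assoc]
        refine (abs_add_le _ _).trans ((add_le_add h6 h5).trans ?_)
        rw [pow_succ κ m]
        push_cast
        have : (4 * R ^ 2 + R) * (m * κ ^ m) ≤ κ * (m * κ ^ m) := by
          gcongr
          linarith
        have : R * κ ^ m ≤ κ * κ ^ m := by
          gcongr
          nlinarith
        linarith
    · have e : transferPoly J (m + 1) 1 j = Polynomial.C (J.a m) * transferPoly J m 0 j := by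
        rw [transferPoly, Matrix.mul_apply, Fin.sum_univ_two, transferStep]
        simp
      obtain ⟨A0, D0⟩ := ih 0 j
      have hRκ : R ≤ κ := by nlinarith
      change |(transferPoly J (m + 1) 1 j).eval μ| ≤ _ ∧
        |(Polynomial.derivative (transferPoly J (m + 1) 1 j)).eval μ| ≤ _
      rw [e]
      constructor
      · rw [Polynomial.eval_mul, Polynomial.eval_C, abs_mul, abs_of_pos ha, pow_succ, mul_comm]
        gcongr
        linarith
      · rw [Polynomial.derivative_C_mul, Polynomial.eval_mul, Polynomial.eval_C, abs_mul,
          abs_of_pos ha, pow_succ]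
        calc J.a m * |(Polynomial.derivative (transferPoly J m 0 j)).eval μ|
            ≤ κ * (m * κ ^ m) := by
              gcongr
              linarith
          _ ≤ ((m + 1 : ℕ) : ℝ) * (κ ^ m * κ) := by
              push_cast
              nlinarith [mul_pos hκm (by linarith : 0 < κ)]

lemma abs_derivative_discr_le {R : ℝ} (hR0 : 0 < R) (hR : J.IsRBounded R) {μ : ℝ}
    (hμ : |μ| ≤ 3 * R) (m : ℕ) :
    |(Polynomial.derivative (discr J m)).eval μ| ≤ m * (4 * R ^ 2 + R + 1) ^ m := by
  have h0 := (transferMat_bounds hR0 hR hμ m 0 0).2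
  have h1 := (transferMat_bounds hR0 hR hμ m 1 1).2
  rw [discr, Matrix.trace_fin_two, Polynomial.derivative_C_mul, Polynomial.derivative_add,
    Polynomial.eval_mul, Polynomial.eval_C, Polynomial.eval_add, abs_mul]
  rw [abs_of_pos (by norm_num : (0 : ℝ) < 1 / 2)]
  have := abs_add_le ((Polynomial.derivative (transferPoly J m 0 0)).eval μ)
    ((Polynomial.derivative (transferPoly J m 1 1)).eval μ)
  linarith

end Bands

/-- Last's lower bound on the derivatives of the band functions. -/
lemma exists_isLastConstant {R : ℝ} (hR : 0 < R) : ∃ c : ℝ, 0 < c ∧ IsLastConstant R c := by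
  set κ := 4 * R ^ 2 + R + 1 with hκ
  have hκ1 : 1 < κ := by nlinarith
  have hlog : 0 < Real.log κ := Real.log_pos hκ1
  -- `κ` is the growth of the transfer matrix per site; the summand `1` absorbs the factor `q ≤ e^q`
  -- in the bound for the derivative.
  refine ⟨1 + Real.log κ, by linarith, ?_⟩
  intro q J hq hJ hJR k x
  have : NeZero q := ⟨by omega⟩
  by_cases hx : Real.sin (2 * π * x) = 0
  · rw [hx, abs_zero, mul_zero]
    exact abs_nonneg _
  rw [(hasDerivAt_floquetEig q hJ hx k).deriv]
  have hd := abs_derivative_discr_le hR hJR (abs_floquetEig_le q hJ hJR k x) q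
  have hd0 := derivative_discr_ne_zero q hJ hx k
  set d := (Polynomial.derivative (discr J q)).eval (floquetEig q J k x) with hdd
  rw [abs_mul, abs_inv, abs_neg, abs_mul, abs_of_pos (by positivity : (0 : ℝ) < 2 * π), ← hκ] at *
  have hdpos : 0 < |d| := abs_pos.mpr hd0
  have hexp : Real.exp (-((1 + Real.log κ) * q)) * |d| ≤ 1 := by
    have h1 : Real.exp (-((1 + Real.log κ) * q)) = (Real.exp q * κ ^ q)⁻¹ := by
      rw [← Real.exp_log (by linarith : 0 < κ), ← Real.exp_nat_mul, ← Real.exp_add,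
        ← Real.exp_neg, Real.exp_log (by linarith : 0 < κ)]
      congr 1
      ring
    rw [h1, inv_mul_le_iff₀ (by positivity), mul_one]
    refine hd.trans ?_
    gcongr
    linarith [Real.add_one_le_exp (q : ℝ)]
  rw [inv_mul_eq_div, le_div_iff₀ hdpos]
  have hs := abs_nonneg (Real.sin (2 * π * x))
  have hpi := Real.pi_gt_three
  calc Real.exp (-((1 + Real.log κ) * q)) * |Real.sin (2 * π * x)| * |d|
      = (Real.exp (-((1 + Real.log κ) * q)) * |d|) * |Real.sin (2 * π * x)| := by ring
    _ ≤ 1 * |Real.sin (2 * π * x)| := by gcongr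
    _ ≤ 2 * π * |Real.sin (2 * π * x)| := by gcongr; linarith

/-! ### Spectral gaps of the fibres of a periodic Jacobi matrix seen with a larger period -/

/-- The slope is bounded only inside `|f| < 1`, so the mean value theorem is applied up to the first
point `c` at which `|f|` reaches `1`. -/
lemma one_sub_abs_le_of_exit {f f' : ℝ → ℝ} (hf : ∀ x, HasDerivAt f (f' x) x) {K : ℝ}
    (hK : ∀ x, |f x| < 1 → |f' x| ≤ K) {a ξ : ℝ} (hlt : a < ξ) (ha : |f a| < 1)
    (hξ : 1 ≤ |f ξ|) : 1 - |f a| ≤ K * (ξ - a) := by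
  have hcont : Continuous f := continuous_iff_continuousAt.mpr fun x => (hf x).continuousAt
  have hcomp : IsCompact (Set.Icc a ξ ∩ {x | 1 ≤ |f x|}) :=
    isCompact_Icc.inter_right (isClosed_le continuous_const hcont.abs)
  obtain ⟨c, ⟨⟨hac, hcξ⟩, hc1⟩, hmin⟩ := hcomp.exists_isLeast ⟨ξ, ⟨hlt.le, le_rfl⟩, hξ⟩
  have hac' : a < c := by
    refine lt_of_le_of_ne hac fun h => ?_
    have hc1' : 1 ≤ |f c| := hc1
    rw [← h] at hc1'
    linarith
  obtain ⟨η, ⟨hη1, hη2⟩, hη⟩ := exists_hasDerivAt_eq_slope f f' hac' hcont.continuousOn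
    fun x _ => hf x
  have hη3 : |f η| < 1 := by
    by_contra h
    exact absurd (hmin ⟨⟨hη1.le, hη2.le.trans hcξ⟩, not_lt.mp h⟩) (not_le.mpr hη2)
  have h1 := hK η hη3
  have hca : 0 < c - a := sub_pos.mpr hac'
  rw [hη, abs_div, abs_of_pos hca, div_le_iff₀ hca] at h1
  have h2 := abs_sub_abs_le_abs_sub (f c) (f a)
  have hc1' : 1 ≤ |f c| := hc1
  have hK0 : 0 ≤ K := (abs_nonneg _).trans (hK η hη3)
  have h3 : K * (c - a) ≤ K * (ξ - a) := by gcongr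
  linarith

/-- Two solutions of `f = v` are separated by a critical point, where `|f| ≥ 1`. -/
lemma two_mul_one_sub_abs_le {f f' : ℝ → ℝ} (hf : ∀ x, HasDerivAt f (f' x) x) {K : ℝ}
    (hK : ∀ x, |f x| < 1 → f' x ≠ 0 ∧ |f' x| ≤ K) {a b v : ℝ} (hab : a < b) (ha : f a = v)
    (hb : f b = v) (hv : |v| < 1) : 2 * (1 - |v|) ≤ K * (b - a) := by
  have hcont : Continuous f := continuous_iff_continuousAt.mpr fun x => (hf x).continuousAt
  obtain ⟨ξ, ⟨h1, h2⟩, h3⟩ := exists_hasDerivAt_eq_zero hab hcont.continuousOn (ha.trans hb.symm)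
    fun x _ => hf x
  have hξ : 1 ≤ |f ξ| := by
    by_contra h
    exact (hK ξ (not_le.mp h)).1 h3
  have e1 := one_sub_abs_le_of_exit hf (fun x hx => (hK x hx).2) h1 (by rwa [ha]) hξ
  -- The stretch between the critical point and `b` is the same estimate for the reflected function.
  have hg : ∀ x, HasDerivAt (fun y => f (-y)) (-f' (-x)) x := by
    intro x
    simpa [Function.comp_def] using (hf (-x)).comp x (hasDerivAt_neg x)
  have e2 := one_sub_abs_le_of_exit hg (K := K)
    (fun x hx => by rw [abs_neg]; exact (hK _ hx).2) (neg_lt_neg h2)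
    (by rwa [neg_neg, hb]) (by rwa [neg_neg])
  rw [ha] at e1
  rw [neg_neg, hb] at e2
  linarith

lemma abs_sin_natCast_mul_le (r : ℕ) (α : ℝ) : |Real.sin (r * α)| ≤ r * |Real.sin α| := by
  induction r with
  | zero => simp
  | succ r ih =>
    push_cast
    rw [add_mul, one_mul, Real.sin_add]
    refine (abs_add_le _ _).trans ?_
    rw [abs_mul, abs_mul]
    have h1 := Real.abs_cos_le_one α
    have h2 := Real.abs_cos_le_one (r * α)
    nlinarith [abs_nonneg (Real.sin (r * α)), abs_nonneg (Real.sin α)]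

/-- Differentiating `T_r(cos β) = cos rβ` gives `T_r'(cos α) sin α = r sin rα`. Here `sin rα ≠ 0`
because `|cos rα| < 1`, and `|sin rα| ≤ r |sin α|`. -/
lemma derivative_chebyshev_T_bounds {r : ℕ} (hr : r ≠ 0) {u : ℝ}
    (hu : |(Polynomial.Chebyshev.T ℝ r).eval u| < 1) : |u| < 1 ∧
      (Polynomial.derivative (Polynomial.Chebyshev.T ℝ r)).eval u ≠ 0 ∧
      |(Polynomial.derivative (Polynomial.Chebyshev.T ℝ r)).eval u| ≤ (r : ℝ) ^ 2 := by
  have hu1 : |u| < 1 := by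
    by_contra h
    exact absurd (Polynomial.Chebyshev.one_le_abs_eval_T_real r (not_lt.mp h)) (not_le.mpr hu)
  refine ⟨hu1, ?_⟩
  rw [abs_lt] at hu1
  set α := Real.arccos u with hα
  have hcos : Real.cos α = u := Real.cos_arccos hu1.1.le hu1.2.le
  have hT : ∀ β : ℝ, (Polynomial.Chebyshev.T ℝ r).eval (Real.cos β) = Real.cos (r * β) := by
    intro β
    exact_mod_cast Polynomial.Chebyshev.T_real_cos β r
  have h1 : HasDerivAt (fun β : ℝ => (Polynomial.Chebyshev.T ℝ r).eval (Real.cos β))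
      ((Polynomial.derivative (Polynomial.Chebyshev.T ℝ r)).eval u * (-Real.sin α)) α := by
    have := ((Polynomial.Chebyshev.T ℝ r).hasDerivAt (Real.cos α)).comp α (Real.hasDerivAt_cos α)
    rw [hcos] at this
    exact this
  have h2 : HasDerivAt (fun β : ℝ => Real.cos (r * β)) (-Real.sin (r * α) * r) α := by
    have h : HasDerivAt (fun β : ℝ => (r : ℝ) * β) r α := by
      simpa using (hasDerivAt_id α).const_mul (r : ℝ)
    exact h.cos
  simp only [hT] at h1
  have h3 := h1.unique h2
  have hs : 0 < Real.sin α := by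
    rw [hα, Real.sin_arccos]
    apply Real.sqrt_pos.mpr
    nlinarith
  rw [← hcos, hT] at hu
  have hr0 : (0 : ℝ) < r := Nat.cast_pos.mpr (Nat.pos_of_ne_zero hr)
  have hrs : Real.sin (r * α) ≠ 0 := by
    intro h
    have := Real.sin_sq_add_cos_sq (r * α)
    rw [h] at this
    rw [abs_lt] at hu
    nlinarith
  constructor
  · intro h0
    rw [h0, zero_mul] at h3
    exact mul_ne_zero (neg_ne_zero.mpr hrs) hr0.ne' h3.symm
  · have h4 := congrArg abs h3
    rw [abs_mul, abs_mul, abs_neg, abs_neg, abs_of_pos hs, abs_of_pos hr0] at h4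
    have h5 := abs_sin_natCast_mul_le r α
    rw [abs_of_pos hs] at h5
    refine le_of_mul_le_mul_right ?_ hs
    rw [h4]
    nlinarith

section Gaps

variable {J : JacobiMatrix}

/-- An energy with `|Δ| < 1` is an eigenvalue at `x = arccos Δ / 2π`. There `|λ'| = 2π |sin 2πx| /
|Δ'|`, so a lower bound on `λ'` is an upper bound on `Δ'`. -/
lemma derivative_discr_bounds {R c : ℝ} (hL : IsLastConstant R c) (p : ℕ) [NeZero p]
    (hJ : J.IsPeriodic p) (hR : J.IsRBounded R) {μ : ℝ} (hμ : |(discr J p).eval μ| < 1) :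
    (Polynomial.derivative (discr J p)).eval μ ≠ 0 ∧
      |(Polynomial.derivative (discr J p)).eval μ| ≤ 2 * π * Real.exp (c * p) := by
  set u := (discr J p).eval μ with hu
  rw [abs_lt] at hμ
  set x := Real.arccos u / (2 * π) with hx
  have hx' : 2 * π * x = Real.arccos u := by
    rw [hx]
    field_simp
  have hs : Real.sin (2 * π * x) ≠ 0 := by
    rw [hx', Real.sin_arccos]
    apply ne_of_gt
    apply Real.sqrt_pos.mpr
    nlinarith
  have hcos : (discr J p).eval μ = Real.cos (2 * π * x) := by
    rw [hx', Real.cos_arccos hμ.1.le hμ.2.le]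
  obtain ⟨k, hk⟩ := exists_floquetEig_eq p hJ hs hcos
  have hd0 := derivative_discr_ne_zero p hJ hs k
  have h1 := hL p J (NeZero.one_le) hJ hR k x
  rw [(hasDerivAt_floquetEig p hJ hs k).deriv] at h1
  rw [hk] at h1 hd0
  refine ⟨hd0, ?_⟩
  set d := (Polynomial.derivative (discr J p)).eval μ
  have hdpos : 0 < |d| := abs_pos.mpr hd0
  have hspos : 0 < |Real.sin (2 * π * x)| := abs_pos.mpr hs
  rw [abs_mul, abs_inv, abs_neg, abs_mul, abs_of_pos (by positivity : (0 : ℝ) < 2 * π),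
    inv_mul_eq_div, le_div_iff₀ hdpos, Real.exp_neg] at h1
  have hE := Real.exp_pos (c * p)
  rw [inv_mul_eq_div, div_mul_eq_mul_div, div_le_iff₀ hE] at h1
  refine le_of_mul_le_mul_left ?_ hspos
  linarith

/-- At fixed `x` the eigenvalues solve `T_r(Δ_p(μ)) = cos 2πx`, and two solutions are separated by
an excursion to `|T_r ∘ Δ_p| ≥ 1`. The slope bound involves `e^{cp}` with the small period only, the
larger one entering through `r²`. -/
lemma sin_sq_le_mul_gap {R c : ℝ} (hL : IsLastConstant R c) {p q r : ℕ} [NeZero p] [NeZero q]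
    (hq : q = p * r) (hJ : J.IsPeriodic p) (hJq : J.IsPeriodic q) (hR : J.IsRBounded R) {x : ℝ}
    (hx : Real.sin (2 * π * x) ≠ 0) {k l : Fin q} (hkl : k ≠ l) :
    Real.sin (2 * π * x) ^ 2 ≤ (r : ℝ) ^ 2 * (2 * π * Real.exp (c * p)) *
      |floquetEig q J k x - floquetEig q J l x| := by
  wlog hlt : l < k generalizing k l
  · rw [abs_sub_comm]
    exact this hkl.symm (lt_of_le_of_ne (not_lt.mp hlt) hkl)
  have hr : r ≠ 0 := fun h => NeZero.ne q (by rw [hq, h, mul_zero])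
  have hlt' : floquetEig q J l x < floquetEig q J k x := floquetEig_strictMono q hJq hx hlt
  rw [abs_of_pos (sub_pos.mpr hlt')]
  have hv : ∀ k : Fin q, (Polynomial.Chebyshev.T ℝ r).eval ((discr J p).eval (floquetEig q J k x)) =
      Real.cos (2 * π * x) := by
    intro k
    rw [← discr_mul_eval hJ, ← hq, discr_eval_floquetEig q hJq]
  have hcs := Real.sin_sq_add_cos_sq (2 * π * x)
  have hs2 : 0 < Real.sin (2 * π * x) ^ 2 := by positivity
  have hcos : |Real.cos (2 * π * x)| < 1 := by
    rw [← sq_lt_one_iff_abs_lt_one]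
    linarith
  have key := two_mul_one_sub_abs_le
    (f := fun μ => (Polynomial.Chebyshev.T ℝ r).eval ((discr J p).eval μ))
    (f' := fun μ => (Polynomial.derivative (Polynomial.Chebyshev.T ℝ r)).eval
      ((discr J p).eval μ) * (Polynomial.derivative (discr J p)).eval μ)
    (fun μ => ((Polynomial.Chebyshev.T ℝ r).hasDerivAt _).comp μ ((discr J p).hasDerivAt μ))
    (K := (r : ℝ) ^ 2 * (2 * π * Real.exp (c * p)))
    (fun μ hμ => by
      obtain ⟨h1, h2, h3⟩ := derivative_chebyshev_T_bounds hr hμ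
      obtain ⟨h4, h5⟩ := derivative_discr_bounds hL p hJ hR h1
      refine ⟨mul_ne_zero h2 h4, ?_⟩
      rw [abs_mul]
      gcongr) hlt' (hv l) (hv k) hcos
  -- `sin² = (1 - |cos|)(1 + |cos|) ≤ 2(1 - |cos|)`.
  refine le_trans ?_ key
  have h0 := abs_nonneg (Real.cos (2 * π * x))
  rw [← sq_abs (Real.cos (2 * π * x))] at hcs
  nlinarith

end Gaps

/-- Large gaps persist under small perturbations. -/
lemma le_gap_of_perturbation {ι E : Type*} [Fintype ι] [NormedAddCommGroup E]
    [InnerProductSpace ℂ E] {A B : E →L[ℂ] E} {b b' : OrthonormalBasis ι ℂ E} {α β : ι → ℝ}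
    (hA : ∀ k, A (b k) = (α k : ℂ) • b k) (hB : ∀ k, B (b' k) = (β k : ℂ) • b' k)
    (hBsymm : ∀ v w, inner ℂ (B v) w = inner ℂ v (B w)) {δ ε : ℝ} (hε : 0 ≤ ε)
    (hAB : ‖A - B‖ ≤ δ) (hgap : ∀ j j', j ≠ j' → 2 * (ε + δ) < |β j - β j'|) {k l : ι}
    (hkl : k ≠ l) : ε ≤ |α k - α l| := by
  by_contra hlt
  rw [not_le] at hlt
  have hδ : 0 ≤ δ := (norm_nonneg _).trans hAB
  -- Two eigenvalues of `B` are more than `2(ε + δ)` apart, so at most one lies within `ε + δ` of `α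
  -- k`.
  obtain ⟨j₀, hj₀⟩ : ∃ j₀, ∀ j, j ≠ j₀ → ε + δ < |β j - α k| := by
    by_cases h : ∃ j₀, |β j₀ - α k| ≤ ε + δ
    · obtain ⟨j₀, h0⟩ := h
      refine ⟨j₀, fun j hj => ?_⟩
      have h1 := hgap j j₀ hj
      have h2 := abs_sub_le (β j) (α k) (β j₀)
      rw [abs_sub_comm (α k)] at h2
      linarith
    · push Not at h
      exact ⟨k, fun j _ => h j⟩
  -- The plane spanned by `b k` and `b l` contains a nonzero `v` orthogonal to the one exceptional
  -- eigenvector. On `v` the operator `B - α k` is at most `ε + δ` by closeness to `A`, and strictly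
  -- larger by the spectrum of `B`.
  obtain ⟨s, t, hst, horth⟩ : ∃ s t : ℂ, (s ≠ 0 ∨ t ≠ 0) ∧
      inner ℂ (b' j₀) (s • b k + t • b l) = 0 := by
    by_cases h0 : inner ℂ (b' j₀) (b l) = 0
    · refine ⟨0, 1, Or.inr one_ne_zero, ?_⟩
      rw [zero_smul, one_smul, zero_add, h0]
    · refine ⟨inner ℂ (b' j₀) (b l), -inner ℂ (b' j₀) (b k), Or.inl h0, ?_⟩
      rw [inner_add_right, inner_smul_right, inner_smul_right]
      ring
  set v := s • b k + t • b l with hv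
  have hvn : ‖v‖ ^ 2 = ‖s‖ ^ 2 + ‖t‖ ^ 2 := by
    have := norm_add_sq_eq_norm_sq_add_norm_sq_of_inner_eq_zero (𝕜 := ℂ) (s • b k) (t • b l) (by
      rw [inner_smul_left, inner_smul_right, b.orthonormal.inner_eq_zero hkl, mul_zero, mul_zero])
    rw [← pow_two, ← pow_two, ← pow_two, norm_smul, norm_smul, b.orthonormal.norm_eq_one,
      b.orthonormal.norm_eq_one, mul_one, mul_one] at this
    exact this
  have hvpos : 0 < ‖v‖ ^ 2 := by
    rw [hvn]
    rcases hst with h | h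
    · have := norm_pos_iff.mpr h
      positivity
    · have := norm_pos_iff.mpr h
      positivity
  have hup : ‖B v - (α k : ℂ) • v‖ ≤ (ε + δ) * ‖v‖ := by
    have e : B v - (α k : ℂ) • v = (t * ((α l : ℂ) - α k)) • b l - (A - B) v := by
      rw [sub_apply, hv, map_add, map_add, map_smul, map_smul, map_smul,
        map_smul, hA, hA]
      module
    rw [e]
    refine (norm_sub_le _ _).trans ?_
    rw [add_mul]
    refine add_le_add ?_ (((A - B).le_opNorm v).trans (by gcongr))
    rw [norm_smul, b.orthonormal.norm_eq_one, mul_one, norm_mul, ← Complex.ofReal_sub,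
      Complex.norm_real, Real.norm_eq_abs, abs_sub_comm, mul_comm]
    have ht : ‖t‖ ≤ ‖v‖ := by
      refine le_of_sq_le_sq ?_ (norm_nonneg _)
      rw [hvn]
      nlinarith [norm_nonneg s]
    gcongr
  have hlow : ((ε + δ) * ‖v‖) ^ 2 < ‖B v - (α k : ℂ) • v‖ ^ 2 := by
    rw [← b'.sum_sq_norm_inner_right, mul_pow, ← b'.sum_sq_norm_inner_right v, Finset.mul_sum]
    have hcoef : ∀ j, inner ℂ (b' j) (B v - (α k : ℂ) • v) =
        ((β j - α k : ℝ) : ℂ) * inner ℂ (b' j) v := by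
      intro j
      rw [inner_sub_right, ← hBsymm, hB, inner_smul_left, inner_smul_right, Complex.conj_ofReal]
      push_cast
      ring
    simp_rw [hcoef, norm_mul, Complex.norm_real, Real.norm_eq_abs, mul_pow, sq_abs]
    have hcmp : ∀ j, j ≠ j₀ → (ε + δ) ^ 2 < (β j - α k) ^ 2 := by
      intro j hj
      rw [← sq_abs (β j - α k)]
      have := hj₀ j hj
      gcongr
    refine Finset.sum_lt_sum (fun j _ => ?_) ?_
    · by_cases hj : j = j₀
      · rw [hj, horth]
        simp
      · have := hcmp j hj
        gcongr
    · obtain ⟨j, hj⟩ : ∃ j, inner ℂ (b' j) v ≠ 0 := by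
        by_contra hall
        push Not at hall
        apply hvpos.ne'
        rw [← b'.sum_sq_norm_inner_right]
        simp [hall]
      refine ⟨j, Finset.mem_univ _, ?_⟩
      have hjj : j ≠ j₀ := fun h => hj (h ▸ horth)
      have := hcmp j hjj
      have hpos := norm_pos_iff.mpr hj
      gcongr
  have := pow_le_pow_left₀ (norm_nonneg _) hup 2
  linarith

/-! ### Heisenberg averages in a Banach algebra -/

section Heisenberg

variable {𝔸 𝔹 : Type*} [NormedRing 𝔸] [NormedAlgebra ℂ 𝔸] [NormedRing 𝔹] [NormedAlgebra ℂ 𝔹]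

/-- The one-parameter group `e^{isA}`. -/
def expI (A : 𝔸) (s : ℝ) : 𝔸 := NormedSpace.exp ((Complex.I * (s : ℂ)) • A)

lemma expI_zero (A : 𝔸) : expI A 0 = 1 := by simp [expI]

lemma hasDerivAt_expI [CompleteSpace 𝔸] (A : 𝔸) (s : ℝ) :
    HasDerivAt (expI A) (Complex.I • (A * expI A s)) s := by
  have h := hasDerivAt_exp_smul_const' (𝕂 := ℝ) (Complex.I • A) s
  have e : ∀ u : ℝ, u • (Complex.I • A) = (Complex.I * (u : ℂ)) • A := by
    intro u
    rw [← Complex.coe_smul u, smul_smul, mul_comm]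
  simp only [e] at h
  rwa [smul_mul_assoc] at h

lemma commute_expI (A : 𝔸) (s : ℝ) : Commute A (expI A s) := by
  let := NormedAlgebra.restrictScalars ℚ ℂ 𝔸
  exact ((Commute.refl A).smul_right _).exp_right

lemma continuous_expI [CompleteSpace 𝔸] (A : 𝔸) : Continuous (expI A) :=
  continuous_iff_continuousAt.mpr fun s => (hasDerivAt_expI A s).continuousAt

lemma map_expI [CompleteSpace 𝔸] (φ : 𝔸 →A[ℂ] 𝔹) (A : 𝔸) (s : ℝ) : φ (expI A s) = expI (φ A) s := by
  let := NormedAlgebra.restrictScalars ℚ ℂ 𝔸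
  let := NormedAlgebra.restrictScalars ℚ ℂ 𝔹
  rw [expI, NormedSpace.map_exp φ φ.continuous, map_smul, expI]

/-- The Heisenberg evolution `e^{isA} P e^{-isA}`. -/
def heis (A P : 𝔸) (s : ℝ) : 𝔸 := expI A s * P * expI A (-s)

lemma continuous_heis [CompleteSpace 𝔸] (A P : 𝔸) : Continuous (heis A P) :=
  ((continuous_expI A).mul continuous_const).mul ((continuous_expI A).comp continuous_neg)

/-- The time average of the Heisenberg evolution. -/
def heisAvg (A P : 𝔸) (t : ℝ) : 𝔸 := ((1 / t : ℝ) : ℂ) • ∫ s in (0 : ℝ)..t, heis A P s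

lemma map_heis [CompleteSpace 𝔸] (φ : 𝔸 →A[ℂ] 𝔹) (A P : 𝔸) (s : ℝ) :
    φ (heis A P s) = heis (φ A) (φ P) s := by
  rw [heis, map_mul, map_mul, map_expI, map_expI, heis]

/-- Used for evaluation at a point of the circle and for the representation on `ℓ²(ℤ)`: a single
average in the algebra of continuous families produces both the fibre averages and the average on
`ℓ²(ℤ)`. -/
lemma map_heisAvg [CompleteSpace 𝔸] [CompleteSpace 𝔹] (φ : 𝔸 →A[ℂ] 𝔹) (A P : 𝔸) (t : ℝ) :
    φ (heisAvg A P t) = heisAvg (φ A) (φ P) t := by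
  rw [heisAvg, map_smul, heisAvg]
  congr 1
  let L : 𝔸 →L[ℂ] 𝔹 := ⟨φ.toAlgHom.toLinearMap, φ.continuous⟩
  have h := L.intervalIntegral_comp_comm
    ((continuous_heis A P).intervalIntegrable (μ := volume) 0 t)
  simp_rw [← map_heis φ]
  exact h.symm

lemma norm_heisAvg_le {A P : 𝔸} {C : ℝ} (hC : ∀ s, ‖heis A P s‖ ≤ C) {t : ℝ} (ht : 0 < t) :
    ‖heisAvg A P t‖ ≤ C := by
  have h := intervalIntegral.norm_integral_le_of_norm_le_const (a := 0) (b := t)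
    fun s _ => hC s
  rw [heisAvg, norm_smul, Complex.norm_real, Real.norm_eq_abs, abs_of_pos (by positivity)]
  rw [sub_zero, abs_of_pos ht] at h
  rw [one_div, inv_mul_le_iff₀ ht]
  linarith

end Heisenberg

/-! ### Averages in terms of an eigenbasis -/

section Eigenbasis

variable {ι E : Type*} [Fintype ι] [NormedAddCommGroup E] [InnerProductSpace ℂ E]
  [CompleteSpace E] {A P : E →L[ℂ] E} {b : OrthonormalBasis ι ℂ E} {α : ι → ℝ}

/-- The curve `u ↦ e^{-iμu} e^{iuA} v` has zero derivative and starts at `v`. -/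
lemma expI_apply_eigenvector {v : E} {μ : ℝ} (hv : A v = (μ : ℂ) • v) (s : ℝ) :
    expI A s v = Complex.exp (Complex.I * μ * s) • v := by
  have hd : ∀ u : ℝ, HasDerivAt (fun u : ℝ => Complex.exp (-(Complex.I * μ * u)) • expI A u v)
      0 u := by
    intro u
    have h1 : HasDerivAt (fun u : ℝ => expI A u v) ((Complex.I • (A * expI A u)) v) u :=
      ((ContinuousLinearMap.apply ℂ E v).restrictScalars ℝ).hasFDerivAt.comp_hasDerivAt u
        (hasDerivAt_expI A u)
    have h2 : HasDerivAt (fun u : ℝ => Complex.exp (-(Complex.I * μ * u)))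
        (Complex.exp (-(Complex.I * μ * u)) * (-(Complex.I * μ))) u := by
      have h3 : HasDerivAt (fun u : ℝ => -(Complex.I * μ * (u : ℂ))) (-(Complex.I * μ)) u := by
        simpa using ((Complex.ofRealCLM.hasDerivAt (x := u)).const_mul (Complex.I * μ)).fun_neg
      exact h3.cexp
    have h4 := h2.fun_smul h1
    rw [(commute_expI A u).eq] at h4
    convert h4 using 1
    rw [FunLike.coe_smul, Pi.smul_apply, mul_apply_eq_comp, hv, map_smul]
    module
  have hconst := is_const_of_deriv_eq_zero (fun u => (hd u).differentiableAt)
    (fun u => (hd u).deriv) s 0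
  simp only [Complex.ofReal_zero, mul_zero, neg_zero, Complex.exp_zero, one_smul, expI_zero,
    one_apply_eq_self] at hconst
  conv_rhs => rw [← hconst]
  rw [smul_smul, ← Complex.exp_add, add_neg_cancel, Complex.exp_zero, one_smul]

lemma inner_expI_apply (hA : ∀ k, A (b k) = (α k : ℂ) • b k) (k : ι) (s : ℝ) (v : E) :
    inner ℂ (b k) (expI A s v) = Complex.exp (Complex.I * α k * s) * inner ℂ (b k) v := by
  classical
  conv_lhs => rw [← b.sum_repr' v]
  rw [map_sum, inner_sum, Finset.sum_eq_single k]
  · rw [map_smul, expI_apply_eigenvector (hA k), inner_smul_right, inner_smul_right,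
      inner_self_eq_norm_sq_to_K, b.orthonormal.norm_eq_one]
    simp [mul_comm]
  · intro l _ hl
    rw [map_smul, expI_apply_eigenvector (hA l), inner_smul_right, inner_smul_right,
      b.orthonormal.inner_eq_zero hl.symm, mul_zero, mul_zero]
  · simp

lemma norm_expI_apply (hA : ∀ k, A (b k) = (α k : ℂ) • b k) (s : ℝ) (v : E) :
    ‖expI A s v‖ = ‖v‖ := by
  rw [← sq_eq_sq₀ (norm_nonneg _) (norm_nonneg _), ← b.sum_sq_norm_inner_right,
    ← b.sum_sq_norm_inner_right v]
  refine Finset.sum_congr rfl fun k _ => ?_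
  rw [inner_expI_apply hA, norm_mul, show Complex.I * α k * s = ((α k * s : ℝ) : ℂ) * Complex.I by
    push_cast; ring, Complex.norm_exp_ofReal_mul_I, one_mul]

lemma norm_heis_le (hA : ∀ k, A (b k) = (α k : ℂ) • b k) (s : ℝ) : ‖heis A P s‖ ≤ ‖P‖ := by
  refine ContinuousLinearMap.opNorm_le_bound _ (norm_nonneg _) fun v => ?_
  rw [heis, mul_apply_eq_comp, mul_apply_eq_comp, norm_expI_apply hA]
  refine (P.le_opNorm _).trans ?_
  rw [norm_expI_apply hA]

lemma inner_heis (hA : ∀ k, A (b k) = (α k : ℂ) • b k) (k l : ι) (s : ℝ) :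
    inner ℂ (b k) (heis A P s (b l)) =
      Complex.exp (Complex.I * (α k - α l) * s) * inner ℂ (b k) (P (b l)) := by
  rw [heis, mul_apply_eq_comp, mul_apply_eq_comp, inner_expI_apply hA,
    expI_apply_eigenvector (hA l), map_smul, inner_smul_right, ← mul_assoc, ← Complex.exp_add]
  congr 2
  push_cast
  ring

lemma inner_heisAvg (hA : ∀ k, A (b k) = (α k : ℂ) • b k) (k l : ι) (t : ℝ) :
    inner ℂ (b k) (heisAvg A P t (b l)) =
      ((1 / t : ℝ) : ℂ) * ((∫ s in (0 : ℝ)..t, Complex.exp (Complex.I * (α k - α l) * s)) *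
        inner ℂ (b k) (P (b l))) := by
  let L : (E →L[ℂ] E) →L[ℂ] ℂ := (innerSL ℂ (b k)) ∘L (ContinuousLinearMap.apply ℂ E (b l))
  have h := L.intervalIntegral_comp_comm
    ((continuous_heis A P).intervalIntegrable (μ := volume) 0 t)
  have hL : ∀ T : E →L[ℂ] E, inner ℂ (b k) (T (b l)) = L T := fun T => rfl
  rw [hL, heisAvg, map_smul, smul_eq_mul, ← h, ← intervalIntegral.integral_mul_const]
  congr 1
  refine intervalIntegral.integral_congr fun s _ => ?_
  exact inner_heis hA k l s

lemma norm_integral_exp_le {ω : ℝ} (hω : ω ≠ 0) (t : ℝ) :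
    ‖∫ s in (0 : ℝ)..t, Complex.exp (Complex.I * ω * s)‖ ≤ 2 / |ω| := by
  have hω' : Complex.I * (ω : ℂ) ≠ 0 :=
    mul_ne_zero Complex.I_ne_zero (Complex.ofReal_ne_zero.mpr hω)
  rw [integral_exp_mul_complex hω', norm_div, norm_mul, Complex.norm_I, one_mul, Complex.norm_real,
    Real.norm_eq_abs]
  gcongr
  refine (norm_sub_le _ _).trans ?_
  rw [show Complex.I * ω * t = ((ω * t : ℝ) : ℂ) * Complex.I by push_cast; ring,
    Complex.norm_exp_ofReal_mul_I]
  norm_num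

/-- The average converges to the diagonal part at rate `1/t`, depending on the smallest gap. -/
lemma norm_sub_heisAvg_sq_le (hA : ∀ k, A (b k) = (α k : ℂ) • b k) {Q : E →L[ℂ] E}
    (hQ : ∀ k, Q (b k) = (inner ℂ (b k) (P (b k)) : ℂ) • b k) {ε t : ℝ} (hε : 0 < ε) (ht : 0 < t)
    (hgap : ∀ k l, k ≠ l → ε ≤ |α k - α l|) (v : E) :
    ‖(Q - heisAvg A P t) v‖ ^ 2 ≤ (2 / (t * ε)) ^ 2 * (Fintype.card ι * ‖P‖ ^ 2) * ‖v‖ ^ 2 := by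
  have hent : ∀ k l, ‖(inner ℂ (b k) ((Q - heisAvg A P t) (b l)) : ℂ)‖ ≤
      2 / (t * ε) * ‖(inner ℂ (b k) (P (b l)) : ℂ)‖ := by
    intro k l
    rw [sub_apply, inner_sub_right, hQ, inner_smul_right, inner_heisAvg hA]
    by_cases hkl : k = l
    · subst hkl
      have : ∫ s in (0 : ℝ)..t, Complex.exp (Complex.I * (α k - α k) * s) = t := by
        simp
      rw [this, inner_self_eq_norm_sq_to_K, b.orthonormal.norm_eq_one]
      have ht' : (t : ℂ) ≠ 0 := Complex.ofReal_ne_zero.mpr ht.ne'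
      push_cast
      rw [← mul_assoc, one_div_mul_cancel ht']
      simp only [one_pow, mul_one, one_mul, sub_self, norm_zero]
      positivity
    · have hg := hgap k l hkl
      have hω : α k - α l ≠ 0 := by
        intro h
        rw [h, abs_zero] at hg
        linarith
      have hI := norm_integral_exp_le hω t
      rw [b.orthonormal.inner_eq_zero hkl, mul_zero, zero_sub, norm_neg, norm_mul, norm_mul,
        Complex.norm_real, Real.norm_eq_abs, abs_of_pos (by positivity), ← mul_assoc]
      push_cast at hI
      gcongr
      calc 1 / t * ‖∫ s in (0 : ℝ)..t, Complex.exp (Complex.I * (α k - α l) * s)‖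
          ≤ 1 / t * (2 / |α k - α l|) := by gcongr
        _ ≤ 1 / t * (2 / ε) := by gcongr
        _ = 2 / (t * ε) := by field_simp
  have hexp : ∀ k, (inner ℂ (b k) ((Q - heisAvg A P t) v) : ℂ) =
      ∑ l, inner ℂ (b l) v * inner ℂ (b k) ((Q - heisAvg A P t) (b l)) := by
    intro k
    conv_lhs => rw [← b.sum_repr' v]
    rw [map_sum, inner_sum]
    refine Finset.sum_congr rfl fun l _ => ?_
    rw [map_smul, inner_smul_right]
  -- Cauchy–Schwarz in each row; summing the rows leaves the squared Hilbert–Schmidt norm of `P`,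
  -- which is at most the dimension times `‖P‖²`.
  have hrow : ∀ k, ‖(inner ℂ (b k) ((Q - heisAvg A P t) v) : ℂ)‖ ^ 2 ≤
      ‖v‖ ^ 2 * ∑ l, (2 / (t * ε)) ^ 2 * ‖(inner ℂ (b k) (P (b l)) : ℂ)‖ ^ 2 := by
    intro k
    rw [hexp k]
    calc ‖∑ l, (inner ℂ (b l) v : ℂ) * inner ℂ (b k) ((Q - heisAvg A P t) (b l))‖ ^ 2
        ≤ (∑ l, ‖(inner ℂ (b l) v : ℂ)‖ *
            ‖(inner ℂ (b k) ((Q - heisAvg A P t) (b l)) : ℂ)‖) ^ 2 := by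
          gcongr
          refine (norm_sum_le _ _).trans (le_of_eq ?_)
          simp_rw [norm_mul]
      _ ≤ (∑ l, ‖(inner ℂ (b l) v : ℂ)‖ ^ 2) *
            ∑ l, ‖(inner ℂ (b k) ((Q - heisAvg A P t) (b l)) : ℂ)‖ ^ 2 :=
          Finset.sum_mul_sq_le_sq_mul_sq _ _ _
      _ ≤ ‖v‖ ^ 2 * ∑ l, (2 / (t * ε)) ^ 2 * ‖(inner ℂ (b k) (P (b l)) : ℂ)‖ ^ 2 := by
          rw [b.sum_sq_norm_inner_right]
          refine mul_le_mul_of_nonneg_left (Finset.sum_le_sum fun l _ => ?_) (sq_nonneg _)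
          rw [← mul_pow]
          exact pow_le_pow_left₀ (norm_nonneg _) (hent k l) 2
  rw [← b.sum_sq_norm_inner_right]
  refine (Finset.sum_le_sum fun k _ => hrow k).trans ?_
  rw [← Finset.mul_sum, Finset.sum_comm]
  simp_rw [← Finset.mul_sum, b.sum_sq_norm_inner_right]
  have hP : ∑ l, ‖P (b l)‖ ^ 2 ≤ Fintype.card ι * ‖P‖ ^ 2 := by
    have : ∀ l ∈ Finset.univ, ‖P (b l)‖ ^ 2 ≤ ‖P‖ ^ 2 := by
      intro l _
      gcongr
      simpa [b.orthonormal.norm_eq_one] using P.le_opNorm (b l)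
    refine (Finset.sum_le_card_nsmul _ _ _ this).trans (le_of_eq ?_)
    rw [nsmul_eq_mul, Finset.card_univ]
  calc ‖v‖ ^ 2 * ((2 / (t * ε)) ^ 2 * ∑ l, ‖P (b l)‖ ^ 2)
      ≤ ‖v‖ ^ 2 * ((2 / (t * ε)) ^ 2 * (Fintype.card ι * ‖P‖ ^ 2)) := by gcongr
    _ = _ := by ring

end Eigenbasis

/-! ### Hellmann–Feynman and the fibres of `Q` -/

section HellmannFeynman

/-- With `β` running over all eigenvalues but the `k`-th, this product annihilates every other
eigencomponent and so isolates the `k`-th eigenvector. -/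
lemma inner_list_prod_sub_apply {ι κ E : Type*} [Fintype ι] [NormedAddCommGroup E]
    [InnerProductSpace ℂ E] {A : E →L[ℂ] E} {b : OrthonormalBasis ι ℂ E} {α : ι → ℝ}
    (hA : ∀ k, A (b k) = (α k : ℂ) • b k) (hsymm : ∀ v w, inner ℂ (A v) w = inner ℂ v (A w))
    (β : κ → ℝ) (L : List κ) (j : ι) (v : E) :
    inner ℂ (b j) ((L.map fun i => A - (β i : ℂ) • (1 : E →L[ℂ] E)).prod v) =
      (L.map fun i => ((α j - β i : ℝ) : ℂ)).prod * inner ℂ (b j) v := by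
  induction L with
  | nil => simp
  | cons i L ih =>
    rw [List.map_cons, List.prod_cons, List.map_cons, List.prod_cons, mul_apply_eq_comp,
      sub_apply, inner_sub_right, ← hsymm, hA, inner_smul_left, FunLike.coe_smul, Pi.smul_apply,
      inner_smul_right, one_apply_eq_self, ih, Complex.conj_ofReal]
    push_cast
    ring

variable (q : ℕ) [NeZero q] {J : JacobiMatrix}

/-- The Hellmann–Feynman formula for the derivative of a band function. -/
lemma inner_currentFibre_eigenvector (hJ : J.IsPeriodic q) {x : ℝ}
    (hx : Real.sin (2 * π * x) ≠ 0) {b : OrthonormalBasis (Fin q) ℂ (Fibre q)}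
    (hb : ∀ k, jacobiFibre q J (x : UnitAddCircle) (b k) = (floquetEig q J k x : ℂ) • b k)
    (k : Fin q) : inner ℂ (b k) (currentFibre q J (x : UnitAddCircle) (b k)) =
      (q : ℂ) / (2 * π) * ((deriv (floquetEig q J k) x : ℝ) : ℂ) := by
  classical
  obtain ⟨D, hD, hP⟩ := exists_hasDerivAt_jacobiFibre q hJ x
  have hsymm := jacobiFibre_inner q hJ
  have hlam : ∀ j, HasDerivAt (floquetEig q J j) (deriv (floquetEig q J j) x) x := fun j =>
    (hasDerivAt_floquetEig q hJ hx j).differentiableAt.hasDerivAt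
  set v := b k with hv
  set L := (Finset.univ.erase k).toList with hL
  -- An eigenvector of the fibre at `y` for the `k`-th band that is visibly continuous at `x`, and
  -- at `x` a nonzero multiple of `v` because the eigenvalues are distinct there. Continuity
  -- suffices: eigenvectors are never differentiated.
  set w : ℝ → Fibre q := fun y => (L.map fun i => jacobiFibre q J (y : UnitAddCircle) -
    (floquetEig q J i y : ℂ) • (1 : Fibre q →L[ℂ] Fibre q)).prod v with hw
  have hwcont : ContinuousAt w x := by
    have h1 : ContinuousAt (fun y : ℝ => (L.map fun i => jacobiFibre q J (y : UnitAddCircle) -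
        (floquetEig q J i y : ℂ) • (1 : Fibre q →L[ℂ] Fibre q)).prod) x := by
      refine tendsto_list_prod L fun i _ => ?_
      exact hD.continuousAt.sub
        ((Complex.continuous_ofReal.continuousAt.comp (hlam i).continuousAt).smul
          continuousAt_const)
    exact h1.clm_apply continuousAt_const
  have hweig : ∀ y : ℝ, jacobiFibre q J (y : UnitAddCircle) (w y) =
      (floquetEig q J k y : ℂ) • w y := by
    intro y
    obtain ⟨c, hc⟩ := exists_eigenbasis q hJ y
    have hcoef : ∀ j, j ≠ k → inner ℂ (c j) (w y) = 0 := by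
      intro j hj
      rw [hw]
      simp only
      rw [inner_list_prod_sub_apply hc (hsymm y), mul_eq_zero]
      left
      rw [List.prod_eq_zero_iff, List.mem_map]
      exact ⟨j, by simp [hL, hj], by simp⟩
    have hwy : w y = (inner ℂ (c k) (w y) : ℂ) • c k := by
      conv_lhs => rw [← c.sum_repr' (w y)]
      rw [Finset.sum_eq_single k]
      · intro j _ hj
        rw [hcoef j hj, zero_smul]
      · simp
    rw [hwy, map_smul, hc, smul_comm]
  obtain ⟨κ, hκ, hwx⟩ : ∃ κ : ℂ, κ ≠ 0 ∧ inner ℂ (w x) (b k) = κ ∧ w x = (starRingEnd ℂ κ) • v := by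
    have hcoef : ∀ j, inner ℂ (b j) (w x) =
        (L.map fun i => ((floquetEig q J j x - floquetEig q J i x : ℝ) : ℂ)).prod *
          inner ℂ (b j) v := fun j => inner_list_prod_sub_apply hb (hsymm x) _ L j v
    have hwx : w x = (inner ℂ (b k) (w x) : ℂ) • v := by
      conv_lhs => rw [← b.sum_repr' (w x)]
      rw [Finset.sum_eq_single k]
      · intro j _ hj
        rw [hcoef j, hv, b.orthonormal.inner_eq_zero hj, mul_zero, zero_smul]
      · simp
    refine ⟨inner ℂ (w x) (b k), ?_, rfl, ?_⟩
    · rw [← inner_conj_symm, Ne, map_eq_zero, hcoef k, hv, inner_self_eq_norm_sq_to_K,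
        b.orthonormal.norm_eq_one]
      simp only [RCLike.ofReal_one, one_pow, mul_one]
      rw [List.prod_eq_zero_iff, List.mem_map]
      rintro ⟨i, hi, h0⟩
      have hik : i ≠ k := by simpa [hL] using hi
      rw [Complex.ofReal_eq_zero, sub_eq_zero] at h0
      exact hik ((floquetEig_strictMono q hJ hx).injective h0).symm
    · rw [inner_conj_symm]
      exact hwx
  -- Symmetry moves the fibre at `y` onto its own eigenvector `w y`. Dividing by `y - x` and letting
  -- `y → x` gives the derivative formula.
  have hid : ∀ y : ℝ, inner ℂ (w y) ((jacobiFibre q J (y : UnitAddCircle) -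
      jacobiFibre q J (x : UnitAddCircle)) v) =
      ((floquetEig q J k y - floquetEig q J k x : ℝ) : ℂ) * inner ℂ (w y) v := by
    intro y
    rw [sub_apply, inner_sub_right, ← hsymm, hweig, hb, inner_smul_left, inner_smul_right,
      Complex.conj_ofReal]
    push_cast
    ring
  have hlim1 : Tendsto (fun y => inner ℂ (w y)
      ((slope (fun y : ℝ => jacobiFibre q J (y : UnitAddCircle)) x y) v)) (𝓝[≠] x)
      (𝓝 (inner ℂ (w x) (D v))) := by
    have h1 := hasDerivAt_iff_tendsto_slope.mp hD
    have h2 : Tendsto (fun y =>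
        (slope (fun y : ℝ => jacobiFibre q J (y : UnitAddCircle)) x y) v) (𝓝[≠] x) (𝓝 (D v)) :=
      ((ContinuousLinearMap.apply ℂ (Fibre q) v).continuous.tendsto D).comp h1
    exact (hwcont.tendsto.mono_left nhdsWithin_le_nhds).inner h2
  have hlim2 : Tendsto (fun y => ((slope (floquetEig q J k) x y : ℝ) : ℂ) * inner ℂ (w y) v)
      (𝓝[≠] x) (𝓝 (((deriv (floquetEig q J k) x : ℝ) : ℂ) * inner ℂ (w x) v)) := by
    have h1 := hasDerivAt_iff_tendsto_slope.mp (hlam k)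
    have h2 := (Complex.continuous_ofReal.tendsto _).comp h1
    exact h2.mul ((hwcont.tendsto.mono_left nhdsWithin_le_nhds).inner tendsto_const_nhds)
  have heq : ∀ y, inner ℂ (w y)
      ((slope (fun y : ℝ => jacobiFibre q J (y : UnitAddCircle)) x y) v) =
      ((slope (floquetEig q J k) x y : ℝ) : ℂ) * inner ℂ (w y) v := by
    intro y
    rw [slope_def_module, slope_def_module, FunLike.coe_smul, Pi.smul_apply,
      ← Complex.coe_smul, inner_smul_right, hid]
    rw [smul_eq_mul]
    push_cast
    ring
  simp only [heq] at hlim1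
  have hfin := tendsto_nhds_unique hlim1 hlim2
  rw [hwx.2, inner_smul_left, inner_smul_left, Complex.conj_conj, hv, inner_self_eq_norm_sq_to_K,
    b.orthonormal.norm_eq_one] at hfin
  have hDv : inner ℂ (b k) (D (b k)) = ((deriv (floquetEig q J k) x : ℝ) : ℂ) := by
    apply mul_left_cancel₀ hκ
    rw [hfin]
    simp
    ring
  -- A commutator with the fibre has zero diagonal entries in its eigenbasis, so only `D`
  -- contributes.
  rw [hP, add_apply, FunLike.coe_smul, Pi.smul_apply, FunLike.coe_smul, Pi.smul_apply,
    FunLike.coe_sub, Pi.sub_apply, ContinuousLinearMap.comp_apply, ContinuousLinearMap.comp_apply,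
    inner_add_right, inner_smul_right, inner_smul_right, inner_sub_right, hDv, ← hsymm, hb,
    map_smul, inner_smul_left, inner_smul_right, Complex.conj_ofReal, sub_self, mul_zero, add_zero]

/-- The eigenvalues being simple, each `P_k` is the rank-one projection onto `b k`. With
Hellmann–Feynman this makes the fibre of `Q` the diagonal part of the current. -/
lemma fibreQ_eigenvector (hJ : J.IsPeriodic q) {x : ℝ}
    (hx : Real.sin (2 * π * x) ≠ 0) {b : OrthonormalBasis (Fin q) ℂ (Fibre q)}
    (hb : ∀ k, jacobiFibre q J (x : UnitAddCircle) (b k) = (floquetEig q J k x : ℂ) • b k)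
    (l : Fin q) : fibreQ q J x (b l) =
      (inner ℂ (b l) (currentFibre q J (x : UnitAddCircle) (b l)) : ℂ) • b l := by
  have hlin : Matrix.toEuclideanLin (floquetMatrix q J x) =
      (jacobiFibre q J (x : UnitAddCircle)).toLinearMap := toEuclideanLin_floquetMatrix q hJ x
  have hsymm := Matrix.isSymmetric_toEuclideanLin_iff.mpr (floquetMatrix_isHermitian q J x)
  have hmem : ∀ k, b k ∈ Module.End.eigenspace (Matrix.toEuclideanLin (floquetMatrix q J x))
      (floquetEig q J k x : ℂ) := by
    intro k
    rw [Module.End.mem_eigenspace_iff, hlin]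
    exact hb k
  have hproj : ∀ k, floquetProj q J k x (b l) = if k = l then b l else 0 := by
    intro k
    split_ifs with hkl
    · subst hkl
      exact Submodule.starProjection_eq_self_iff.mpr (hmem k)
    · rw [floquetProj, Submodule.starProjection_apply_eq_zero_iff, Submodule.mem_orthogonal]
      intro u hu
      have hne : (floquetEig q J k x : ℂ) ≠ (floquetEig q J l x : ℂ) := by
        intro h
        exact hkl ((floquetEig_strictMono q hJ hx).injective (Complex.ofReal_injective h))
      exact hsymm.orthogonalFamily_eigenspaces hne ⟨u, hu⟩ ⟨b l, hmem l⟩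
  rw [inner_currentFibre_eigenvector q hJ hx hb, fibreQ, FunLike.coe_smul, Pi.smul_apply, sum_apply,
    Finset.sum_eq_single l]
  · rw [FunLike.coe_smul, Pi.smul_apply, hproj, if_pos rfl, smul_smul]
  · intro k _ hk
    rw [FunLike.coe_smul, Pi.smul_apply, hproj, if_neg hk, smul_zero]
  · simp

lemma norm_currentFibre_le {R : ℝ} (hR : J.IsRBounded R) (θ : UnitAddCircle) :
    ‖currentFibre q J θ‖ ≤ 2 * R := by
  have ha : ∀ n, ‖(J.a n : ℂ)‖ ≤ R := fun n => by
    rw [Complex.norm_real, Real.norm_eq_abs, abs_of_pos (J.a_pos' n)]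
    exact (hR n).2.1
  have h := norm_triFibre_le q (α := fun n => -(Complex.I * J.a n)) (β := fun _ => 0)
    (γ := fun n => Complex.I * J.a (n - 1)) (A := R) (B := 0) (C := R)
    (fun n => by simpa using ha n) (fun n => by simp) (fun n => by simpa using ha (n - 1)) θ
  refine h.trans (le_of_eq ?_)
  ring

lemma fibreQ_sub_heisAvg_sq_le {R : ℝ} (hJ : J.IsPeriodic q) (hR : J.IsRBounded R) {x ε t : ℝ}
    (hx : Real.sin (2 * π * x) ≠ 0) (hε : 0 < ε) (ht : 0 < t)
    (hgap : ∀ k l : Fin q, k ≠ l → ε ≤ |floquetEig q J k x - floquetEig q J l x|)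
    (v : Fibre q) :
    ‖(fibreQ q J x - heisAvg (jacobiFibre q J (x : UnitAddCircle))
      (currentFibre q J (x : UnitAddCircle)) t) v‖ ^ 2 ≤
      (2 / (t * ε)) ^ 2 * (q * (2 * R) ^ 2) * ‖v‖ ^ 2 := by
  obtain ⟨b, hb⟩ := exists_eigenbasis q hJ x
  have h := norm_sub_heisAvg_sq_le hb (fibreQ_eigenvector q hJ hx hb) hε ht hgap v
  rw [Fintype.card_fin] at h
  refine h.trans ?_
  have := norm_currentFibre_le q hR (x : UnitAddCircle)
  gcongr

lemma norm_heisAvg_fibre_le {R : ℝ} (hJ : J.IsPeriodic q) (hR : J.IsRBounded R) (x : ℝ) {t : ℝ}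
    (ht : 0 < t) : ‖heisAvg (jacobiFibre q J (x : UnitAddCircle))
      (currentFibre q J (x : UnitAddCircle)) t‖ ≤ 2 * R := by
  obtain ⟨b, hb⟩ := exists_eigenbasis q hJ x
  exact norm_heisAvg_le
    (fun s => (norm_heis_le hb s).trans (norm_currentFibre_le q hR (x : UnitAddCircle))) ht

/-- At a fixed `x` the smallest gap is positive, with no quantitative bound needed. The limit
transfers both measurability in `θ` and the norm bound `2R` from the averages to the fibres of `Q`.
-/
lemma tendsto_heisAvg_fibreQ {R : ℝ} (hJ : J.IsPeriodic q) (hR : J.IsRBounded R) {x : ℝ}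
    (hx : Real.sin (2 * π * x) ≠ 0) :
    Tendsto (fun n : ℕ => heisAvg (jacobiFibre q J (x : UnitAddCircle))
      (currentFibre q J (x : UnitAddCircle)) ((n : ℝ) + 1)) atTop (𝓝 (fibreQ q J x)) := by
  obtain ⟨ε, hε, hgap⟩ : ∃ ε : ℝ, 0 < ε ∧
      ∀ k l : Fin q, k ≠ l → ε ≤ |floquetEig q J k x - floquetEig q J l x| := by
    have hev : ∀ᶠ ε in 𝓝[>] (0 : ℝ), ∀ k l : Fin q, k ≠ l →
        ε ≤ |floquetEig q J k x - floquetEig q J l x| := by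
      rw [Filter.eventually_all]
      intro k
      rw [Filter.eventually_all]
      intro l
      rw [Filter.eventually_imp_distrib_left]
      intro hkl
      have hpos : 0 < |floquetEig q J k x - floquetEig q J l x| :=
        abs_pos.mpr (sub_ne_zero.mpr fun h => hkl ((floquetEig_strictMono q hJ hx).injective h))
      filter_upwards [Ioo_mem_nhdsGT hpos] with ε hε
      exact hε.2.le
    obtain ⟨ε, h1, h2⟩ := (hev.and self_mem_nhdsWithin).exists
    exact ⟨ε, h2, h1⟩
  rw [tendsto_iff_norm_sub_tendsto_zero]
  set C := 2 / ε * √(q * (2 * R) ^ 2) with hC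
  refine squeeze_zero (g := fun n : ℕ => C * (1 / ((n : ℝ) + 1))) (fun _ => norm_nonneg _)
    (fun n => ?_) ?_
  · have hn : (0 : ℝ) < n + 1 := by positivity
    rw [norm_sub_rev]
    refine ContinuousLinearMap.opNorm_le_bound _ (by positivity) fun v => ?_
    refine le_of_sq_le_sq ?_ (by positivity)
    refine (fibreQ_sub_heisAvg_sq_le q hJ hR hx hε hn hgap v).trans (le_of_eq ?_)
    have hs : √(q * (2 * R) ^ 2) ^ 2 = q * (2 * R) ^ 2 := Real.sq_sqrt (by positivity)
    rw [hC, mul_pow _ ‖v‖, mul_pow _ (1 / ((n : ℝ) + 1)), mul_pow (2 / ε), hs]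
    field_simp
  · simpa using tendsto_one_div_add_atTop_nhds_zero_nat.const_mul C

lemma norm_fibreQ_le {R : ℝ} (hJ : J.IsPeriodic q) (hR : J.IsRBounded R) {x : ℝ}
    (hx : Real.sin (2 * π * x) ≠ 0) : ‖fibreQ q J x‖ ≤ 2 * R :=
  le_of_tendsto (tendsto_heisAvg_fibreQ q hJ hR hx).norm
    (Eventually.of_forall fun n => norm_heisAvg_fibre_le q hJ hR x (by positivity))

end HellmannFeynman

/-! ### The circle: exceptional sets and the direct integral -/

section Circle

/-- `sin 2πθ` as a function on the circle. -/
def circleSin (θ : UnitAddCircle) : ℝ := (fourier 1 θ : ℂ).im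

lemma circleSin_coe (x : ℝ) : circleSin (x : UnitAddCircle) = Real.sin (2 * π * x) := by
  rw [circleSin, fourier_coe_unit, show 2 * π * Complex.I * ((1 : ℤ) : ℂ) * x =
    ((2 * π * x : ℝ) : ℂ) * Complex.I by push_cast; ring, Complex.exp_ofReal_mul_I_im]

lemma continuous_circleSin : Continuous circleSin :=
  Complex.continuous_im.comp (fourier 1 : C(UnitAddCircle, ℂ)).continuous

lemma haar_eq_volume :
    (AddCircle.haarAddCircle : Measure UnitAddCircle) = (volume : Measure UnitAddCircle) := by
  have h := AddCircle.volume_eq_smul_haarAddCircle (T := (1 : ℝ))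
  rw [ENNReal.ofReal_one, one_smul] at h
  exact h.symm

lemma haar_abs_circleSin_lt_le (σ : ℝ) :
    (AddCircle.haarAddCircle : Measure UnitAddCircle) {θ | |circleSin θ| < σ} ≤
      ENNReal.ofReal σ := by
  rcases le_or_gt σ 0 with hσ | hσ
  · have : {θ : UnitAddCircle | |circleSin θ| < σ} = ∅ := by
      ext θ
      simp only [Set.mem_ofPred_eq, Set.mem_empty_iff_false, iff_false, not_lt]
      exact hσ.trans (abs_nonneg _)
    rw [this, measure_empty]
    exact zero_le
  have hmeas : MeasurableSet {θ : UnitAddCircle | |circleSin θ| < σ} :=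
    (isOpen_lt continuous_circleSin.abs continuous_const).measurableSet
  -- On the fundamental domain `(-1/4, 3/4]` the zeros `0` and `1/2` of `sin 2πx` are the midpoints
  -- of the two halves.
  have hmp := UnitAddCircle.measurePreserving_mk (-1 / 4)
  rw [haar_eq_volume, ← hmp.measure_preimage hmeas.nullMeasurableSet, Measure.restrict_apply
    (hmp.measurable hmeas)]
  have hsub : ((↑) : ℝ → UnitAddCircle) ⁻¹' {θ : UnitAddCircle | |circleSin θ| < σ} ∩
      Set.Ioc (-1 / 4) (-1 / 4 + 1) ⊆
      Set.Icc (-(σ / 4)) (σ / 4) ∪ Set.Icc (1 / 2 - σ / 4) (1 / 2 + σ / 4) := by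
    rintro x ⟨hx1, hx2, hx3⟩
    have hx1' : |Real.sin (2 * π * x)| < σ := by
      rw [← circleSin_coe]
      exact hx1
    -- Jordan's inequality `|sin 2πy| ≥ 4|y|`. Each zero then contributes an interval of length
    -- `σ/2`.
    have key : ∀ y : ℝ, |y| ≤ 1 / 4 → |Real.sin (2 * π * y)| < σ → |y| ≤ σ / 4 := by
      intro y hy hys
      have habs : |2 * π * y| = 2 * π * |y| := by
        rw [abs_mul, abs_of_pos (by positivity)]
      have h := Real.mul_abs_le_abs_sin (x := 2 * π * y) (by
        rw [habs]
        nlinarith [Real.pi_pos])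
      rw [habs, show 2 / π * (2 * π * |y|) = 4 * |y| by field_simp; ring] at h
      linarith
    rcases le_or_gt x (1 / 4) with hx4 | hx4
    · left
      exact abs_le.mp (key x (abs_le.mpr ⟨by linarith, hx4⟩) hx1')
    · right
      have h := key (x - 1 / 2) (abs_le.mpr ⟨by linarith, by linarith⟩) (by
        rw [show 2 * π * (x - 1 / 2) = 2 * π * x - π by ring, Real.sin_sub_pi, abs_neg]
        exact hx1')
      rw [abs_le] at h
      exact ⟨by linarith, by linarith⟩
  refine (measure_mono hsub).trans ((measure_union_le _ _).trans (le_of_eq ?_))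
  rw [Real.volume_Icc, Real.volume_Icc, ← ENNReal.ofReal_add (by linarith) (by linarith)]
  congr 1
  ring

lemma ae_circleSin_ne_zero :
    ∀ᵐ θ ∂(AddCircle.haarAddCircle : Measure UnitAddCircle), circleSin θ ≠ 0 := by
  rw [ae_iff]
  have hlim : Tendsto (fun n : ℕ => ENNReal.ofReal (1 / ((n : ℝ) + 1))) atTop (𝓝 0) := by
    simpa [Function.comp_def] using (ENNReal.continuous_ofReal.tendsto 0).comp
      tendsto_one_div_add_atTop_nhds_zero_nat
  refine le_antisymm (ge_of_tendsto' hlim fun n => ?_) zero_le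
  refine (measure_mono fun θ hθ => ?_).trans (haar_abs_circleSin_lt_le (1 / ((n : ℝ) + 1)))
  have h0 : circleSin θ = 0 := not_not.mp hθ
  change |circleSin θ| < _
  rw [h0, abs_zero]
  positivity

lemma coe_equivIco_eq (θ : UnitAddCircle) :
    (((AddCircle.equivIco 1 0 θ : ℝ)) : UnitAddCircle) = θ := AddCircle.coe_equivIco

variable (q : ℕ)

/-- Evaluation at a point of the circle. -/
def evalFibre (θ : UnitAddCircle) :
    C(UnitAddCircle, Fibre q →L[ℂ] Fibre q) →A[ℂ] (Fibre q →L[ℂ] Fibre q) where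
  toFun M := M θ
  map_one' := rfl
  map_zero' := rfl
  map_mul' _ _ := rfl
  map_add' _ _ := rfl
  commutes' _ := rfl
  cont := continuous_eval_const θ

/-- Multiplication by a family of fibre operators, applied pointwise. -/
lemma directIntegral_ae {M : UnitAddCircle → Fibre q →L[ℂ] Fibre q}
    (hM : MemLp M ∞ (AddCircle.haarAddCircle : Measure UnitAddCircle)) (f : FloquetSpace q) :
    directIntegral q M f =ᵐ[AddCircle.haarAddCircle] fun θ => M θ (f θ) := by
  rw [directIntegral, dif_pos hM]
  filter_upwards [(ContinuousLinearMap.id ℂ (Fibre q →L[ℂ] Fibre q)).coeFn_holder (r := 2)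
    (hM.toLp M) f, hM.coeFn_toLp] with θ h1 h2
  rw [h2] at h1
  exact h1

lemma memLp_top_continuousMap (M : C(UnitAddCircle, Fibre q →L[ℂ] Fibre q)) :
    MemLp M ∞ (AddCircle.haarAddCircle : Measure UnitAddCircle) :=
  memLp_top_of_bound M.continuous.aestronglyMeasurable ‖M‖
    (Eventually.of_forall fun θ => M.norm_coe_le_norm θ)

lemma norm_directIntegral_le (M : C(UnitAddCircle, Fibre q →L[ℂ] Fibre q)) :
    ‖directIntegral q M‖ ≤ ‖M‖ := by
  refine ContinuousLinearMap.opNorm_le_bound _ (norm_nonneg M) fun f => ?_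
  refine Lp.norm_le_mul_norm_of_ae_le_mul ?_
  filter_upwards [directIntegral_ae q (memLp_top_continuousMap q M) f] with θ h
  rw [h]
  exact ((M θ).le_opNorm _).trans (by gcongr; exact M.norm_coe_le_norm θ)

/-- Continuous families of fibre operators acting on Floquet space. -/
def floquetRepLinear : C(UnitAddCircle, Fibre q →L[ℂ] Fibre q) →ₗ[ℂ]
    (FloquetSpace q →L[ℂ] FloquetSpace q) where
  toFun M := directIntegral q M
  map_add' M N := by
    ext1 f
    refine Lp.ext ?_
    filter_upwards [directIntegral_ae q (memLp_top_continuousMap q (M + N)) f,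
      directIntegral_ae q (memLp_top_continuousMap q N) f,
      directIntegral_ae q (memLp_top_continuousMap q M) f,
      Lp.coeFn_add (directIntegral q M f) (directIntegral q N f)] with θ h1 h2 h3 h4
    rw [Pi.add_apply, h2, h3] at h4
    exact h1.trans h4.symm
  map_smul' c M := by
    ext1 f
    refine Lp.ext ?_
    filter_upwards [directIntegral_ae q (memLp_top_continuousMap q (c • M)) f,
      directIntegral_ae q (memLp_top_continuousMap q M) f,
      Lp.coeFn_smul c (directIntegral q M f)] with θ h1 h2 h3
    rw [Pi.smul_apply, h2] at h3
    exact h1.trans h3.symm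

/-- `floquetRepLinear` as an algebra homomorphism. -/
def floquetRepAlgHom : C(UnitAddCircle, Fibre q →L[ℂ] Fibre q) →ₐ[ℂ]
    (FloquetSpace q →L[ℂ] FloquetSpace q) :=
  AlgHom.ofLinearMap (floquetRepLinear q)
    (by
      ext1 f
      refine Lp.ext ?_
      filter_upwards [directIntegral_ae q (memLp_top_continuousMap q 1) f] with θ h
      exact h)
    (fun M N => by
      ext1 f
      refine Lp.ext ?_
      filter_upwards [directIntegral_ae q (memLp_top_continuousMap q (M * N)) f,
        directIntegral_ae q (memLp_top_continuousMap q N) f,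
        directIntegral_ae q (memLp_top_continuousMap q M) (directIntegral q N f)] with θ h1 h2 h3
      rw [h2] at h3
      exact h1.trans h3.symm)

lemma continuous_floquetRepAlgHom : Continuous fun M => floquetRepAlgHom q M :=
  AddMonoidHomClass.continuous_of_bound (floquetRepLinear q) 1 fun M => by
    rw [one_mul]
    exact norm_directIntegral_le q M

/-- `floquetRepAlgHom` as a continuous homomorphism. -/
def floquetRep : C(UnitAddCircle, Fibre q →L[ℂ] Fibre q) →A[ℂ]
    (FloquetSpace q →L[ℂ] FloquetSpace q) :=
  { floquetRepAlgHom q with cont := continuous_floquetRepAlgHom q }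

variable [NeZero q] {J : JacobiMatrix}

/-- The average `(1/t) ∫₀ᵗ e^{isJ} i[J, X] e^{-isJ} ds` in the fibres. -/
def averageFibre (J : JacobiMatrix) (t : ℝ) : C(UnitAddCircle, Fibre q →L[ℂ] Fibre q) :=
  heisAvg (jacobiFibre q J) (currentFibre q J) t

lemma averageFibre_apply (t : ℝ) (θ : UnitAddCircle) :
    averageFibre q J t θ = heisAvg (jacobiFibre q J θ) (currentFibre q J θ) t :=
  map_heisAvg (evalFibre q θ) (jacobiFibre q J) (currentFibre q J) t

lemma memLp_circleQ {R : ℝ} (hJ : J.IsPeriodic q) (hR : J.IsRBounded R) :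
    MemLp (circleQ q J) ∞ (AddCircle.haarAddCircle : Measure UnitAddCircle) := by
  have hsin : ∀ θ : UnitAddCircle, circleSin θ ≠ 0 →
      Real.sin (2 * π * (AddCircle.equivIco 1 0 θ : ℝ)) ≠ 0 := by
    intro θ hθ
    rwa [← circleSin_coe, coe_equivIco_eq]
  refine memLp_top_of_bound (C := 2 * R) ?_ ?_
  · refine aestronglyMeasurable_of_tendsto_ae atTop
      (f := fun n : ℕ => averageFibre q J ((n : ℝ) + 1)) (fun n =>
        (averageFibre q J ((n : ℝ) + 1)).continuous.aestronglyMeasurable) ?_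
    filter_upwards [ae_circleSin_ne_zero] with θ hθ
    have h := tendsto_heisAvg_fibreQ q hJ hR (hsin θ hθ)
    rw [coe_equivIco_eq] at h
    simp only [averageFibre_apply]
    exact h
  · filter_upwards [ae_circleSin_ne_zero] with θ hθ
    exact norm_fibreQ_le q hJ hR (hsin θ hθ)

end Circle

/-! ### The Floquet representation on `ℓ²(ℤ)` -/

section PeriodRep

/-- The unit vector `δ_n`. -/
def delta (n : ℤ) : L2Z := lp.single 2 n (1 : ℂ)

lemma delta_apply (n m : ℤ) : delta n m = if m = n then 1 else 0 := by
  rw [delta, lp.single_apply, Pi.single_apply]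

lemma hasSum_delta (φ : L2Z) : HasSum (fun n : ℤ => φ n • delta n) φ := by
  have h := lp.hasSum_single (p := 2) (by simp) φ
  refine h.congr_fun fun n => ?_
  rw [delta, ← lp.single_smul, smul_eq_mul, mul_one]

lemma continuousLinearMap_ext_delta {S T : L2Z →L[ℂ] L2Z} (h : ∀ n, S (delta n) = T (delta n)) :
    S = T := by
  ext1 φ
  have h1 := S.hasSum (hasSum_delta φ)
  have h2 := T.hasSum (hasSum_delta φ)
  simp only [map_smul, h] at h1 h2
  exact h1.unique h2

/-- Only columns of `T` can be bounded well: a general `φ` could concentrate its Floquet transform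
on the bad fibres. This is the source of the `ℓ¹` norm in the final estimate. -/
lemma norm_apply_le_l1norm {φ : L2Z} (hφ : Memℓp (φ : ℤ → ℂ) 1) (T : L2Z →L[ℂ] L2Z) {C : ℝ}
    (hT : ∀ n, ‖T (delta n)‖ ≤ C) : ‖T φ‖ ≤ l1norm φ * C := by
  have hs : Summable fun n : ℤ => ‖φ n‖ := by simpa using hφ.summable (by simp)
  have h1 := T.hasSum (hasSum_delta φ)
  simp only [map_smul] at h1
  have hle : ∀ n : ℤ, ‖φ n • T (delta n)‖ ≤ ‖φ n‖ * C := fun n => by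
    rw [norm_smul]
    exact mul_le_mul_of_nonneg_left (hT n) (norm_nonneg _)
  rw [← h1.tsum_eq]
  have h2 := tsum_of_norm_bounded (hs.mul_right C).hasSum hle
  rwa [tsum_mul_right] at h2

lemma JacobiMatrix.op_delta (J : JacobiMatrix) (n : ℤ) :
    J.op (delta n) = (J.a n : ℂ) • delta (n + 1) + (J.b n : ℂ) • delta n +
      (J.a (n - 1) : ℂ) • delta (n - 1) := by
  ext m
  rw [J.op_apply, lp.coeFn_add, Pi.add_apply, lp.coeFn_add, Pi.add_apply, lp.coeFn_smul,
    lp.coeFn_smul, lp.coeFn_smul, Pi.smul_apply, Pi.smul_apply, Pi.smul_apply]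
  simp only [delta_apply, smul_eq_mul, mul_ite, mul_one, mul_zero]
  have e1 : (m - 1 = n) = (m = n + 1) := propext (by omega)
  have e2 : (m + 1 = n) = (m = n - 1) := propext (by omega)
  simp only [e1, e2]
  congr 1
  · congr 1
    · split_ifs with h
      · rw [h, add_sub_cancel_right]
      · rfl
    · split_ifs with h
      · rw [h]
      · rfl
  · split_ifs with h
    · rw [h]
    · rfl

/-- The current operator `i[J, X]` on `ℓ²(ℤ)`. -/
def currentOp (J : JacobiMatrix) : L2Z →L[ℂ] L2Z :=
  Complex.I • (weightedShift J.a 1 J.bdd_a -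
    weightedShift (fun n => J.a (n - 1)) (-1) (J.bdd_a.imp fun _ h n => h (n - 1)))

lemma currentOp_apply (J : JacobiMatrix) (φ : L2Z) (n : ℤ) :
    currentOp J φ n =
      Complex.I * ((J.a n : ℂ) * φ (n + 1) - (J.a (n - 1) : ℂ) * φ (n - 1)) := by
  change Complex.I * ((J.a n : ℂ) * φ (n + 1) - (J.a (n - 1) : ℂ) * φ (n + -1)) = _
  rw [← sub_eq_add_neg]

lemma currentOp_delta (J : JacobiMatrix) (n : ℤ) :
    currentOp J (delta n) = (-(Complex.I * J.a n)) • delta (n + 1) +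
      (Complex.I * J.a (n - 1)) • delta (n - 1) := by
  ext m
  rw [currentOp_apply, lp.coeFn_add, Pi.add_apply, lp.coeFn_smul,
    lp.coeFn_smul, Pi.smul_apply, Pi.smul_apply]
  simp only [delta_apply, smul_eq_mul, mul_ite, mul_one, mul_zero]
  have e1 : (m - 1 = n) = (m = n + 1) := propext (by omega)
  have e2 : (m + 1 = n) = (m = n - 1) := propext (by omega)
  simp only [e1, e2]
  split_ifs with h1 h2 h2
  · omega
  · rw [h1]
    ring
  · rw [h2, add_sub_cancel_right]
    ring
  · ring

lemma norm_sq_floquetSpace {q : ℕ} (f : FloquetSpace q) :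
    ‖f‖ ^ 2 = ∫ θ, ‖f θ‖ ^ 2 ∂(AddCircle.haarAddCircle : Measure UnitAddCircle) := by
  have h : ((‖f‖ : ℂ)) ^ 2 =
      ∫ θ, ((‖f θ‖ : ℂ)) ^ 2 ∂(AddCircle.haarAddCircle : Measure UnitAddCircle) := by
    refine (inner_self_eq_norm_sq_to_K (𝕜 := ℂ) f).symm.trans ((L2.inner_def f f).trans ?_)
    exact integral_congr_ae (Eventually.of_forall fun θ =>
      inner_self_eq_norm_sq_to_K (𝕜 := ℂ) (f θ))
  have h2 : (∫ θ, ((‖f θ‖ : ℂ)) ^ 2 ∂(AddCircle.haarAddCircle : Measure UnitAddCircle)) =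
      ((∫ θ, ‖f θ‖ ^ 2 ∂(AddCircle.haarAddCircle : Measure UnitAddCircle) : ℝ) : ℂ) := by
    refine Eq.trans ?_ integral_ofReal
    exact integral_congr_ae (Eventually.of_forall fun θ => (Complex.ofReal_pow _ 2).symm)
  rw [h2, ← Complex.ofReal_pow] at h
  exact Complex.ofReal_injective h

variable (q : ℕ) [NeZero q] {J : JacobiMatrix}

lemma floquetTransform_delta (n : ℤ) : floquetTransform q (delta n) = floquetVec q n := by
  rw [floquetTransform, delta, HilbertBasis.repr_symm_single, HilbertBasis.coe_mkOfOrthogonalEqBot]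

lemma floquetVec_ae (n : ℤ) :
    floquetVec q n =ᵐ[AddCircle.haarAddCircle] fibreVec q n := floquetVec_coe q n

/-- Continuous families of fibre operators acting on `ℓ²(ℤ)`. -/
def periodRep : C(UnitAddCircle, Fibre q →L[ℂ] Fibre q) →A[ℂ] (L2Z →L[ℂ] L2Z) :=
  ((floquetTransform q).symm.toContinuousLinearEquiv.conjContinuousAlgEquiv :
    (FloquetSpace q →L[ℂ] FloquetSpace q) →A[ℂ] (L2Z →L[ℂ] L2Z)).comp (floquetRep q)

lemma floquetTransform_periodRep (M : C(UnitAddCircle, Fibre q →L[ℂ] Fibre q)) (φ : L2Z) :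
    floquetTransform q (periodRep q M φ) = directIntegral q M (floquetTransform q φ) :=
  (floquetTransform q).apply_symm_apply _

lemma floquetTransform_opQ (φ : L2Z) :
    floquetTransform q (opQ q J φ) = directIntegral q (circleQ q J) (floquetTransform q φ) :=
  (floquetTransform q).apply_symm_apply _

lemma periodRep_delta {M : C(UnitAddCircle, Fibre q →L[ℂ] Fibre q)} {n : ℤ} {α β γ : ℂ}
    (hM : ∀ θ, M θ (fibreVec q n θ) =
      α • fibreVec q (n + 1) θ + β • fibreVec q n θ + γ • fibreVec q (n - 1) θ) :
    periodRep q M (delta n) = α • delta (n + 1) + β • delta n + γ • delta (n - 1) := by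
  apply (floquetTransform q).injective
  rw [floquetTransform_periodRep, map_add, map_add, map_smul, map_smul, map_smul]
  simp only [floquetTransform_delta]
  refine Lp.ext ?_
  filter_upwards [directIntegral_ae q (memLp_top_continuousMap q M) (floquetVec q n),
    floquetVec_ae q n, floquetVec_ae q (n + 1), floquetVec_ae q (n - 1),
    Lp.coeFn_add (α • floquetVec q (n + 1) + β • floquetVec q n) (γ • floquetVec q (n - 1)),
    Lp.coeFn_add (α • floquetVec q (n + 1)) (β • floquetVec q n),
    Lp.coeFn_smul α (floquetVec q (n + 1)), Lp.coeFn_smul β (floquetVec q n),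
    Lp.coeFn_smul γ (floquetVec q (n - 1))] with θ h1 h2 h3 h4 h5 h6 h7 h8 h9
  rw [h1, h5, Pi.add_apply, h6, Pi.add_apply, h7, h8, h9, Pi.smul_apply, Pi.smul_apply,
    Pi.smul_apply, h2, h3, h4, hM]

lemma periodRep_jacobiFibre (hJ : J.IsPeriodic q) : periodRep q (jacobiFibre q J) = J.op := by
  refine continuousLinearMap_ext_delta fun n => ?_
  rw [periodRep_delta q fun θ => jacobiFibre_fibreVec q hJ θ n, J.op_delta]

lemma periodRep_currentFibre (hJ : J.IsPeriodic q) :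
    periodRep q (currentFibre q J) = currentOp J := by
  refine continuousLinearMap_ext_delta fun n => ?_
  have h := periodRep_delta q (M := currentFibre q J) (n := n) (α := -(Complex.I * J.a n))
    (β := 0) (γ := Complex.I * J.a (n - 1)) fun θ => by
      rw [currentFibre_fibreVec q hJ, zero_smul, add_zero]
  rw [h, currentOp_delta, zero_smul, add_zero]

lemma periodRep_averageFibre (hJ : J.IsPeriodic q) (t : ℝ) :
    periodRep q (averageFibre q J t) = heisAvg J.op (currentOp J) t := by
  refine (map_heisAvg (periodRep q) (jacobiFibre q J) (currentFibre q J) t).trans ?_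
  rw [periodRep_jacobiFibre q hJ, periodRep_currentFibre q hJ]

/-- Fibrewise bounds that are better off the set where `|sin 2πθ| < σ`. -/
lemma norm_opQ_sub_heisAvg_delta_sq_le {R a b σ t : ℝ} (hJ : J.IsPeriodic q)
    (hR : J.IsRBounded R) (hb : 0 ≤ b) (ha : 0 ≤ a) (hσ : 0 ≤ σ)
    (hgood : ∀ x : ℝ, Real.sin (2 * π * x) ≠ 0 → σ ≤ |Real.sin (2 * π * x)| →
      ∀ v : Fibre q, ‖v‖ = 1 → ‖(fibreQ q J x - heisAvg (jacobiFibre q J (x : UnitAddCircle))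
        (currentFibre q J (x : UnitAddCircle)) t) v‖ ^ 2 ≤ a)
    (hbad : ∀ x : ℝ, Real.sin (2 * π * x) ≠ 0 →
      ∀ v : Fibre q, ‖v‖ = 1 → ‖(fibreQ q J x - heisAvg (jacobiFibre q J (x : UnitAddCircle))
        (currentFibre q J (x : UnitAddCircle)) t) v‖ ^ 2 ≤ b) (n : ℤ) :
    ‖(opQ q J - heisAvg J.op (currentOp J) t) (delta n)‖ ^ 2 ≤ a + b * σ := by
  rw [← (floquetTransform q).norm_map, sub_apply, map_sub, floquetTransform_opQ,
    ← periodRep_averageFibre q hJ, floquetTransform_periodRep, floquetTransform_delta,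
    norm_sq_floquetSpace]
  -- By Plancherel the squared norm is the integral of fibre errors on unit vectors: at most `a` off
  -- `B` and `b` on `B`, where `B` has measure at most `σ`.
  set B : Set UnitAddCircle := {θ | |circleSin θ| < σ} with hB
  have hBm : MeasurableSet B :=
    (isOpen_lt continuous_circleSin.abs continuous_const).measurableSet
  have hint : Integrable (fun θ => a + B.indicator (fun _ => b) θ)
      (AddCircle.haarAddCircle : Measure UnitAddCircle) :=
    (integrable_const a).add ((integrable_const b).indicator hBm)
  have hle : (fun θ => ‖(directIntegral q (circleQ q J) (floquetVec q n) -
      directIntegral q (averageFibre q J t) (floquetVec q n) : FloquetSpace q) θ‖ ^ 2)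
      ≤ᵐ[AddCircle.haarAddCircle] fun θ => a + B.indicator (fun _ => b) θ := by
    filter_upwards [ae_circleSin_ne_zero,
      directIntegral_ae q (memLp_circleQ q hJ hR) (floquetVec q n),
      directIntegral_ae q (memLp_top_continuousMap q (averageFibre q J t)) (floquetVec q n),
      floquetVec_ae q n, Lp.coeFn_sub (directIntegral q (circleQ q J) (floquetVec q n))
      (directIntegral q (averageFibre q J t) (floquetVec q n))] with θ h0 h1 h2 h3 h4
    set x : ℝ := (AddCircle.equivIco 1 0 θ : ℝ) with hx
    have hxθ : (x : UnitAddCircle) = θ := coe_equivIco_eq θ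
    have hs : circleSin θ = Real.sin (2 * π * x) := by rw [← hxθ, circleSin_coe]
    have hval : (directIntegral q (circleQ q J) (floquetVec q n) -
        directIntegral q (averageFibre q J t) (floquetVec q n) : FloquetSpace q) θ =
        (fibreQ q J x - heisAvg (jacobiFibre q J (x : UnitAddCircle))
        (currentFibre q J (x : UnitAddCircle)) t) (fibreVec q n θ) := by
      rw [h4, Pi.sub_apply, h1, h2, h3, averageFibre_apply, sub_apply, hxθ]
      rfl
    rw [hval]
    rw [hs] at h0
    by_cases hθ : θ ∈ B
    · rw [Set.indicator_of_mem hθ]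
      have := hbad x h0 _ (norm_fibreVec q n θ)
      linarith
    · rw [Set.indicator_of_notMem hθ, add_zero]
      refine hgood x h0 ?_ _ (norm_fibreVec q n θ)
      rw [← hs]
      exact not_lt.mp hθ
  refine (integral_mono_of_nonneg (Eventually.of_forall fun θ => by positivity) hint hle).trans ?_
  rw [integral_add (integrable_const a) ((integrable_const b).indicator hBm), integral_const,
    integral_indicator_const _ hBm]
  have hm : (AddCircle.haarAddCircle : Measure UnitAddCircle).real B ≤ σ := by
    have := ENNReal.toReal_mono ENNReal.ofReal_ne_top (haar_abs_circleSin_lt_le σ)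
    rwa [ENNReal.toReal_ofReal hσ] at this
  simp only [probReal_univ, smul_eq_mul, one_mul]
  have := mul_le_mul_of_nonneg_right hm hb
  linarith

end PeriodRep

/-! ### The Heisenberg evolution of the position operator -/

section Position

variable {E F : Type*} [NormedAddCommGroup E] [NormedSpace ℂ E] [CompleteSpace E]
  [NormedAddCommGroup F] [NormedSpace ℂ F] [CompleteSpace F]

lemma hasSum_expI_apply (A : E →L[ℂ] E) (s : ℝ) (v : E) :
    HasSum (fun n : ℕ => ((n.factorial : ℂ)⁻¹ * (Complex.I * s) ^ n) • (A ^ n) v)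
      (expI A s v) := by
  have h := NormedSpace.exp_series_hasSum_exp' (𝕂 := ℂ) ((Complex.I * (s : ℂ)) • A)
  have h2 := (ContinuousLinearMap.apply ℂ E v).hasSum h
  refine h2.congr_fun fun n => ?_
  rw [smul_pow, smul_smul]
  rfl

/-- The partial sums of the exponential series stay in `S`. Applied to the graph of `X`, this shows
that the evolution preserves `D(X)`. -/
lemma expI_mem_of_invariant {A : E →L[ℂ] E} {S : Submodule ℂ E} (hS : IsClosed (S : Set E))
    (hA : ∀ v ∈ S, A v ∈ S) (s : ℝ) {v : E} (hv : v ∈ S) : expI A s v ∈ S := by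
  have hpow : ∀ n : ℕ, (A ^ n) v ∈ S := by
    intro n
    induction n with
    | zero => exact hv
    | succ n ih =>
      rw [pow_succ']
      exact hA _ ih
  exact hS.mem_of_tendsto (hasSum_expI_apply A s v)
    (Eventually.of_forall fun T => S.sum_mem fun n _ => S.smul_mem _ (hpow n))

lemma expI_intertwine {A : E →L[ℂ] E} {B : F →L[ℂ] F} (L : E →L[ℂ] F)
    (h : ∀ v, L (A v) = B (L v)) (s : ℝ) (v : E) : L (expI A s v) = expI B s (L v) := by
  have hpow : ∀ n : ℕ, L ((A ^ n) v) = (B ^ n) (L v) := by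
    intro n
    induction n with
    | zero => rfl
    | succ n ih => rw [pow_succ', pow_succ', mul_apply_eq_comp, mul_apply_eq_comp, h, ih]
  have h1 := L.hasSum (hasSum_expI_apply A s v)
  simp only [map_smul, hpow] at h1
  exact h1.unique (hasSum_expI_apply B s (L v))

/-- The generator of the joint evolution of `(φ, Xφ)`. -/
def positionGenerator (J : JacobiMatrix) : (L2Z × L2Z) →L[ℂ] (L2Z × L2Z) :=
  (J.op ∘L ContinuousLinearMap.fst ℂ L2Z L2Z).prod
    (Complex.I • (currentOp J ∘L ContinuousLinearMap.fst ℂ L2Z L2Z) +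
      J.op ∘L ContinuousLinearMap.snd ℂ L2Z L2Z)

/-- The graph of the position operator. -/
def positionGraph : Submodule ℂ (L2Z × L2Z) where
  carrier := {v | ∀ m : ℤ, v.2 m = (m : ℂ) * v.1 m}
  add_mem' {v w} hv hw m := by
    change v.2 m + w.2 m = (m : ℂ) * (v.1 m + w.1 m)
    rw [hv, hw, mul_add]
  zero_mem' m := by
    change (0 : ℂ) = (m : ℂ) * 0
    rw [mul_zero]
  smul_mem' c v hv m := by
    change c * v.2 m = (m : ℂ) * (c * v.1 m)
    rw [hv]
    ring

lemma continuous_apply_L2Z (m : ℤ) : Continuous fun φ : L2Z => φ m :=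
  (lp.evalCLM ℂ (fun _ : ℤ => ℂ) 2 m).continuous

lemma isClosed_positionGraph : IsClosed (positionGraph : Set (L2Z × L2Z)) := by
  have : (positionGraph : Set (L2Z × L2Z)) =
      ⋂ m : ℤ, {v : L2Z × L2Z | v.2 m = (m : ℂ) * v.1 m} := by
    ext v
    rw [Set.mem_iInter]
    rfl
  rw [this]
  refine isClosed_iInter fun m => isClosed_eq ((continuous_apply_L2Z m).comp continuous_snd) ?_
  exact continuous_const.mul ((continuous_apply_L2Z m).comp continuous_fst)

/-- This is `XJ = JX + [X, J]`, where `[X, J]` equals `i` times the current `i[J, X]`. -/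
lemma positionGenerator_mem (J : JacobiMatrix) {v : L2Z × L2Z} (hv : v ∈ positionGraph) :
    positionGenerator J v ∈ positionGraph := by
  intro m
  change Complex.I * currentOp J v.1 m + J.op v.2 m = (m : ℂ) * J.op v.1 m
  rw [currentOp_apply, J.op_apply, J.op_apply, hv, hv, hv]
  push_cast
  linear_combination ((J.a m : ℂ) * v.1 (m + 1) - (J.a (m - 1) : ℂ) * v.1 (m - 1)) * Complex.I_sq

lemma heisenbergX_apply (J : JacobiMatrix) (t : ℝ) {φ : L2Z}
    (h : φ ∈ (heisenbergX J t).domain) : heisenbergX J t ⟨φ, h⟩ =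
      expI J.op t (positionOp ⟨expI J.op (-t) φ, h⟩) := rfl

/-- The pair `(φ, Xφ)` is evolved by a bounded generator on `ℓ² × ℓ²`, so the unbounded `X` is never
differentiated. The second component of the evolved pair is `X e^{-isJ} φ`, the derivative of
`e^{isJ} X e^{-isJ} φ` is the evolved current applied to `φ`, and integration over `[0, t]` gives
the formula. -/
lemma exists_heisenbergX_eq (J : JacobiMatrix) {t : ℝ} (ht : t ≠ 0) {φ : L2Z}
    (hφ : φ ∈ positionOp.domain) : ∃ hφt : φ ∈ (heisenbergX J t).domain,
      heisenbergX J t ⟨φ, hφt⟩ =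
        positionOp ⟨φ, hφ⟩ + (t : ℂ) • heisAvg J.op (currentOp J) t φ := by
  set v₀ : L2Z × L2Z := (φ, positionOp ⟨φ, hφ⟩) with hv₀
  have hv₀mem : v₀ ∈ positionGraph := fun m => rfl
  set 𝒥 := positionGenerator J with h𝒥
  have hmem : ∀ s, expI 𝒥 s v₀ ∈ positionGraph := fun s =>
    expI_mem_of_invariant isClosed_positionGraph (fun v hv => positionGenerator_mem J hv) s hv₀mem
  have hfst : ∀ s, (expI 𝒥 s v₀).1 = expI J.op s φ := fun s =>
    expI_intertwine (ContinuousLinearMap.fst ℂ L2Z L2Z) (fun v => rfl) s v₀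
  have hcoord : ∀ s : ℝ, ∀ m : ℤ, (expI 𝒥 s v₀).2 m = (m : ℂ) * expI J.op s φ m := by
    intro s m
    rw [← hfst]
    exact hmem s m
  have hdom : expI J.op (-t) φ ∈ positionOp.domain := by
    change Memℓp (fun n : ℤ => (n : ℂ) * expI J.op (-t) φ n) 2
    have e : (fun n : ℤ => (n : ℂ) * expI J.op (-t) φ n) = (expI 𝒥 (-t) v₀).2 := by
      funext m
      rw [hcoord]
    rw [e]
    exact lp.memℓp _
  have hX : positionOp ⟨expI J.op (-t) φ, hdom⟩ = (expI 𝒥 (-t) v₀).2 := by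
    ext m
    exact (hcoord (-t) m).symm
  have hdom' : φ ∈ (heisenbergX J t).domain := hdom
  refine ⟨hdom', ?_⟩
  rw [heisenbergX_apply J t hdom', hX]
  have hder : ∀ s : ℝ, HasDerivAt (fun s => expI J.op s (expI 𝒥 (-s) v₀).2)
      (heis J.op (currentOp J) s φ) s := by
    intro s
    have h1 : HasDerivAt (fun s => (expI J.op s).restrictScalars ℝ)
        ((Complex.I • (J.op * expI J.op s)).restrictScalars ℝ) s :=
      (ContinuousLinearMap.restrictScalarsL ℂ L2Z L2Z ℝ ℝ).hasFDerivAt.comp_hasDerivAt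
        s (hasDerivAt_expI J.op s)
    have h2 : HasDerivAt (fun s => expI 𝒥 (-s)) (-(Complex.I • (𝒥 * expI 𝒥 (-s)))) s := by
      simpa [Function.comp_def] using (hasDerivAt_expI 𝒥 (-s)).scomp s (hasDerivAt_neg s)
    let L : ((L2Z × L2Z) →L[ℂ] (L2Z × L2Z)) →L[ℂ] L2Z :=
      (ContinuousLinearMap.snd ℂ L2Z L2Z) ∘L (ContinuousLinearMap.apply ℂ (L2Z × L2Z) v₀)
    have h3 : HasDerivAt (fun s => (expI 𝒥 (-s) v₀).2)
        (L (-(Complex.I • (𝒥 * expI 𝒥 (-s))))) s :=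
      (L.restrictScalars ℝ).hasFDerivAt.comp_hasDerivAt s h2
    have h4 := h1.clm_apply h3
    have e1 : L (-(Complex.I • (𝒥 * expI 𝒥 (-s)))) = currentOp J (expI J.op (-s) φ) -
        Complex.I • J.op (expI 𝒥 (-s) v₀).2 := by
      change -(Complex.I • (Complex.I • currentOp J (expI 𝒥 (-s) v₀).1 +
        J.op (expI 𝒥 (-s) v₀).2)) = _
      rw [hfst, smul_add, smul_smul, Complex.I_mul_I]
      module
    have e2 : heis J.op (currentOp J) s φ = (Complex.I • (J.op * expI J.op s)) (expI 𝒥 (-s) v₀).2 +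
        expI J.op s (L (-(Complex.I • (𝒥 * expI 𝒥 (-s))))) := by
      rw [e1, (commute_expI J.op s).eq]
      change _ = Complex.I • (expI J.op s (J.op (expI 𝒥 (-s) v₀).2)) +
        expI J.op s (currentOp J (expI J.op (-s) φ) - Complex.I • J.op (expI 𝒥 (-s) v₀).2)
      rw [map_sub, map_smul, add_sub_cancel]
      rfl
    rw [e2]
    exact h4
  have hcont : Continuous fun s => heis J.op (currentOp J) s φ :=
    (ContinuousLinearMap.apply ℂ L2Z φ).continuous.comp (continuous_heis J.op (currentOp J))
  have hftc := intervalIntegral.integral_eq_sub_of_hasDerivAt (a := 0) (b := t)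
    (fun s _ => hder s) (hcont.intervalIntegrable 0 t)
  have hpull := (ContinuousLinearMap.apply ℂ L2Z φ).intervalIntegral_comp_comm
    ((continuous_heis J.op (currentOp J)).intervalIntegrable (μ := volume) 0 t)
  have h0 : expI J.op 0 (expI 𝒥 (-0) v₀).2 = positionOp ⟨φ, hφ⟩ := by
    rw [neg_zero, expI_zero, expI_zero]
    rfl
  rw [h0] at hftc
  have hav : (t : ℂ) • heisAvg J.op (currentOp J) t φ =
      ∫ s in (0 : ℝ)..t, heis J.op (currentOp J) s φ := by
    rw [heisAvg, FunLike.coe_smul, Pi.smul_apply, smul_smul]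
    have : (t : ℂ) * ((1 / t : ℝ) : ℂ) = 1 := by
      rw [← Complex.ofReal_mul, mul_one_div_cancel ht, Complex.ofReal_one]
    rw [this, one_smul]
    exact hpull.symm
  rw [hav, hftc]
  abel

end Position

section Approximation

/-! ### Comparing Jacobi matrices -/

lemma norm_apply_delta_le (T : L2Z →L[ℂ] L2Z) (n m : ℤ) : ‖T (delta n) m‖ ≤ ‖T‖ := by
  refine (lp.norm_apply_le_norm two_ne_zero _ m).trans ((T.le_opNorm _).trans (le_of_eq ?_))
  rw [delta, lp.norm_single (by norm_num), norm_one, mul_one]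

lemma norm_a_sub_le (J J' : JacobiMatrix) (n : ℤ) : ‖(J.a n : ℂ) - J'.a n‖ ≤ ‖J.op - J'.op‖ := by
  have h := norm_apply_delta_le (J.op - J'.op) (n + 1) n
  have e : (J.op - J'.op) (delta (n + 1)) n = (J.a n : ℂ) - J'.a n := by
    change J.op (delta (n + 1)) n - J'.op (delta (n + 1)) n = _
    rw [J.op_apply, J'.op_apply]
    have h1 : n - 1 ≠ n + 1 := by omega
    have h2 : n ≠ n + 1 := by omega
    simp only [delta_apply, if_neg h1, if_neg h2, if_true, mul_zero, mul_one, zero_add]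
  rwa [e] at h

lemma norm_b_sub_le (J J' : JacobiMatrix) (n : ℤ) : ‖(J.b n : ℂ) - J'.b n‖ ≤ ‖J.op - J'.op‖ := by
  have h := norm_apply_delta_le (J.op - J'.op) n n
  have e : (J.op - J'.op) (delta n) n = (J.b n : ℂ) - J'.b n := by
    change J.op (delta n) n - J'.op (delta n) n = _
    rw [J.op_apply, J'.op_apply]
    have h1 : n - 1 ≠ n := by omega
    have h2 : n + 1 ≠ n := by omega
    simp only [delta_apply, if_neg h1, if_neg h2, if_true, mul_zero, mul_one, zero_add, add_zero]
  rwa [e] at h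

/-- The coefficients are matrix elements, so their differences are bounded by the operator norm; the
factor `3` counts the diagonals. -/
lemma norm_jacobiFibre_sub_le (q : ℕ) [NeZero q] (J J' : JacobiMatrix) (θ : UnitAddCircle) :
    ‖jacobiFibre q J θ - jacobiFibre q J' θ‖ ≤ 3 * ‖J.op - J'.op‖ := by
  have e : jacobiFibre q J θ - jacobiFibre q J' θ = triFibre q (fun n => (J.a n : ℂ) - J'.a n)
      (fun n => (J.b n : ℂ) - J'.b n) (fun n => (J.a (n - 1) : ℂ) - J'.a (n - 1)) θ := by
    ext1 v
    rw [sub_apply, jacobiFibre, jacobiFibre, triFibre_apply, triFibre_apply, triFibre_apply,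
      ← Finset.sum_sub_distrib]
    refine Finset.sum_congr rfl fun k _ => ?_
    rw [← smul_sub]
    congr 1
    module
  rw [e]
  refine (norm_triFibre_le q (norm_a_sub_le J J') (norm_b_sub_le J J')
    (fun n => norm_a_sub_le J J' (n - 1)) θ).trans (le_of_eq ?_)
  ring

lemma JacobiMatrix.IsPeriodic.mul {p : ℕ} {J : JacobiMatrix} (hJ : J.IsPeriodic p) (r : ℕ) :
    J.IsPeriodic (p * r) := by
  intro n
  have e : n + ((p * r : ℕ) : ℤ) = n + (r : ℤ) * p := by
    push_cast
    ring
  rw [e, hJ.a_add_mul, hJ.b_add_mul]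
  exact ⟨rfl, rfl⟩

/-- Away from the band edges, the spectral gaps of a periodic Jacobi matrix that is close to one of
a smaller period are large. -/
lemma le_gap_of_close {R c : ℝ} (hL : IsLastConstant R c) {p q r : ℕ} [NeZero p] [NeZero q]
    (hq : q = p * r) (hp : 6 ≤ p) {J J' : JacobiMatrix} (hJ : J.IsPeriodic q)
    (hJ' : J'.IsPeriodic p) (hR' : J'.IsRBounded R) {ε x : ℝ} (hε : 0 < ε)
    (hclose : 3 * ‖J.op - J'.op‖ ≤ ε) (hx : Real.sin (2 * π * x) ≠ 0)
    (hσ : q * Real.exp (c * p / 2) * √ε ≤ |Real.sin (2 * π * x)|) {k l : Fin q} (hkl : k ≠ l) :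
    ε ≤ |floquetEig q J k x - floquetEig q J l x| := by
  have hJq' : J'.IsPeriodic q := hq ▸ hJ'.mul r
  obtain ⟨b, hb⟩ := exists_eigenbasis q hJ x
  obtain ⟨b', hb'⟩ := exists_eigenbasis q hJq' x
  refine le_gap_of_perturbation hb hb' (jacobiFibre_inner q hJq' x) hε.le
    ((norm_jacobiFibre_sub_le q J J' (x : UnitAddCircle)).trans hclose) (fun j j' hjj' => ?_) hkl
  have h1 := sin_sq_le_mul_gap hL hq hJ' hJq' hR' hx hjj'
  have h2 : (q * Real.exp (c * p / 2) * √ε) ^ 2 ≤ Real.sin (2 * π * x) ^ 2 := by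
    rw [← sq_abs (Real.sin (2 * π * x))]
    gcongr
  have hr : (0 : ℝ) < r := by
    have : r ≠ 0 := fun h => NeZero.ne q (by rw [hq, h, mul_zero])
    exact_mod_cast Nat.pos_of_ne_zero this
  have he : Real.exp (c * p / 2) ^ 2 = Real.exp (c * p) := by
    rw [← Real.exp_nat_mul]
    congr 1
    push_cast
    ring
  rw [mul_pow, mul_pow, he, Real.sq_sqrt hε.le, hq, Nat.cast_mul] at h2
  -- `le_gap_of_perturbation` with `δ = ε` requires gaps above `4ε`. The factor `p² ≥ 36` left over
  -- in the choice of threshold supplies `36ε / 2π`, which is enough since `π < 4`.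
  have hp' : (6 : ℝ) ≤ p := by exact_mod_cast hp
  have hpos : 0 < (r : ℝ) ^ 2 * Real.exp (c * p) := by positivity
  set g := |floquetEig q J' j x - floquetEig q J' j' x|
  have h3 : (r : ℝ) ^ 2 * Real.exp (c * p) * (p ^ 2 * ε) ≤
      (r : ℝ) ^ 2 * Real.exp (c * p) * (2 * π * g) := by
    calc _ = ((p : ℝ) * r) ^ 2 * Real.exp (c * p) * ε := by ring
      _ ≤ _ := h2.trans h1
      _ = _ := by ring
  have h4 := le_of_mul_le_mul_left h3 hpos
  have h5 : 36 * ε ≤ 2 * π * g := by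
    refine le_trans ?_ h4
    gcongr
    nlinarith
  nlinarith [Real.pi_lt_four, abs_nonneg (floquetEig q J' j x - floquetEig q J' j' x)]

/-- The ballistic approximation on a delta function. -/
lemma norm_opQ_sub_heisAvg_delta_le {R c : ℝ} (hL : IsLastConstant R c) {p q r : ℕ} [NeZero p]
    [NeZero q] (hq : q = p * r) (hp : 6 ≤ p) {J J' : JacobiMatrix} (hJ : J.IsPeriodic q)
    (hR : J.IsRBounded R) (hJ' : J'.IsPeriodic p) (hR' : J'.IsRBounded R) {ε t : ℝ} (hε : 0 < ε)
    (ht : 0 < t) (hclose : 3 * ‖J.op - J'.op‖ ≤ ε) (n : ℤ) :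
    ‖(opQ q J - heisAvg J.op (currentOp J) t) (delta n)‖ ≤
      √(4 * R ^ 2 * (q : ℝ) ^ 2 / (t ^ 2 * ε ^ 2) +
        16 * R ^ 2 * (q : ℝ) * Real.exp (c * p / 2) * √ε) := by
  refine Real.le_sqrt_of_sq_le ?_
  -- Turns the constant `4 · q · (2R)² = 16R²q` of the fibre estimate into `4R²q²`.
  have hq4 : (4 : ℝ) ≤ q := by
    have h1 : p ≤ q := Nat.le_of_dvd (Nat.pos_of_ne_zero (NeZero.ne q)) ⟨r, hq⟩
    exact_mod_cast (by omega : 4 ≤ q)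
  refine (norm_opQ_sub_heisAvg_delta_sq_le q (a := 4 * R ^ 2 * (q : ℝ) ^ 2 / (t ^ 2 * ε ^ 2))
    (b := 16 * R ^ 2) (σ := q * Real.exp (c * p / 2) * √ε) (t := t) hJ hR (by positivity)
    (by positivity) (by positivity) (fun x hx hσ v hv => ?_) (fun x hx v hv => ?_) n).trans
    (le_of_eq (by ring))
  · refine (fibreQ_sub_heisAvg_sq_le q hJ hR hx hε ht
      (fun k l hkl => le_gap_of_close hL hq hp hJ hJ' hR' hε hclose hx hσ hkl) v).trans ?_
    rw [hv, one_pow, mul_one, div_pow, mul_pow t, div_mul_eq_mul_div]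
    refine div_le_div_of_nonneg_right ?_ (by positivity)
    nlinarith [mul_nonneg (mul_nonneg (sq_nonneg R) (Nat.cast_nonneg (α := ℝ) q))
      (sub_nonneg.mpr hq4)]
  · have h := ((fibreQ q J x - heisAvg (jacobiFibre q J (x : UnitAddCircle))
      (currentFibre q J (x : UnitAddCircle)) t).le_opNorm v).trans
      (mul_le_mul_of_nonneg_right ((norm_sub_le _ _).trans
        (add_le_add (norm_fibreQ_le q hJ hR hx) (norm_heisAvg_fibre_le q hJ hR x ht)))
        (norm_nonneg v))
    rw [hv, mul_one] at h
    calc _ ≤ (2 * R + 2 * R) ^ 2 := by gcongr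
      _ = 16 * R ^ 2 := by ring

lemma norm_opQ_sub_heisenbergX_le {J : JacobiMatrix} {q : ℕ} [NeZero q] {t C : ℝ} (ht : 0 < t)
    (hC : ∀ n, ‖(opQ q J - heisAvg J.op (currentOp J) t) (delta n)‖ ≤ C) {φ : L2Z}
    (hφ1 : Memℓp (φ : ℤ → ℂ) 1) (hφ : φ ∈ positionOp.domain) :
    ∃ hφt : φ ∈ (heisenbergX J t).domain,
      ‖opQ q J φ - ((1 / t : ℝ) : ℂ) • heisenbergX J t ⟨φ, hφt⟩‖ ≤
        1 / t * ‖positionOp ⟨φ, hφ⟩‖ + l1norm φ * C := by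
  obtain ⟨hφt, h⟩ := exists_heisenbergX_eq J ht.ne' hφ
  refine ⟨hφt, ?_⟩
  have e : opQ q J φ - ((1 / t : ℝ) : ℂ) • heisenbergX J t ⟨φ, hφt⟩ =
      (opQ q J - heisAvg J.op (currentOp J) t) φ -
        ((1 / t : ℝ) : ℂ) • positionOp ⟨φ, hφ⟩ := by
    have h1 : ((1 / t : ℝ) : ℂ) * (t : ℂ) = 1 := by
      rw [← Complex.ofReal_mul, one_div_mul_cancel ht.ne', Complex.ofReal_one]
    rw [h, smul_add, smul_smul, h1, one_smul, sub_apply]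
    abel
  rw [e]
  refine (norm_sub_le _ _).trans ?_
  rw [norm_smul, Complex.norm_real, Real.norm_of_nonneg (by positivity), add_comm]
  gcongr
  exact norm_apply_le_l1norm hφ1 _ hC

/-! ### Closeness of consecutive periodic approximants. -/

namespace JacobiMatrix.IsExpApprox

variable {η : ℝ} {J : JacobiMatrix} {q : ℕ → ℕ} {Jq : ℕ → JacobiMatrix} [∀ n, NeZero (q n)]

lemma strictMono (h : IsExpApprox η J q Jq) : StrictMono q :=
  strictMono_nat_of_lt_succ fun n => lt_of_le_of_ne
    (Nat.le_of_dvd (Nat.pos_of_ne_zero (NeZero.ne _)) (h.dvd n)) (h.ne n)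

lemma eventually_three_mul_norm_sub_le (h : IsExpApprox η J q Jq) (hη : 0 ≤ η) :
    ∀ᶠ n in atTop, 3 * ‖(Jq (n + 1)).op - (Jq n).op‖ ≤ gam η q (n + 1) := by
  -- The threshold `1/6` at both `n` and `n + 1` gives `3 · (1/6 + 1/6) = 1`.
  have h1 : ∀ᶠ n in atTop,
      (q (n + 1) : ℝ) ^ 3 * Real.exp (η * q n) * ‖J.op - (Jq n).op‖ < 1 / 6 :=
    h.tendsto.eventually_lt_const (by norm_num)
  filter_upwards [h1, (tendsto_add_atTop_nat 1).eventually h1] with n hn hn'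
  have hpos : (0 : ℝ) < q (n + 1) := by exact_mod_cast Nat.pos_of_ne_zero (NeZero.ne (q (n + 1)))
  have hle : (q (n + 1) : ℝ) ≤ q (n + 1 + 1) := by
    exact_mod_cast h.strictMono.monotone (Nat.le_succ _)
  have hle' : (q n : ℝ) ≤ q (n + 1) := by
    exact_mod_cast h.strictMono.monotone (Nat.le_succ _)
  -- The weight at index `n + 1` dominates the one at index `n`, as `q` increases and `η ≥ 0`.
  have hn2 : (q (n + 1) : ℝ) ^ 3 * Real.exp (η * q n) * ‖J.op - (Jq (n + 1)).op‖ < 1 / 6 := by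
    refine lt_of_le_of_lt ?_ hn'
    gcongr
  have htri : ‖(Jq (n + 1)).op - (Jq n).op‖ ≤ ‖J.op - (Jq (n + 1)).op‖ + ‖J.op - (Jq n).op‖ := by
    rw [norm_sub_rev J.op (Jq (n + 1)).op]
    exact norm_sub_le_norm_sub_add_norm_sub _ _ _
  set M := (q (n + 1) : ℝ) ^ 3 with hM
  have hM0 : 0 < M := by positivity
  rw [gam, Nat.add_sub_cancel, Real.exp_neg, ← hM, le_div_iff₀ hM0,
    ← one_div, le_div_iff₀ (Real.exp_pos _)]
  have h2 := mul_le_mul_of_nonneg_left htri (mul_pos hM0 (Real.exp_pos (η * q n))).le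
  nlinarith

end JacobiMatrix.IsExpApprox

end Approximation

end JacobiTransport

end

/-! ### The ballistic estimate for exponentially approximable Jacobi matrices. -/

theorem corollary4p2 (R : ℝ) (hR : 0 < R) :
    (∃ c : ℝ, 0 < c ∧ JacobiTransport.IsLastConstant R c) ∧
      ∀ c₁ : ℝ, 0 < c₁ → JacobiTransport.IsLastConstant R c₁ →
      ∀ η : ℝ, 7 * c₁ < η →
      ∀ (J : JacobiTransport.JacobiMatrix) (q : ℕ → ℕ) [∀ n, NeZero (q n)]
        (Jq : ℕ → JacobiTransport.JacobiMatrix),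
        J.IsRBounded R → JacobiTransport.JacobiMatrix.IsExpApprox η J q Jq →
        (∀ᶠ n in atTop, (Jq n).IsRBounded R) →
        ∃ N : ℕ, 1 ≤ N ∧ ∀ n : ℕ, N ≤ n →
          MemLp (JacobiTransport.circleQ (q n) (Jq n)) ∞
            (AddCircle.haarAddCircle : Measure UnitAddCircle) ∧
          ∀ (t ε : ℝ) (φ : JacobiTransport.L2Z),
            0 < t → JacobiTransport.gam η q n < ε →
            Memℓp (φ : ℤ → ℂ) 1 → ∀ hφ : φ ∈ JacobiTransport.positionOp.domain,
            ∃ hφt : φ ∈ (JacobiTransport.heisenbergX (Jq n) t).domain,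
              ‖JacobiTransport.opQ (q n) (Jq n) φ -
                  ((1 / t : ℝ) : ℂ) • JacobiTransport.heisenbergX (Jq n) t ⟨φ, hφt⟩‖ ≤
                1 / t * ‖JacobiTransport.positionOp ⟨φ, hφ⟩‖ +
                JacobiTransport.l1norm φ *
                  √(4 * R ^ 2 * (q n : ℝ) ^ 2 / (t ^ 2 * ε ^ 2) +
                    16 * R ^ 2 * (q n : ℝ) * Real.exp (c₁ * q (n - 1) / 2) * √ε) := by
  refine ⟨JacobiTransport.exists_isLastConstant hR, ?_⟩
  intro c₁ hc₁ hL η hη J q _ Jq _ hExp hbdd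
  obtain ⟨N, hN⟩ := eventually_atTop.mp
    ((hbdd.and (hExp.eventually_three_mul_norm_sub_le (by linarith))).and (eventually_ge_atTop 6))
  refine ⟨N + 1, Nat.le_add_left 1 N, fun n hn => ?_⟩
  obtain ⟨m, rfl⟩ : ∃ m, n = m + 1 := ⟨n - 1, by omega⟩
  obtain ⟨⟨hRm, hclose⟩, hm6⟩ := hN m (by omega)
  have hRn := (hN (m + 1) (by omega)).1.1
  -- A strictly increasing sequence of naturals satisfies `m ≤ q m`, so taking the index at least
  -- `6` makes the smaller period at least `6`.
  have hp : 6 ≤ q m := hm6.trans (hExp.strictMono.le_apply)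
  obtain ⟨r, hr⟩ := hExp.dvd m
  refine ⟨JacobiTransport.memLp_circleQ (q (m + 1)) (hExp.periodic (m + 1)) hRn, ?_⟩
  intro t ε φ ht hε hφ1 hφ
  have hε0 : 0 < ε := lt_of_le_of_lt (by unfold JacobiTransport.gam; positivity) hε
  exact JacobiTransport.norm_opQ_sub_heisenbergX_le ht
    (JacobiTransport.norm_opQ_sub_heisAvg_delta_le hL hr hp (hExp.periodic (m + 1)) hRn
      (hExp.periodic m) hRm hε0 ht (hclose.trans hε.le)) hφ1 hφ
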